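/- Let $d\in\{1,2,3\}$, $L_1,\dots,L_d>0$, $\Omega=\prod_{i=1}^d(0,L_i)$, $T>0$, $\alpha>0$, $\epsilon>0$, $Q\in\mathbb R$, and let the applied field $\boldsymbol h_e=\boldsymbol h_e(\boldsymbol x,t)\in\mathbb R^3$ be of class $C^2([0,T];C^0(\overline\Omega))$. For $\boldsymbol m\in\mathbb R^3$ put $\boldsymbol f(\boldsymbol m,\boldsymbol x,t)=-Q(m_2\boldsymbol e_2+m_3\boldsymbol e_3)+\boldsymbol h_e(\boldsymbol x,t)$ (there is no stray field). Let $\boldsymbol m_e\in C^3([0,T];C^0(\overline\Omega))\cap L^\infty([0,T];C^4(\overline\Omega))$ with $|\boldsymbol m_e|=1$ be a solution of the Landau–Lifshitz–Gilbert equation $$\boldsymbol m_t=-\boldsymbol m\times\boldsymbol h_{\rm eff}-\alpha\,\boldsymbol m\times(\boldsymbol m\times\boldsymbol h_{\rm eff}),\qquad \boldsymbol h_{\rm eff}=\epsilon\Delta\boldsymbol m+\boldsymbol f(\boldsymbol m,\boldsymbol x,t)\quad\text{in }\Omega\times(0,T),$$ with $\partial\boldsymbol m/\partial\nu=0$ on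 $\partial\Omega$. For step sizes $h,k>0$ such that every $N_i=L_i/h$ is an integer, consider the cell-centered grid with points $\boldsymbol x_I=\big((I_1-\tfrac12)h,\dots,(I_d-\tfrac12)h\big)$, $1\le I_i\le N_i$. Let $\Delta_h$ be the standard centered difference Laplacian, where ghost values are given by the discrete Neumann condition (the value in a ghost cell equals the value in the adjacent boundary cell), let $\nabla_h$ be the forward difference gradient with the same ghost values, and put $\|\boldsymbol g\|_2^2=h^d\sum_I|\boldsymbol g_I|^2$ and $\|\boldsymbol g\|_{H^1_h}=(\|\boldsymbol g\|_2^2+\|\nabla_h\boldsymbol g\|_2^2)^{1/2}$. Write $t^n=nk$. Let $\boldsymbol m_h^0=\boldsymbol m_e(\boldsymbol x_h,0)$, let $\boldsymbol m_h^1$ be a given grid function, and for $n\ge1$, $t^{n+1}\le T$, let $\boldsymbol m_h^{n+1}$ be given by the semi-implicit Crank–Nicolson scheme with projection $$\frac{\boldsymbol m_h^{n+1,*}-\boldsymbol m_h^n}{k}=-\hat{\boldsymbol m}_h\times\Big(\epsilon\Delta_h\frac{\boldsymbol m_h^{n+1,*}+\boldsymbol m_h^n}{2}+\hat{\boldsymbol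 f}_h\Big)-\alpha\,\hat{\boldsymbol m}_h\times\Big(\hat{\boldsymbol m}_h\times\Big(\epsilon\Delta_h\frac{\boldsymbol m_h^{n+1,*}+\boldsymbol m_h^n}{2}+\hat{\boldsymbol f}_h\Big)\Big),\qquad \boldsymbol m_h^{n+1}=\frac{\boldsymbol m_h^{n+1,*}}{|\boldsymbol m_h^{n+1,*}|},$$ where $\hat{\boldsymbol m}_h=\tfrac12(3\boldsymbol m_h^n-\boldsymbol m_h^{n-1})$, $\hat{\boldsymbol f}_h=\tfrac12(3\boldsymbol f_h^n-\boldsymbol f_h^{n-1})$ and $\boldsymbol f_h^n=\boldsymbol f(\boldsymbol m_h^n,\boldsymbol x_h,t^n)$. Let $\boldsymbol e^n=\boldsymbol m_h^n-\boldsymbol m_e(\boldsymbol x_h,t^n)$. Then for all constants $C_0,C_1$ there are $C>0$ and $\delta>0$, independent of $h$ and $k$ (and of the numerical solution), such that whenever $0<h,k<\delta$, $k\le C_1h$ and $\|\boldsymbol e^0\|_{H^1_h}+\|\boldsymbol e^1\|_{H^1_h}\le C_0(k^2+h^2)$, one has $$\|\boldsymbol e^n\|_{H^1_h}\le C(k^2+h^2)\qquad\text{for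 all }n\ge2\text{ with }nk\le T.$$ -/

import Mathlib

open Set MeasureTheory
open scoped BoundedContinuousFunction

namespace LLG

/-- Points of `ℝ^d`, with the Euclidean structure. -/
abbrev Space (d : ℕ) : Type := EuclideanSpace ℝ (Fin d)

/-- Values of the magnetization: `ℝ³` with the Euclidean norm. -/
abbrev Vec3 : Type := EuclideanSpace ℝ (Fin 3)

/-- The cross product on `ℝ³`. -/
def cross (a b : Vec3) : Vec3 := WithLp.toLp 2 (crossProduct a.ofLp b.ofLp)

/-- The right-hand side `-m × H - α m × (m × H)` of the Landau-Lifshitz-Gilbert equation. -/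
noncomputable def llgRhs (α : ℝ) (m H : Vec3) : Vec3 :=
  -cross m H - α • cross m (cross m H)

/-- The lower order part `-Q (m₂ e₂ + m₃ e₃) + hₑ` of the effective field (uniaxial anisotropy and
applied field, no stray field). The components `m₁, m₂, m₃` are numbered `0, 1, 2` here. -/
noncomputable def lowerField (Q : ℝ) (m he : Vec3) : Vec3 :=
  -(Q • (m 1 • EuclideanSpace.single (1 : Fin 3) (1 : ℝ)
      + m 2 • EuclideanSpace.single (2 : Fin 3) (1 : ℝ))) + he

/-- The open box `Ω = ∏ (0, Lᵢ)`. -/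
def openBox {d : ℕ} (L : Fin d → ℝ) : Set (Space d) := {x | ∀ i, x i ∈ Ioo 0 (L i)}

/-- The closed box `Ω̄ = ∏ [0, Lᵢ]`. -/
def closedBox {d : ℕ} (L : Fin d → ℝ) : Set (Space d) := {x | ∀ i, x i ∈ Icc 0 (L i)}

/-- `u ∈ C^r([0,T]; C^0(Ω̄; ℝ³))`: on `[0,T]` and `Ω̄`, `u` is given by an `r` times continuously
differentiable curve in the Banach space of (bounded) continuous functions on the compact set `Ω̄`
with the supremum norm. -/
def TimeRegular {d : ℕ} (L : Fin d → ℝ) (T : ℝ) (r : ℕ) (u : ℝ → Space d → Vec3) : Prop :=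
  ∃ U : ℝ → (closedBox L →ᵇ Vec3), ContDiffOn ℝ r U (Icc 0 T) ∧
    ∀ t ∈ Icc 0 T, ∀ x : closedBox L, U t x = u t x

/-- `u ∈ L^∞([0,T]; C^r(Ω̄; ℝ³))`: for almost every `t`, `u t` is `C^r` up to the boundary, with
derivatives up to order `r` bounded by a constant independent of `t`. -/
def SpaceRegular {d : ℕ} (L : Fin d → ℝ) (T : ℝ) (r : ℕ) (u : ℝ → Space d → Vec3) : Prop :=
  ∃ M : ℝ, ∀ᵐ t ∂(volume.restrict (Icc (0 : ℝ) T)),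
    ContDiffOn ℝ r (u t) (closedBox L) ∧
      ∀ j ≤ r, ∀ x ∈ closedBox L, ‖iteratedFDerivWithin ℝ j (u t) (closedBox L) x‖ ≤ M

open scoped Laplacian in
/-- `m` is a solution on `Ω × [0,T]` of the Landau-Lifshitz-Gilbert equation with exchange,
anisotropy and applied fields, with values in the unit sphere and homogeneous Neumann boundary
condition on each face `xᵢ = 0` and `xᵢ = Lᵢ` of the box. -/
structure IsLLGSolution {d : ℕ} (L : Fin d → ℝ) (T α ε Q : ℝ) (he m : ℝ → Space d → Vec3) :
    Prop where
  norm_eq_one : ∀ t ∈ Icc 0 T, ∀ x ∈ closedBox L, ‖m t x‖ = 1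
  equation : ∀ t ∈ Ioo 0 T, ∀ x ∈ openBox L,
    HasDerivAt (fun s => m s x)
      (llgRhs α (m t x) (ε • Δ (m t) x + lowerField Q (m t x) (he t x))) t
  neumann : ∀ t ∈ Icc 0 T, ∀ x ∈ closedBox L, ∀ i, (x i = 0 ∨ x i = L i) →
    HasLineDerivWithinAt ℝ (m t) 0 (closedBox L) x (EuclideanSpace.single i (1 : ℝ))

/-- Indices of the cells of the grid: `N i` cells in direction `i`, numbered from `0`. -/
abbrev Index {d : ℕ} (N : Fin d → ℕ) : Type := (i : Fin d) → Fin (N i)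

/-- Vector-valued grid functions (values at the cell centers). -/
abbrev GridFun {d : ℕ} (N : Fin d → ℕ) : Type := Index N → Vec3

/-- The center of the cell with index `I`; with indices from `0` its coordinates are
`(Iᵢ + 1/2) h`. -/
noncomputable def center {d : ℕ} {N : Fin d → ℕ} (h : ℝ) (I : Index N) : Space d :=
  WithLp.toLp 2 fun i => ((I i : ℕ) + 1 / 2 : ℝ) * h

/-- The value `f_{I + eᵢ}`; beyond the last cell it is the ghost value given by the discrete
Neumann condition, that is, the value in the last cell. -/
def next {d : ℕ} {N : Fin d → ℕ} (f : GridFun N) (i : Fin d) (I : Index N) : Vec3 :=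
  if hI : (I i : ℕ) + 1 < N i then f (Function.update I i ⟨(I i : ℕ) + 1, hI⟩) else f I

/-- The value `f_{I - eᵢ}`; before the first cell it is the ghost value given by the discrete
Neumann condition, that is, the value in the first cell. -/
def prev {d : ℕ} {N : Fin d → ℕ} (f : GridFun N) (i : Fin d) (I : Index N) : Vec3 :=
  if 0 < (I i : ℕ) then f (Function.update I i ⟨(I i : ℕ) - 1, by omega⟩) else f I

/-- The centered second order difference Laplacian `Δ_h` with discrete Neumann condition. -/
noncomputable def discreteLaplacian {d : ℕ} {N : Fin d → ℕ} (h : ℝ) (f : GridFun N) : GridFun N :=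
  fun I => ∑ i, (h ^ 2)⁻¹ • (next f i I - (2 : ℝ) • f I + prev f i I)

/-- `‖f‖₂² = ⟨f, f⟩ = h^d ∑_I |f_I|²`. -/
noncomputable def l2NormSq {d : ℕ} {N : Fin d → ℕ} (h : ℝ) (f : GridFun N) : ℝ :=
  h ^ d * ∑ I, ‖f I‖ ^ 2

/-- The component in direction `i` of the discrete gradient `∇_h f`. -/
noncomputable def discreteDeriv {d : ℕ} {N : Fin d → ℕ} (h : ℝ) (i : Fin d) (f : GridFun N) :
    GridFun N :=
  fun I => h⁻¹ • (next f i I - f I)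

/-- The discrete norm `‖f‖_{H¹_h} = (‖f‖₂² + ‖∇_h f‖₂²)^{1/2}`. -/
noncomputable def h1Norm {d : ℕ} {N : Fin d → ℕ} (h : ℝ) (f : GridFun N) : ℝ :=
  Real.sqrt (l2NormSq h f + ∑ i, l2NormSq h (discreteDeriv h i f))

/-- The lower order field `f_h^n` of the numerical solution at time `t^n = n k`. -/
noncomputable def gridField {d : ℕ} {N : Fin d → ℕ} (Q h k : ℝ) (he : ℝ → Space d → Vec3)
    (mh : ℕ → GridFun N) (n : ℕ) : GridFun N :=
  fun I => lowerField Q (mh n I) (he (n * k) (center h I))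

/-- The extrapolation `(3 u^n - u^{n-1}) / 2` to time `t^{n+1/2}`, for `n ≥ 1`. -/
noncomputable def extrapolate {d : ℕ} {N : Fin d → ℕ} (u : ℕ → GridFun N) (n : ℕ) : GridFun N :=
  fun I => (1 / 2 : ℝ) • ((3 : ℝ) • u n I - u (n - 1) I)

/-- `mh` (with intermediate magnetizations `ms`) is computed up to time `T` by the semi-implicit
Crank-Nicolson scheme with projection: for every `n ≥ 1` with `t^{n+1} ≤ T`, the value `ms (n+1)`
solves the linear system, and `mh (n+1)` is its pointwise normalization. The starting values
`mh 0` and `mh 1` are not constrained here. -/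
def IsSICNSolution {d : ℕ} {N : Fin d → ℕ} (T α ε Q h k : ℝ) (he : ℝ → Space d → Vec3)
    (mh ms : ℕ → GridFun N) : Prop :=
  ∀ n : ℕ, 1 ≤ n → ((n + 1 : ℕ) : ℝ) * k ≤ T → ∀ I : Index N,
    k⁻¹ • (ms (n + 1) I - mh n I)
        = llgRhs α (extrapolate mh n I)
            (ε • discreteLaplacian h (fun J => (1 / 2 : ℝ) • (ms (n + 1) J + mh n J)) I
              + extrapolate (gridField Q h k he mh) n I) ∧
      mh (n + 1) I = ‖ms (n + 1) I‖⁻¹ • ms (n + 1) I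

/-- The error `e^n = m_h^n - m_e(x_h, t^n)`. -/
noncomputable def error {d : ℕ} {N : Fin d → ℕ} (h k : ℝ) (me : ℝ → Space d → Vec3)
    (mh : ℕ → GridFun N) (n : ℕ) : GridFun N :=
  fun I => mh n I - me (n * k) (center h I)

end LLG

/-! ### Cross product algebra and the Landau–Lifshitz–Gilbert right-hand side. -/

namespace LLG

open scoped RealInnerProductSpace

/-! The proof combines stability with consistency, and both refer to a corrected solution u near
$m_e$ instead of $m_e$ itself.

Stability. Let a be the extrapolated numerical value, e the error, e* the error before projection,
and D the discrete Laplacian of (e* + e)/2. Testing the error equation with -D, the exchange term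
yields the dissipation $k\epsilon\alpha\|a\times D\|^2$ (`inner_llgRhs_right`), so only the part of
D orthogonal to a is damped. The part along a is harmless because of the length constraint: a unit
field satisfies $\langle m,\Delta_h m\rangle=-\frac12|\nabla m|^2$ (`inner_lap_of_unit`), so
$\langle a,D\rangle$ is bounded by first differences of the errors, apart from residuals and a term
$h^{-1}\cdot$(error)² (`abs_inner_lap_avg_le`). It is multiplied by the component along a of the
reference increment, which is O(kh) as long as the error is at most h in the maximum norm, and this
cancels $h^{-1}$ (`ErrStep.energy_le`).

Since the increment of the scheme is orthogonal to a, the intermediate value leaves the sphere only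
by O(k) times the dissipated quantity plus errors (`ErrStep.abs_norm_sub_one_le`). The projection
costs this deviation times the error and its first differences (`h1Sq_projection_le`), and the
unused half of the dissipation pays for it. One step thus has growth factor 1 + Ck
(`exists_step_const`). The first step is separate, since the value at level 1 need not be a unit
field; a fixed factor suffices there (`exists_first_step_const`). The maximum norm bound is
recovered from the H¹ bound, for d ≤ 3, by `exists_norm_le_mesh`, and a discrete Gronwall induction
closes in `exists_stability`.

Consistency. With ghost values the discrete Laplacian is only first order accurate in boundary
cells. To second order its defect is 1/24 times the sum, over the neighbours, of the differences of
$\Delta m_e$; in interior cells this sum is O(h²) anyway. Adding $h^2z$ with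
$z\approx-\frac1{24}\Delta m_e$ therefore removes the defect. Only the tangential part is needed,
because the equation does not see the component of the field along m (`llgRhs_self`), and z can be
adjusted so that $u=m_e+h^2z$ has unit length exactly (`norm_add_correction_eq_one`,
`RefData.refLevel`).

No mixed space-time derivatives are assumed. The tangential exchange field is recovered
algebraically from $m_e$, its time derivative and the lower order field, so it inherits bounded
second difference quotients in time (`exchField_of_llgRhs`); the normal part is governed by $|\nabla
u|^2$. Interpolation between smallness in time and smoothness in space (`sq_norm_nbr_diff_le`),
followed by summation by parts, controls time increments of gradients and Laplacians well enough for
residuals of size O(k² + h²) in ℓ² (`refStep_and_refResidual`). Finally $u-m_e$ is O(h²) in discrete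
H¹, so the estimate passes from u to $m_e$. -/

theorem inner_eq_sum (a b : Vec3) : ⟪a, b⟫ = a 0 * b 0 + a 1 * b 1 + a 2 * b 2 := by
  simp [PiLp.inner_apply, Fin.sum_univ_three]; ring

theorem cross_apply_zero (a b : Vec3) : cross a b 0 = a 1 * b 2 - a 2 * b 1 := by
  simp [cross, crossProduct]

theorem cross_apply_one (a b : Vec3) : cross a b 1 = a 2 * b 0 - a 0 * b 2 := by
  simp [cross, crossProduct]

theorem cross_apply_two (a b : Vec3) : cross a b 2 = a 0 * b 1 - a 1 * b 0 := by
  simp [cross, crossProduct]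

theorem vec3_ext {a b : Vec3} (h0 : a 0 = b 0) (h1 : a 1 = b 1) (h2 : a 2 = b 2) : a = b := by
  ext i; fin_cases i <;> assumption

theorem cross_add_left (a b c : Vec3) : cross (a + b) c = cross a c + cross b c := by
  apply vec3_ext <;> simp only [PiLp.add_apply, cross_apply_zero, cross_apply_one, cross_apply_two]
    <;> ring

theorem cross_add_right (a b c : Vec3) : cross a (b + c) = cross a b + cross a c := by
  apply vec3_ext <;> simp only [PiLp.add_apply, cross_apply_zero, cross_apply_one, cross_apply_two]
    <;> ring

theorem cross_smul_left (r : ℝ) (a b : Vec3) : cross (r • a) b = r • cross a b := by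
  apply vec3_ext <;> simp only [PiLp.smul_apply, smul_eq_mul, cross_apply_zero, cross_apply_one,
    cross_apply_two] <;> ring

theorem cross_smul_right (r : ℝ) (a b : Vec3) : cross a (r • b) = r • cross a b := by
  apply vec3_ext <;> simp only [PiLp.smul_apply, smul_eq_mul, cross_apply_zero, cross_apply_one,
    cross_apply_two] <;> ring

theorem cross_sub_left (a b c : Vec3) : cross (a - b) c = cross a c - cross b c := by
  apply vec3_ext <;> simp only [PiLp.sub_apply, cross_apply_zero, cross_apply_one, cross_apply_two]
    <;> ring

theorem cross_sub_right (a b c : Vec3) : cross a (b - c) = cross a b - cross a c := by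
  apply vec3_ext <;> simp only [PiLp.sub_apply, cross_apply_zero, cross_apply_one, cross_apply_two]
    <;> ring

theorem cross_neg_right (a b : Vec3) : cross a (-b) = -cross a b := by
  apply vec3_ext <;> simp only [PiLp.neg_apply, cross_apply_zero, cross_apply_one, cross_apply_two]
    <;> ring

theorem cross_self (a : Vec3) : cross a a = 0 := by
  apply vec3_ext <;> simp only [PiLp.zero_apply, cross_apply_zero, cross_apply_one, cross_apply_two]
    <;> ring

theorem inner_cross_left (a b : Vec3) : ⟪a, cross a b⟫ = 0 := by
  simp only [inner_eq_sum, cross_apply_zero, cross_apply_one, cross_apply_two]; ring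

theorem inner_cross_right (a b : Vec3) : ⟪b, cross a b⟫ = 0 := by
  simp only [inner_eq_sum, cross_apply_zero, cross_apply_one, cross_apply_two]; ring

theorem inner_cross_swap (a b c : Vec3) : ⟪cross a b, c⟫ = -⟪b, cross a c⟫ := by
  simp only [inner_eq_sum, cross_apply_zero, cross_apply_one, cross_apply_two]; ring

theorem inner_cross_cross (a b c : Vec3) :
    ⟪cross a b, cross a c⟫ = ‖a‖ ^ 2 * ⟪b, c⟫ - ⟪a, b⟫ * ⟪a, c⟫ := by
  rw [← real_inner_self_eq_norm_sq]
  simp only [inner_eq_sum, cross_apply_zero, cross_apply_one, cross_apply_two]; ring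

theorem cross_cross (a b : Vec3) : cross a (cross a b) = ⟪a, b⟫ • a - ‖a‖ ^ 2 • b := by
  rw [← real_inner_self_eq_norm_sq]
  apply vec3_ext <;> simp only [PiLp.sub_apply, PiLp.smul_apply, smul_eq_mul, inner_eq_sum,
    cross_apply_zero, cross_apply_one, cross_apply_two] <;> ring

theorem norm_cross_le (a b : Vec3) : ‖cross a b‖ ≤ ‖a‖ * ‖b‖ := by
  apply abs_le_of_sq_le_sq' _ (by positivity) |>.2
  have := inner_cross_cross a b b
  rw [real_inner_self_eq_norm_sq, real_inner_self_eq_norm_sq] at this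
  nlinarith [sq_nonneg ⟪a, b⟫]

theorem llgRhs_add (α : ℝ) (m H K : Vec3) :
    llgRhs α m (H + K) = llgRhs α m H + llgRhs α m K := by
  simp only [llgRhs, cross_add_right]; module

theorem llgRhs_sub (α : ℝ) (m H K : Vec3) :
    llgRhs α m (H - K) = llgRhs α m H - llgRhs α m K := by
  simp only [llgRhs, cross_sub_right]; module

theorem llgRhs_smul (α r : ℝ) (m H : Vec3) : llgRhs α m (r • H) = r • llgRhs α m H := by
  simp only [llgRhs, cross_smul_right]; module

/-- The component of the field along m is invisible to the equation. This allows the consistency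
analysis to match only tangential parts of the exchange field. -/
theorem llgRhs_self (α : ℝ) (m : Vec3) : llgRhs α m m = 0 := by
  simp [llgRhs, cross_self]
  rw [show cross m 0 = 0 by simpa using cross_smul_right 0 m m]; simp

/-- Applied to the scheme, this makes every increment orthogonal to the extrapolated value; the
control of normal components and of the projection rests on it. -/
theorem inner_llgRhs (α : ℝ) (m H : Vec3) : ⟪m, llgRhs α m H⟫ = 0 := by
  simp [llgRhs, inner_sub_right, inner_smul_right, inner_cross_left]

/-- Bounding by the cross product and not by the full field matters: the dissipation controls m × H
but not H. -/
theorem norm_llgRhs_le_cross (α : ℝ) (m H : Vec3) :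
    ‖llgRhs α m H‖ ≤ (1 + |α| * ‖m‖) * ‖cross m H‖ := by
  rw [llgRhs]
  calc _ ≤ ‖-cross m H‖ + ‖α • cross m (cross m H)‖ := norm_sub_le _ _
    _ ≤ ‖cross m H‖ + |α| * (‖m‖ * ‖cross m H‖) := by
        rw [norm_neg, norm_smul, Real.norm_eq_abs]; gcongr; exact norm_cross_le _ _
    _ = _ := by ring

theorem norm_llgRhs_le (α : ℝ) (m H : Vec3) :
    ‖llgRhs α m H‖ ≤ (1 + |α| * ‖m‖) * (‖m‖ * ‖H‖) :=
  (norm_llgRhs_le_cross α m H).trans (by gcongr; exact norm_cross_le _ _)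

theorem norm_llgRhs_sub_le (α : ℝ) (m n H : Vec3) :
    ‖llgRhs α m H - llgRhs α n H‖ ≤ (1 + |α| * (‖m‖ + ‖n‖)) * ‖m - n‖ * ‖H‖ := by
  have : llgRhs α m H - llgRhs α n H = -cross (m - n) H
      - α • (cross m (cross (m - n) H) + cross (m - n) (cross n H)) := by
    simp only [llgRhs, cross_sub_left, cross_sub_right]; module
  rw [this]
  calc _ ≤ ‖-cross (m - n) H‖
        + ‖α • (cross m (cross (m - n) H) + cross (m - n) (cross n H))‖ := norm_sub_le _ _
    _ ≤ ‖m - n‖ * ‖H‖ + |α| * (‖m‖ * (‖m - n‖ * ‖H‖) + ‖m - n‖ * (‖n‖ * ‖H‖)) := by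
        rw [norm_neg, norm_smul, Real.norm_eq_abs]
        gcongr
        · exact norm_cross_le _ _
        · refine (norm_add_le _ _).trans ?_
          gcongr
          · exact (norm_cross_le _ _).trans (by gcongr; exact norm_cross_le _ _)
          · exact (norm_cross_le _ _).trans (by gcongr; exact norm_cross_le _ _)
    _ = _ := by ring

/-- Testing the equation: the exchange term only damps the component orthogonal to `m`. -/
theorem inner_llgRhs_right (α : ℝ) (m H : Vec3) : ⟪llgRhs α m H, H⟫ = α * ‖cross m H‖ ^ 2 := by
  rw [llgRhs, inner_sub_left, inner_neg_left, inner_smul_left, inner_cross_swap m (cross m H),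
    real_inner_self_eq_norm_sq, real_inner_comm, inner_cross_right]
  simp

/-- Skew-symmetry of m × moves the cross product onto H, so a perturbation F of the field is paired
with the dissipated quantity only. -/
theorem abs_inner_llgRhs_le (α : ℝ) (m F H : Vec3) :
    |⟪llgRhs α m F, H⟫| ≤ (1 + |α| * ‖m‖) * ‖F‖ * ‖cross m H‖ := by
  have : ⟪llgRhs α m F, H⟫ = ⟪F, cross m H⟫ + α * ⟪cross m F, cross m H⟫ := by
    rw [llgRhs, inner_sub_left, inner_neg_left, inner_smul_left, inner_cross_swap m (cross m F),
      inner_cross_swap]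
    simp
  rw [this]
  calc _ ≤ |⟪F, cross m H⟫| + |α * ⟪cross m F, cross m H⟫| := abs_add_le _ _
    _ ≤ ‖F‖ * ‖cross m H‖ + |α| * ((‖m‖ * ‖F‖) * ‖cross m H‖) := by
        rw [abs_mul]
        gcongr
        · exact abs_real_inner_le_norm _ _
        · exact (abs_real_inner_le_norm _ _).trans (by gcongr; exact norm_cross_le _ _)
    _ = _ := by ring

theorem lowerField_sub (Q : ℝ) (m n a b : Vec3) :
    lowerField Q m a - lowerField Q n b = lowerField Q (m - n) (a - b) := by
  simp only [lowerField, PiLp.sub_apply]; module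

theorem lowerField_add (Q : ℝ) (m n a b : Vec3) :
    lowerField Q m a + lowerField Q n b = lowerField Q (m + n) (a + b) := by
  simp only [lowerField, PiLp.add_apply]; module

theorem lowerField_smul (Q r : ℝ) (m a : Vec3) :
    r • lowerField Q m a = lowerField Q (r • m) (r • a) := by
  simp only [lowerField, PiLp.smul_apply, smul_eq_mul]; module

theorem norm_lowerField_le (Q : ℝ) (m a : Vec3) : ‖lowerField Q m a‖ ≤ |Q| * ‖m‖ + ‖a‖ := by
  refine (norm_add_le _ _).trans ?_
  rw [norm_neg, norm_smul, Real.norm_eq_abs]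
  gcongr
  apply abs_le_of_sq_le_sq' _ (by positivity) |>.2
  rw [← real_inner_self_eq_norm_sq, ← real_inner_self_eq_norm_sq, inner_eq_sum, inner_eq_sum]
  simp
  nlinarith [sq_nonneg (m 0)]

/-- The component of `b` orthogonal to a unit vector `v`. -/
noncomputable def perp (v b : Vec3) : Vec3 := b - ⟪v, b⟫ • v

theorem perp_sub (v b c : Vec3) : perp v (b - c) = perp v b - perp v c := by
  simp only [perp, inner_sub_right]; module

theorem perp_add (v b c : Vec3) : perp v (b + c) = perp v b + perp v c := by
  simp only [perp, inner_add_right]; module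

theorem perp_smul (r : ℝ) (v b : Vec3) : perp v (r • b) = r • perp v b := by
  simp only [perp, inner_smul_right]; module

theorem inner_perp {v : Vec3} (hv : ‖v‖ = 1) (b : Vec3) : ⟪v, perp v b⟫ = 0 := by
  simp [perp, inner_sub_right, inner_smul_right, hv]

theorem norm_perp_le {v : Vec3} (hv : ‖v‖ = 1) (b : Vec3) : ‖perp v b‖ ≤ ‖b‖ := by
  apply abs_le_of_sq_le_sq' _ (by positivity) |>.2
  have h : ‖perp v b‖ ^ 2 = ‖b‖ ^ 2 - ⟪v, b⟫ ^ 2 := by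
    rw [perp, norm_sub_sq_real, inner_smul_right, norm_smul, hv, Real.norm_eq_abs, mul_one, sq_abs,
      real_inner_comm]
    ring
  nlinarith [sq_nonneg ⟪v, b⟫]

theorem norm_perp_sub_perp_le {v w : Vec3} (hv : ‖v‖ = 1) (hw : ‖w‖ = 1) (b : Vec3) :
    ‖perp v b - perp w b‖ ≤ 2 * ‖v - w‖ * ‖b‖ := by
  have : perp v b - perp w b = -(⟪v - w, b⟫ • v + ⟪w, b⟫ • (v - w)) := by
    simp only [perp, inner_sub_left]; module
  rw [this, norm_neg]
  calc _ ≤ ‖⟪v - w, b⟫ • v‖ + ‖⟪w, b⟫ • (v - w)‖ := norm_add_le _ _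
    _ ≤ ‖v - w‖ * ‖b‖ + (1 * ‖b‖) * ‖v - w‖ := by
        rw [norm_smul, norm_smul, hv, mul_one, Real.norm_eq_abs, Real.norm_eq_abs, ← hw]
        gcongr <;> exact abs_real_inner_le_norm _ _
    _ = _ := by ring

/-- The tangential part of the effective field, recovered from the time derivative. -/
theorem perp_eq_of_llgRhs {α : ℝ} {v H : Vec3} (hv : ‖v‖ = 1) :
    perp v H = (1 + α ^ 2)⁻¹ • (α • llgRhs α v H + cross v (llgRhs α v H)) := by
  have h1 : llgRhs α v H = -cross v H + α • perp v H := by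
    rw [llgRhs, cross_cross, hv, perp]; module
  have h2 : cross v (perp v H) = cross v H := by
    rw [perp, cross_sub_right, cross_smul_right, cross_self]; simp
  rw [h1, cross_add_right, cross_smul_right, h2, cross_neg_right, cross_cross, hv]
  have h3 : (0 : ℝ) < 1 + α ^ 2 := by positivity
  rw [eq_inv_smul_iff₀ h3.ne', perp]; module

/-- A tangent vector is the right-hand side for the tangential field computed from it. -/
theorem llgRhs_of_perp {α : ℝ} {v z : Vec3} (hv : ‖v‖ = 1) (hz : ⟪v, z⟫ = 0) :
    llgRhs α v ((1 + α ^ 2)⁻¹ • (α • z + cross v z)) = z := by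
  have h3 : (0 : ℝ) < 1 + α ^ 2 := by positivity
  rw [llgRhs_smul, inv_smul_eq_iff₀ h3.ne', llgRhs_add, llgRhs_smul, llgRhs, llgRhs]
  simp only [cross_cross, hz, hv, cross_sub_right, cross_smul_right]
  simp only [cross_self]
  module

end LLG

/-! ### Discrete calculus: neighbours, product rule, summation by parts, the H¹ norm. -/

namespace LLG

open scoped RealInnerProductSpace

section Grid

variable {d : ℕ} {N : Fin d → ℕ} {F : Type*} [NormedAddCommGroup F] [InnerProductSpace ℝ F]

/-- The neighbour of a cell in direction `p.1`, upwards if `p.2` and downwards otherwise; a cell at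
the boundary is its own neighbour in the outward direction. -/
def nbr (I : Index N) (p : Fin d × Bool) : Index N :=
  if p.2 then
    if hI : (I p.1 : ℕ) + 1 < N p.1 then Function.update I p.1 ⟨(I p.1 : ℕ) + 1, hI⟩ else I
  else if 0 < (I p.1 : ℕ) then Function.update I p.1 ⟨(I p.1 : ℕ) - 1, by omega⟩ else I

theorem next_eq_nbr (f : GridFun N) (i : Fin d) (I : Index N) :
    next f i I = f (nbr I (i, true)) := by
  simp only [next, nbr, if_true]; split_ifs <;> rfl

theorem prev_eq_nbr (f : GridFun N) (i : Fin d) (I : Index N) :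
    prev f i I = f (nbr I (i, false)) := by
  simp only [prev, nbr, Bool.false_eq_true, if_false]; split_ifs <;> rfl

theorem nbr_nbr {I : Index N} {p : Fin d × Bool} (h : nbr I p ≠ I) :
    nbr (nbr I p) (p.1, !p.2) = I := by
  obtain ⟨i, b⟩ := p
  cases b
  · by_cases hI : 0 < (I i : ℕ)
    · have h1 : nbr I (i, false) = Function.update I i ⟨(I i : ℕ) - 1, by omega⟩ := by
        simp [nbr, hI]
      rw [h1, nbr]
      have h2 : (I i : ℕ) - 1 + 1 < N i := by omega
      simp only [Bool.not_false, if_true, Function.update_self, h2, dite_true,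
        Function.update_idem]
      convert Function.update_eq_self i I
      omega
    · simp [nbr, hI] at h
  · by_cases hI : (I i : ℕ) + 1 < N i
    · have h1 : nbr I (i, true) = Function.update I i ⟨(I i : ℕ) + 1, hI⟩ := by
        simp [nbr, hI]
      rw [h1, nbr]
      simp
    · simp [nbr, hI] at h

/-- Reversing an edge is an involution on pairs (cell, direction); an outward direction at the
boundary gives a self-loop, which is fixed. The discrete Neumann condition thus produces no boundary
terms. -/
theorem sum_nbr_symm (φ : Index N → Index N → ℝ) :
    ∑ I, ∑ p, φ I (nbr I p) = ∑ I, ∑ p, φ (nbr I p) I := by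
  classical
  let σ : Index N × (Fin d × Bool) → Index N × (Fin d × Bool) := fun x =>
    if nbr x.1 x.2 = x.1 then x else (nbr x.1 x.2, (x.2.1, !x.2.2))
  have hσ : Function.Involutive σ := by
    rintro ⟨I, p⟩
    by_cases h : nbr I p = I
    · simp [σ, h]
    · have h' : nbr (nbr I p) (p.1, !p.2) ≠ nbr I p := by rw [nbr_nbr h]; exact Ne.symm h
      have h1 : σ (I, p) = (nbr I p, (p.1, !p.2)) := by simp [σ, h]
      have h2 : σ (nbr I p, (p.1, !p.2)) = (nbr (nbr I p) (p.1, !p.2), (p.1, !!p.2)) := by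
        simp [σ, h']
      rw [h1, h2, nbr_nbr h]; simp
  rw [← Fintype.sum_prod_type', ← Fintype.sum_prod_type']
  refine Fintype.sum_equiv hσ.toPerm _ _ ?_
  rintro ⟨I, p⟩
  by_cases h : nbr I p = I
  · simp [σ, h]
  · simp [σ, h, nbr_nbr h]

/-- All one-sided difference quotients of a grid function at a cell. -/
noncomputable def grad (h : ℝ) (f : Index N → F) (I : Index N) :
    PiLp 2 (fun _ : Fin d × Bool => F) :=
  WithLp.toLp 2 fun p => h⁻¹ • (f (nbr I p) - f I)

/-- The centered difference Laplacian, as the sum of the differences over all neighbours. -/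
noncomputable def lap (h : ℝ) (f : Index N → F) (I : Index N) : F :=
  (h ^ 2)⁻¹ • ∑ p, (f (nbr I p) - f I)

/-- The integral `h^d ∑_I φ_I`. -/
noncomputable def gridSum (h : ℝ) (φ : Index N → ℝ) : ℝ := h ^ d * ∑ I, φ I

theorem discreteLaplacian_eq_lap (h : ℝ) (f : GridFun N) : discreteLaplacian h f = lap h f := by
  ext1 I
  rw [discreteLaplacian, lap, Fintype.sum_prod_type, Finset.smul_sum]
  refine Finset.sum_congr rfl fun i _ => ?_
  rw [Fintype.sum_bool, ← next_eq_nbr f, ← prev_eq_nbr f]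
  module

theorem grad_apply (h : ℝ) (f : Index N → F) (I : Index N) (p : Fin d × Bool) :
    grad h f I p = h⁻¹ • (f (nbr I p) - f I) := rfl

theorem inner_grad (h : ℝ) (f g : Index N → F) (I : Index N) :
    ⟪grad h f I, grad h g I⟫ =
      (h ^ 2)⁻¹ * ∑ p, ⟪f (nbr I p) - f I, g (nbr I p) - g I⟫ := by
  rw [PiLp.inner_apply, Finset.mul_sum]
  refine Finset.sum_congr rfl fun p _ => ?_
  rw [grad_apply, grad_apply, inner_smul_left, inner_smul_right]
  simp; ring

theorem grad_add (h : ℝ) (f g : Index N → F) (I : Index N) :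
    grad h (f + g) I = grad h f I + grad h g I := by
  ext1 p; simp only [grad_apply, Pi.add_apply, PiLp.add_apply]; module

theorem grad_sub (h : ℝ) (f g : Index N → F) (I : Index N) :
    grad h (f - g) I = grad h f I - grad h g I := by
  ext1 p; simp only [grad_apply, Pi.sub_apply, PiLp.sub_apply]; module

theorem grad_smul (h r : ℝ) (f : Index N → F) (I : Index N) :
    grad h (r • f) I = r • grad h f I := by
  ext1 p; simp only [grad_apply, Pi.smul_apply, PiLp.smul_apply]; module

theorem lap_add (h : ℝ) (f g : Index N → F) (I : Index N) :
    lap h (f + g) I = lap h f I + lap h g I := by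
  rw [lap, lap, lap, ← smul_add, ← Finset.sum_add_distrib]
  congr 1; refine Finset.sum_congr rfl fun p _ => ?_
  simp only [Pi.add_apply]; module

theorem lap_smul (h r : ℝ) (f : Index N → F) (I : Index N) :
    lap h (r • f) I = r • lap h f I := by
  rw [lap, lap, smul_comm r, Finset.smul_sum (r := r)]
  congr 1; refine Finset.sum_congr rfl fun p _ => ?_
  simp only [Pi.smul_apply]; module

theorem lap_sub (h : ℝ) (f g : Index N → F) (I : Index N) :
    lap h (f - g) I = lap h f I - lap h g I := by
  rw [show f - g = f + (-1 : ℝ) • g by module, lap_add, lap_smul]; module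

/-- The discrete product rule. -/
theorem lap_inner (h : ℝ) (f g : Index N → F) (I : Index N) :
    lap h (fun J => ⟪f J, g J⟫) I =
      ⟪f I, lap h g I⟫ + ⟪g I, lap h f I⟫ + ⟪grad h f I, grad h g I⟫ := by
  rw [inner_grad, lap, lap, lap, inner_smul_right, inner_smul_right, inner_sum, inner_sum,
    smul_eq_mul, ← mul_add, ← mul_add, ← Finset.sum_add_distrib, ← Finset.sum_add_distrib]
  congr 1; refine Finset.sum_congr rfl fun p _ => ?_
  simp only [inner_sub_left, inner_sub_right, real_inner_comm (f I), real_inner_comm (f (nbr I p))]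
  ring

/-- The product rule applied to the constant function |u|². The normal part of the Laplacian of a
unit field costs only first differences. -/
theorem inner_lap_of_unit (h : ℝ) {u : Index N → F} (hu : ∀ I, ‖u I‖ = 1) (I : Index N) :
    ⟪u I, lap h u I⟫ = -(1 / 2) * ‖grad h u I‖ ^ 2 := by
  have h1 := lap_inner h u u I
  simp only [real_inner_self_eq_norm_sq, hu] at h1
  simp [lap] at h1 ⊢
  linarith

theorem norm_grad_apply_le (h : ℝ) (f : Index N → F) (I : Index N) (p : Fin d × Bool) :
    ‖h⁻¹ • (f (nbr I p) - f I)‖ ≤ ‖grad h f I‖ := by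
  rw [← grad_apply]; exact PiLp.norm_apply_le _ _

theorem norm_sub_le_mul_grad {h : ℝ} (hh : 0 < h) (f : Index N → F) (I : Index N)
    (p : Fin d × Bool) : ‖f (nbr I p) - f I‖ ≤ h * ‖grad h f I‖ := by
  have := norm_grad_apply_le h f I p
  rwa [norm_smul, norm_inv, Real.norm_eq_abs, abs_of_pos hh, inv_mul_le_iff₀ hh] at this

/-- An inverse estimate over the 2d neighbours. Combined with k ≤ K h it trades one factor h or k
for one difference. -/
theorem mul_norm_lap_le {h : ℝ} (hh : 0 < h) (f : Index N → F) (I : Index N) :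
    h * ‖lap h f I‖ ≤ 2 * d * ‖grad h f I‖ := by
  have h1 : ‖∑ p, (f (nbr I p) - f I)‖ ≤ 2 * d * (h * ‖grad h f I‖) := by
    refine (norm_sum_le_of_le _ fun p _ => norm_sub_le_mul_grad hh f I p).trans_eq ?_
    rw [Finset.sum_const, Finset.card_univ, Fintype.card_prod, Fintype.card_fin,
      Fintype.card_bool, nsmul_eq_mul]; push_cast; ring
  rw [lap, norm_smul, norm_inv, norm_pow, Real.norm_eq_abs, abs_of_pos hh]
  calc h * ((h ^ 2)⁻¹ * ‖∑ p, (f (nbr I p) - f I)‖)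
      ≤ h * ((h ^ 2)⁻¹ * (2 * d * (h * ‖grad h f I‖))) := by gcongr
    _ = _ := by field_simp

theorem norm_grad_le_of_forall {h c : ℝ} (hc : 0 ≤ c) (f : Index N → F) (I : Index N)
    (H : ∀ p, ‖h⁻¹ • (f (nbr I p) - f I)‖ ≤ c) : ‖grad h f I‖ ≤ 2 * d * c := by
  rw [PiLp.norm_eq_of_L2]
  refine Real.sqrt_le_iff.2 ⟨by positivity, ?_⟩
  calc _ ≤ ∑ _p : Fin d × Bool, c ^ 2 := by
        gcongr with p; exact H p
    _ = 2 * d * c ^ 2 := by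
        rw [Finset.sum_const, Finset.card_univ, Fintype.card_prod, Fintype.card_fin,
      Fintype.card_bool, nsmul_eq_mul]; push_cast; ring
    _ ≤ _ := by
        rcases Nat.eq_zero_or_pos d with rfl | hd
        · simp
        have : (1 : ℝ) ≤ d := by exact_mod_cast hd
        nlinarith [mul_nonneg (mul_nonneg (by linarith : (0 : ℝ) ≤ d) (sq_nonneg c))
          (by linarith : (0 : ℝ) ≤ d - 1), mul_nonneg (by linarith : (0 : ℝ) ≤ d) (sq_nonneg c)]

theorem gridSum_add (h : ℝ) (φ ψ : Index N → ℝ) :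
    gridSum h (fun I => φ I + ψ I) = gridSum h φ + gridSum h ψ := by
  simp only [gridSum, Finset.sum_add_distrib]; ring

theorem gridSum_sub (h : ℝ) (φ ψ : Index N → ℝ) :
    gridSum h (fun I => φ I - ψ I) = gridSum h φ - gridSum h ψ := by
  simp only [gridSum, Finset.sum_sub_distrib]; ring

theorem gridSum_mul (h c : ℝ) (φ : Index N → ℝ) :
    gridSum h (fun I => c * φ I) = c * gridSum h φ := by
  simp only [gridSum, ← Finset.mul_sum]; ring

theorem gridSum_mono {h : ℝ} (hh : 0 < h) {φ ψ : Index N → ℝ} (H : ∀ I, φ I ≤ ψ I) :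
    gridSum h φ ≤ gridSum h ψ := by
  unfold gridSum; gcongr with I; exact H I

theorem gridSum_nonneg {h : ℝ} (hh : 0 < h) {φ : Index N → ℝ} (H : ∀ I, 0 ≤ φ I) :
    0 ≤ gridSum h φ :=
  mul_nonneg (by positivity) (Finset.sum_nonneg fun I _ => H I)

theorem gridSum_const {h : ℝ} {L : Fin d → ℝ} (hN : ∀ i, (N i : ℝ) * h = L i) (c : ℝ) :
    gridSum h (fun _ : Index N => c) = (∏ i, L i) * c := by
  simp only [gridSum, Finset.sum_const, Finset.card_univ, Fintype.card_pi, Fintype.card_fin,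
    nsmul_eq_mul, Nat.cast_prod, ← hN, Finset.prod_mul_distrib, Finset.prod_const]
  ring

theorem pow_mul_le_gridSum {h : ℝ} (hh : 0 < h) {φ : Index N → ℝ} (H : ∀ I, 0 ≤ φ I)
    (I : Index N) : h ^ d * φ I ≤ gridSum h φ := by
  unfold gridSum; gcongr
  exact Finset.single_le_sum (fun J _ => H J) (Finset.mem_univ I)

/-- Summation by parts. -/
theorem gridSum_inner_lap (h : ℝ) (f g : Index N → F) :
    gridSum h (fun I => ⟪f I, lap h g I⟫)
      = -(1 / 2) * gridSum h (fun I => ⟪grad h f I, grad h g I⟫) := by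
  have h1 := sum_nbr_symm (N := N) fun I J => ⟪f I, g J - g I⟫
  have h2 : ∑ I : Index N, ∑ p, ⟪f (nbr I p) - f I, g (nbr I p) - g I⟫
      = -2 * ∑ I : Index N, ∑ p, ⟪f I, g (nbr I p) - g I⟫ := by
    have : ∑ I : Index N, ∑ p, ⟪f (nbr I p) - f I, g (nbr I p) - g I⟫
      = -(∑ I : Index N, ∑ p, ⟪f (nbr I p), g I - g (nbr I p)⟫)
        - ∑ I : Index N, ∑ p, ⟪f I, g (nbr I p) - g I⟫ := by
      rw [← Finset.sum_neg_distrib, ← Finset.sum_sub_distrib]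
      refine Finset.sum_congr rfl fun I _ => ?_
      rw [← Finset.sum_neg_distrib, ← Finset.sum_sub_distrib]
      refine Finset.sum_congr rfl fun p _ => ?_
      simp only [inner_sub_left, inner_sub_right]; ring
    rw [this, ← h1]; ring
  simp only [gridSum, inner_grad, lap, inner_smul_right, inner_sum, ← Finset.mul_sum, h2]
  ring

theorem gridSum_sq_grad (h : ℝ) (f : Index N → F) :
    gridSum h (fun I => ‖grad h f I‖ ^ 2) = -2 * gridSum h (fun I => ⟪f I, lap h f I⟫) := by
  rw [gridSum_inner_lap]; simp only [real_inner_self_eq_norm_sq]; ring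

/-- The square of the discrete `H¹` norm. -/
noncomputable def h1Sq (h : ℝ) (f : Index N → F) : ℝ :=
  gridSum h (fun I => ‖f I‖ ^ 2) + 1 / 2 * gridSum h (fun I => ‖grad h f I‖ ^ 2)

/-- `grad` lists both one-sided differences, so each edge between two cells is counted twice; this
is the origin of the factor 1/2 in `h1Sq`. -/
theorem h1Norm_eq_sqrt (h : ℝ) (f : GridFun N) : h1Norm h f = Real.sqrt (h1Sq h f) := by
  rw [h1Norm, h1Sq]
  congr 2
  have key : ∀ i : Fin d, ∑ I : Index N, ‖f (nbr I (i, true)) - f I‖ ^ 2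
      = ∑ I : Index N, ‖f (nbr I (i, false)) - f I‖ ^ 2 := by
    intro i
    classical
    -- Only nonzero terms are matched: at the last cell the upper neighbour is the cell itself, and
    -- the map to the neighbour is not injective there.
    refine Finset.sum_bij_ne_zero (fun I _ _ => nbr I (i, true)) (fun _ _ _ => Finset.mem_univ _)
      ?_ ?_ ?_
    · intro I _ hI J _ hJ hIJ
      have hI' : nbr I (i, true) ≠ I := fun h0 => by simp [h0] at hI
      have hJ' : nbr J (i, true) ≠ J := fun h0 => by simp [h0] at hJ
      have e1 := nbr_nbr hI'
      have e2 := nbr_nbr hJ'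
      rw [hIJ] at e1
      exact e1.symm.trans e2
    · intro I _ hI
      have hI' : nbr I (i, false) ≠ I := fun h0 => by simp [h0] at hI
      have e1 := nbr_nbr hI'
      simp only [Bool.not_false] at e1
      exact ⟨nbr I (i, false), Finset.mem_univ _, by rw [e1, norm_sub_rev]; exact hI, e1⟩
    · intro I _ hI
      have hI' : nbr I (i, true) ≠ I := fun h0 => by simp [h0] at hI
      have e1 := nbr_nbr hI'
      simp only [Bool.not_true] at e1
      rw [e1, norm_sub_rev]
  have e : ∀ I : Index N, ‖grad h f I‖ ^ 2
      = ∑ i, ((h ^ 2)⁻¹ * ‖f (nbr I (i, true)) - f I‖ ^ 2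
        + (h ^ 2)⁻¹ * ‖f (nbr I (i, false)) - f I‖ ^ 2) := by
    intro I
    rw [← real_inner_self_eq_norm_sq, inner_grad, Fintype.sum_prod_type, Finset.mul_sum]
    refine Finset.sum_congr rfl fun i _ => ?_
    rw [Fintype.sum_bool, real_inner_self_eq_norm_sq, real_inner_self_eq_norm_sq]; ring
  simp only [gridSum, e]
  rw [Finset.sum_comm, Finset.mul_sum, Finset.mul_sum]
  refine Finset.sum_congr rfl fun i _ => ?_
  rw [Finset.sum_add_distrib, ← Finset.mul_sum, ← Finset.mul_sum, ← key i, l2NormSq]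
  simp only [discreteDeriv, next_eq_nbr, norm_smul, mul_pow, ← Finset.mul_sum]
  simp; ring

theorem h1Sq_nonneg {h : ℝ} (hh : 0 < h) (f : Index N → F) : 0 ≤ h1Sq h f := by
  have h1 := gridSum_nonneg hh fun I => sq_nonneg ‖f I‖
  have h2 := gridSum_nonneg hh fun I => sq_nonneg ‖grad h f I‖
  rw [h1Sq]; linarith

theorem gridSum_sq_le_h1Sq {h : ℝ} (hh : 0 < h) (f : Index N → F) :
    gridSum h (fun I => ‖f I‖ ^ 2) ≤ h1Sq h f := by
  have h2 := gridSum_nonneg hh fun I => sq_nonneg ‖grad h f I‖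
  rw [h1Sq]; linarith

theorem gridSum_sq_grad_le_h1Sq {h : ℝ} (hh : 0 < h) (f : Index N → F) :
    gridSum h (fun I => ‖grad h f I‖ ^ 2) ≤ 2 * h1Sq h f := by
  have h1 := gridSum_nonneg hh fun I => sq_nonneg ‖f I‖
  rw [h1Sq]; linarith

theorem h1Sq_add_le {h : ℝ} (hh : 0 < h) (f g : Index N → F) :
    h1Sq h (f + g) ≤ 2 * h1Sq h f + 2 * h1Sq h g := by
  have key : ∀ {E : Type _} [NormedAddCommGroup E] (a b : E),
      ‖a + b‖ ^ 2 ≤ 2 * ‖a‖ ^ 2 + 2 * ‖b‖ ^ 2 := by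
    intro E _ a b
    nlinarith [norm_add_le a b, norm_nonneg (a + b), sq_nonneg (‖a‖ - ‖b‖), norm_nonneg a,
      norm_nonneg b]
  have h1 : gridSum h (fun I => ‖(f + g) I‖ ^ 2)
      ≤ gridSum h (fun I => 2 * ‖f I‖ ^ 2 + 2 * ‖g I‖ ^ 2) :=
    gridSum_mono hh fun I => key _ _
  have h2 : gridSum h (fun I => ‖grad h (f + g) I‖ ^ 2)
      ≤ gridSum h (fun I => 2 * ‖grad h f I‖ ^ 2 + 2 * ‖grad h g I‖ ^ 2) :=
    gridSum_mono hh fun I => by rw [grad_add]; exact key _ _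
  rw [gridSum_add, gridSum_mul, gridSum_mul] at h1 h2
  simp only [h1Sq]; linarith

end Grid

end LLG

/-! ### Pointwise energy estimate and bounds for a reference step. -/

namespace LLG

open scoped RealInnerProductSpace

theorem inner_eq_of_ne_zero {a : Vec3} (ha : a ≠ 0) (x y : Vec3) :
    ⟪x, y⟫ = (‖a‖ ^ 2)⁻¹ * (⟪a, x⟫ * ⟪a, y⟫ + ⟪cross a x, cross a y⟫) := by
  have : ‖a‖ ^ 2 ≠ 0 := by positivity
  rw [inner_cross_cross]; field_simp; ring

/-- Here `a` and `ah` are the extrapolated numerical and reference values, `w` and `y` the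
increments of the reference and of the error, `D` the Laplacian of the averaged error, `F` the error
of the lower order field, `X` the reference field and `R` its residual. Subtracting the two
equations leaves the exchange term, which dissipates, a field error, and a remainder `G`. The part
of `G` across `a` is paired with `cross a D`; the part along `a` is known exactly from orthogonality
and produces the last product. -/
theorem energy_pointwise {α ε K k : ℝ} (hα : 0 < α) (hε : 0 < ε) (hK : 1 ≤ K)
    (hαK : 1 + 5 * α ≤ K) (hεK : ε ≤ K) (hk : 0 < k) {a ah w y D F X R : Vec3}
    (ha : 1 / 2 ≤ ‖a‖) (ha' : ‖a‖ ≤ 3) (hah : ‖ah‖ ≤ 2) (hX : ‖X‖ ≤ K)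
    (hF : ‖F‖ ≤ K * ‖a - ah‖) (h1 : k⁻¹ • (y + w) = llgRhs α a (ε • D + F + X))
    (h2 : k⁻¹ • w = llgRhs α ah X + R) :
    ‖y‖ ≤ k * (4 * K ^ 2 * (‖cross a D‖ + ‖a - ah‖ + ‖R‖)) ∧
    -⟪y, D⟫ ≤ k * (-(ε * α) * ‖cross a D‖ ^ 2 + 3 * K ^ 2 * (‖a - ah‖ + ‖R‖) * ‖cross a D‖)
      + 4 * (|⟪a, w⟫| * |⟪a, D⟫|) := by
  have ha0 : a ≠ 0 := by rintro rfl; norm_num at ha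
  set G := llgRhs α a X - llgRhs α ah X - R with hG
  have hy : y = k • (ε • llgRhs α a D + llgRhs α a F + G) := by
    rw [← inv_smul_eq_iff₀ hk.ne']
    have : k⁻¹ • y = k⁻¹ • (y + w) - k⁻¹ • w := by module
    rw [this, h1, h2, llgRhs_add, llgRhs_add, llgRhs_smul, hG]; abel
  have hac : 1 + |α| * ‖a‖ ≤ K := by rw [abs_of_pos hα]; nlinarith
  have hG1 : ‖G‖ ≤ K ^ 2 * (‖a - ah‖ + ‖R‖) := by
    have e1 : ‖llgRhs α a X - llgRhs α ah X‖ ≤ K ^ 2 * ‖a - ah‖ := by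
      refine (norm_llgRhs_sub_le α a ah X).trans ?_
      have : 1 + |α| * (‖a‖ + ‖ah‖) ≤ K := by rw [abs_of_pos hα]; nlinarith
      calc _ ≤ K * ‖a - ah‖ * K := by gcongr
        _ = _ := by ring
    have e2 : ‖R‖ ≤ K ^ 2 * ‖R‖ := le_mul_of_one_le_left (norm_nonneg _) (by nlinarith)
    have := norm_sub_le (llgRhs α a X - llgRhs α ah X) R
    linarith
  have hA1 : ‖llgRhs α a D‖ ≤ K * ‖cross a D‖ :=
    (norm_llgRhs_le_cross α a D).trans (by gcongr)
  have hA2 : ‖llgRhs α a F‖ ≤ 3 * K ^ 2 * ‖a - ah‖ := by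
    refine (norm_llgRhs_le α a F).trans ?_
    calc _ ≤ K * (3 * (K * ‖a - ah‖)) := by gcongr
      _ = _ := by ring
  constructor
  · rw [hy, norm_smul, Real.norm_eq_abs, abs_of_pos hk]
    gcongr
    have t1 : ‖ε • llgRhs α a D‖ ≤ K ^ 2 * ‖cross a D‖ := by
      rw [norm_smul, Real.norm_eq_abs, abs_of_pos hε]
      calc _ ≤ K * (K * ‖cross a D‖) := by gcongr
        _ = _ := by ring
    have t2 := norm_add_le (ε • llgRhs α a D + llgRhs α a F) G
    have t3 := norm_add_le (ε • llgRhs α a D) (llgRhs α a F)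
    have : 0 ≤ K ^ 2 * ‖cross a D‖ := by positivity
    have : 0 ≤ K ^ 2 * ‖R‖ := by positivity
    linarith
  · have hay : ⟪a, y⟫ = -⟪a, w⟫ := by
      have := congrArg (fun z => ⟪a, z⟫) h1
      simp only [inner_llgRhs, inner_smul_right, inner_add_right, mul_eq_zero, inv_eq_zero,
        hk.ne', false_or] at this
      linarith
    -- The right-hand sides containing `D` and `F` are orthogonal to `a`, so `G` alone carries the
    -- normal component of the increment `y`, and that is minus the one of `w`.
    have hGa : k * ⟪a, G⟫ = -⟪a, w⟫ := by
      rw [← hay, hy]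
      simp only [inner_smul_right, inner_add_right, inner_llgRhs]; ring
    have e1 : ⟪y, D⟫ = k * (ε * (α * ‖cross a D‖ ^ 2) + ⟪llgRhs α a F, D⟫ + ⟪G, D⟫) := by
      rw [hy]
      simp only [inner_smul_left, inner_add_left, inner_llgRhs_right]; simp
    have e2 : -⟪llgRhs α a F, D⟫ ≤ K ^ 2 * ‖a - ah‖ * ‖cross a D‖ := by
      refine (neg_le_abs _).trans ((abs_inner_llgRhs_le α a F D).trans ?_)
      calc _ ≤ K * (K * ‖a - ah‖) * ‖cross a D‖ := by gcongr
        _ = _ := by ring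
    have ha2 : ‖a‖⁻¹ ≤ 2 := by
      rw [inv_le_comm₀ (by linarith) (by norm_num)]; linarith
    have e3 : -(k * ⟪G, D⟫) ≤ 4 * (|⟪a, w⟫| * |⟪a, D⟫|)
        + k * (2 * (K ^ 2 * (‖a - ah‖ + ‖R‖)) * ‖cross a D‖) := by
      have : -(k * ⟪G, D⟫) = (‖a‖⁻¹) ^ 2 * (⟪a, w⟫ * ⟪a, D⟫)
          - k * ((‖a‖⁻¹) ^ 2 * ⟪cross a G, cross a D⟫) := by
        rw [inner_eq_of_ne_zero ha0 G D, inv_pow]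
        linear_combination (-(‖a‖ ^ 2)⁻¹ * ⟪a, D⟫) * hGa
      rw [this]
      have p1 : (‖a‖⁻¹) ^ 2 * (⟪a, w⟫ * ⟪a, D⟫) ≤ 4 * (|⟪a, w⟫| * |⟪a, D⟫|) := by
        rw [← abs_mul]
        calc _ ≤ (‖a‖⁻¹) ^ 2 * |⟪a, w⟫ * ⟪a, D⟫| := by gcongr; exact le_abs_self _
          _ ≤ 2 ^ 2 * |⟪a, w⟫ * ⟪a, D⟫| := by gcongr
          _ = _ := by ring
      have p2 : -((‖a‖⁻¹) ^ 2 * ⟪cross a G, cross a D⟫)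
          ≤ 2 * (K ^ 2 * (‖a - ah‖ + ‖R‖)) * ‖cross a D‖ := by
        have q1 : -⟪cross a G, cross a D⟫ ≤ (‖a‖ * ‖G‖) * ‖cross a D‖ :=
          (neg_le_abs _).trans ((abs_real_inner_le_norm _ _).trans
            (by gcongr; exact norm_cross_le _ _))
        calc _ = (‖a‖⁻¹) ^ 2 * -⟪cross a G, cross a D⟫ := by ring
          _ ≤ (‖a‖⁻¹) ^ 2 * ((‖a‖ * ‖G‖) * ‖cross a D‖) := by gcongr
          _ = ‖a‖⁻¹ * ‖G‖ * ‖cross a D‖ := by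
              have : ‖a‖ ≠ 0 := by positivity
              field_simp
          _ ≤ _ := by gcongr
      nlinarith [mul_le_mul_of_nonneg_left p2 hk.le]
    have e4 := mul_le_mul_of_nonneg_left e2 hk.le
    have e5 : 0 ≤ k * (K ^ 2 * ‖R‖ * ‖cross a D‖) := by positivity
    rw [e1]
    nlinarith

section Grid

variable {d : ℕ} {N : Fin d → ℕ}

/-- The extrapolation from two consecutive time levels. -/
noncomputable def extrap (m' m : GridFun N) : GridFun N :=
  fun I => (1 / 2 : ℝ) • ((3 : ℝ) • m I - m' I)

theorem extrap_eq (m' m : GridFun N) : extrap m' m = (3 / 2 : ℝ) • m - (1 / 2 : ℝ) • m' := by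
  ext1 I; simp only [extrap, Pi.sub_apply, Pi.smul_apply]; module

theorem norm_extrap_le (e' e : GridFun N) (I : Index N) :
    ‖extrap e' e I‖ ≤ 2 * (‖e I‖ + ‖e' I‖) := by
  rw [extrap_eq]
  refine (norm_sub_le _ _).trans ?_
  simp only [Pi.smul_apply, norm_smul]
  norm_num
  linarith [norm_nonneg (e I), norm_nonneg (e' I)]

theorem norm_grad_extrap_le (h : ℝ) (e' e : GridFun N) (I : Index N) :
    ‖grad h (extrap e' e) I‖ ≤ 2 * (‖grad h e I‖ + ‖grad h e' I‖) := by
  rw [extrap_eq, grad_sub, grad_smul, grad_smul]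
  refine (norm_sub_le _ _).trans ?_
  simp only [norm_smul]
  norm_num
  linarith [norm_nonneg (grad h e I), norm_nonneg (grad h e' I)]

theorem norm_lap_extrap_le (h : ℝ) (e' e : GridFun N) (I : Index N) :
    ‖lap h (extrap e' e) I‖ ≤ 2 * max ‖lap h e I‖ ‖lap h e' I‖ := by
  rw [extrap_eq, lap_sub, lap_smul, lap_smul]
  refine (norm_sub_le _ _).trans ?_
  simp only [norm_smul]
  norm_num
  linarith [le_max_left ‖lap h e I‖ ‖lap h e' I‖, le_max_right ‖lap h e I‖ ‖lap h e' I‖]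

/-- Pointwise bounds for a reference solution with values `u'`, `u`, `up` in the sphere at three
consecutive time levels; `X` is its effective field and `R` its residual. -/
structure RefStep (K h k α : ℝ) (u' u up X R : GridFun N) : Prop where
  unit' : ∀ I, ‖u' I‖ = 1
  unit : ∀ I, ‖u I‖ = 1
  unitp : ∀ I, ‖up I‖ = 1
  grad_le' : ∀ I, ‖grad h u' I‖ ≤ K
  grad_le : ∀ I, ‖grad h u I‖ ≤ K
  gradp_le : ∀ I, ‖grad h up I‖ ≤ K
  lap_le' : ∀ I, ‖lap h u' I‖ ≤ K
  lap_le : ∀ I, ‖lap h u I‖ ≤ K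
  lapp_le : ∀ I, ‖lap h up I‖ ≤ K
  incr' : ∀ I, ‖u I - u' I‖ ≤ K * k
  incr : ∀ I, ‖up I - u I‖ ≤ K * k
  incr2 : ∀ I, ‖up I - (2 : ℝ) • u I + u' I‖ ≤ K * k ^ 2
  field : ∀ I, ‖X I‖ ≤ K
  eqn : ∀ I, k⁻¹ • (up I - u I) = llgRhs α (extrap u' u I) (X I) + R I

/-- Admissible parameters for the one-step estimates. -/
structure StepParam (d : ℕ) (K h k α ε : ℝ) : Prop where
  one_le : 1 ≤ K
  h_pos : 0 < h
  k_pos : 0 < k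
  h_le : h ≤ 1
  k_le : k ≤ 1
  k_le_h : k ≤ K * h
  α_pos : 0 < α
  ε_pos : 0 < ε
  α_le : 1 + 5 * α ≤ K
  ε_le : ε ≤ K
  d_le : (d : ℝ) ≤ 3

variable {K h k α ε : ℝ}

theorem StepParam.mul_lap_le (hp : StepParam d K h k α ε) (f : GridFun N) (I : Index N) :
    h * ‖lap h f I‖ ≤ 6 * ‖grad h f I‖ := by
  refine (mul_norm_lap_le hp.h_pos f I).trans ?_
  have := hp.d_le
  gcongr; linarith

/-- For unit fields the average of two values is orthogonal to their difference, and the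
extrapolation differs from the average by half a second difference. The product is therefore third
order in k. -/
theorem RefStep.inner_extrap {u' u up X R : GridFun N} (hu : RefStep K h k α u' u up X R)
    (I : Index N) : ⟪extrap u' u I, up I - u I⟫
      = -(1 / 2) * ⟪up I - u I, up I - (2 : ℝ) • u I + u' I⟫ := by
  have h1 : ⟪up I + u I, up I - u I⟫ = 0 := by
    rw [inner_add_left, inner_sub_right, inner_sub_right, real_inner_self_eq_norm_sq,
      real_inner_self_eq_norm_sq, hu.unit, hu.unitp, real_inner_comm]; ring
  have h2 : extrap u' u I = (1 / 2 : ℝ) • (up I + u I)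
      - (1 / 2 : ℝ) • (up I - (2 : ℝ) • u I + u' I) := by
    rw [extrap]; module
  rw [h2, inner_sub_left, inner_smul_left, inner_smul_left, h1, real_inner_comm (up I - u I)]
  simp

theorem RefStep.norm_extrap_le {u' u up X R : GridFun N} (hu : RefStep K h k α u' u up X R)
    (I : Index N) : ‖extrap u' u I‖ ≤ 2 := by
  rw [extrap_eq]
  refine (norm_sub_le _ _).trans ?_
  simp only [Pi.smul_apply, norm_smul, hu.unit, hu.unit']
  norm_num

/-- The component of the numerical solution along the increment of the reference solution. -/
theorem RefStep.abs_inner_le {u' u up X R : GridFun N} (hp : StepParam d K h k α ε)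
    (hu : RefStep K h k α u' u up X R) (a : GridFun N) (I : Index N) :
    |⟪a I, up I - u I⟫| ≤ k * (K ^ 2 * (‖a I - extrap u' u I‖ + k ^ 2)) := by
  have hK := hp.one_le
  have hk := hp.k_pos
  have e : ⟪a I, up I - u I⟫ = ⟪a I - extrap u' u I, up I - u I⟫
      + -(1 / 2) * ⟪up I - u I, up I - (2 : ℝ) • u I + u' I⟫ := by
    rw [← hu.inner_extrap, inner_sub_left]; ring
  rw [e]
  have t1 : |⟪a I - extrap u' u I, up I - u I⟫| ≤ ‖a I - extrap u' u I‖ * (K * k) :=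
    (abs_real_inner_le_norm _ _).trans (by gcongr; exact hu.incr I)
  have t2 : |⟪up I - u I, up I - (2 : ℝ) • u I + u' I⟫| ≤ (K * k) * (K * k ^ 2) :=
    (abs_real_inner_le_norm _ _).trans (by gcongr; exacts [hu.incr I, hu.incr2 I])
  refine (abs_add_le _ _).trans ?_
  rw [abs_mul, abs_neg, abs_of_pos (by norm_num : (0 : ℝ) < 1 / 2)]
  have : ‖a I - extrap u' u I‖ * (K * k) ≤ ‖a I - extrap u' u I‖ * (K ^ 2 * k) := by
    gcongr; nlinarith
  have : 0 ≤ (K * k) * (K * k ^ 2) := by positivity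
  nlinarith

/-- The difference of two fields in the sphere is almost orthogonal to its Laplacian. -/
theorem abs_inner_lap_sub_le {m u : GridFun N} (hm : ∀ I, ‖m I‖ = 1)
    (hu : ∀ I, ‖u I‖ = 1) {I : Index N} {G : ℝ} (hgm : ‖grad h m I‖ ≤ G)
    (hgu : ‖grad h u I‖ ≤ K) (hlu : ‖lap h u I‖ ≤ K) :
    |⟪m I, lap h (m - u) I⟫| ≤ (G + K) * ‖grad h (m - u) I‖ + K * ‖(m - u) I‖ := by
  have e : ⟪m I, lap h (m - u) I⟫ = -(1 / 2) * (‖grad h m I‖ ^ 2 - ‖grad h u I‖ ^ 2)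
      - ⟪(m - u) I, lap h u I⟫ := by
    have h1 := inner_lap_of_unit h hm I
    have h2 := inner_lap_of_unit h hu I
    rw [lap_sub, inner_sub_right, h1, Pi.sub_apply, inner_sub_left, h2]; ring
  have t1 : |‖grad h m I‖ ^ 2 - ‖grad h u I‖ ^ 2| ≤ ‖grad h (m - u) I‖ * (G + K) := by
    rw [grad_sub, sq_sub_sq, abs_mul,
      abs_of_nonneg (add_nonneg (norm_nonneg _) (norm_nonneg _)), mul_comm]
    gcongr
    exact abs_norm_sub_norm_le _ _
  have t2 : |⟪(m - u) I, lap h u I⟫| ≤ ‖(m - u) I‖ * K :=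
    (abs_real_inner_le_norm _ _).trans (by gcongr)
  rw [e]
  refine (abs_sub _ _).trans ?_
  rw [abs_mul, abs_neg, abs_of_pos (by norm_num : (0 : ℝ) < 1 / 2)]
  have : 0 ≤ ‖grad h (m - u) I‖ * (G + K) := (abs_nonneg _).trans t1
  linarith

end Grid

end LLG

/-! ### The Laplacian of the error along the extrapolated value. -/

namespace LLG

open scoped RealInnerProductSpace

section Grid

variable {d : ℕ} {N : Fin d → ℕ} {K h k α ε : ℝ}

theorem lap_neg (h : ℝ) {F : Type*} [NormedAddCommGroup F] [InnerProductSpace ℝ F]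
    (f : Index N → F) (I : Index N) : lap h (-f) I = -lap h f I := by
  rw [show -f = (-1 : ℝ) • f by module, lap_smul]; module

/-- For an increment `y` of the error such that `y + w` is orthogonal to the extrapolation `a`, the
component of the Laplacian of `y` along `a` is of lower order. -/
theorem abs_inner_lap_incr_le {u' u up X R : GridFun N} (hp : StepParam d K h k α ε)
    (hu : RefStep K h k α u' u up X R) {e' e y : GridFun N} (I : Index N)
    (hge' : ‖grad h e' I‖ ≤ 1) (hge : ‖grad h e I‖ ≤ 1)
    (horth : ∀ J, ⟪extrap (u' + e') (u + e) J, y J + (up J - u J)⟫ = 0) :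
    |⟪extrap (u' + e') (u + e) I, lap h y I⟫| ≤
      |lap h (fun J => ⟪extrap u' u J, up J - u J⟫) I|
      + 16 * K ^ 2 * (‖e I‖ + ‖e' I‖ + ‖grad h e I‖ + ‖grad h e' I‖ + ‖y I‖ + ‖grad h y I‖)
      + 12 * h⁻¹ * (‖y I‖ * (‖grad h e I‖ + ‖grad h e' I‖)) := by
  have hK := hp.one_le
  have hh := hp.h_pos
  have hk := hp.k_pos
  have hKK : K ≤ K ^ 2 := by nlinarith
  set ê : GridFun N := extrap e' e with hê
  set w : GridFun N := up - u with hw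
  have ha : extrap (u' + e') (u + e) = extrap u' u + ê := by
    ext1 J; simp only [hê, extrap, Pi.add_apply]; module
  rw [ha] at horth ⊢
  have en : ‖ê I‖ ≤ 2 * (‖e I‖ + ‖e' I‖) := norm_extrap_le e' e I
  have eg : ‖grad h ê I‖ ≤ 2 * (‖grad h e I‖ + ‖grad h e' I‖) := norm_grad_extrap_le h e' e I
  have hlw : ‖lap h w I‖ ≤ 2 * K := by
    rw [hw, lap_sub]; linarith [norm_sub_le (lap h up I) (lap h u I), hu.lapp_le I, hu.lap_le I]
  have hgw : ‖grad h w I‖ ≤ 2 * K := by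
    rw [hw, grad_sub]
    linarith [norm_sub_le (grad h up I) (grad h u I), hu.gradp_le I, hu.grad_le I]
  -- Orthogonality holds in every cell, so the discrete product rule may be applied to it; this
  -- expresses the normal component of the Laplacian of `y` by lower order terms.
  have hfun : (fun J => ⟪(extrap u' u + ê) J, y J⟫)
      = -((fun J => ⟪extrap u' u J, up J - u J⟫) + fun J => ⟪ê J, w J⟫) := by
    ext1 J
    have := horth J
    simp only [Pi.add_apply, Pi.neg_apply, inner_add_left, inner_add_right, hw, Pi.sub_apply]
      at this ⊢
    linarith
  have h1 := lap_inner h (extrap u' u + ê) y I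
  rw [hfun, lap_neg, lap_add, lap_inner h ê w I] at h1
  have hlê : ‖lap h ê I‖ ≤ 6 * h⁻¹ * ‖grad h ê I‖ := by
    have := hp.mul_lap_le ê I
    rw [mul_comm 6, mul_assoc, ← div_eq_inv_mul, le_div_iff₀ hh]
    linarith
  have t1 : |⟪ê I, lap h w I⟫| ≤ ‖ê I‖ * (2 * K) :=
    (abs_real_inner_le_norm _ _).trans (by gcongr)
  -- The reference increment is O(k), hence O(h), and absorbs one difference of the Laplacian of the
  -- error.
  have t2 : |⟪w I, lap h ê I⟫| ≤ 6 * K ^ 2 * ‖grad h ê I‖ := by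
    refine (abs_real_inner_le_norm _ _).trans ?_
    calc _ ≤ (K * (K * h)) * ‖lap h ê I‖ := by
          gcongr
          exact (hu.incr I).trans (by gcongr; exact hp.k_le_h)
      _ = K ^ 2 * (h * ‖lap h ê I‖) := by ring
      _ ≤ K ^ 2 * (6 * ‖grad h ê I‖) := mul_le_mul_of_nonneg_left (hp.mul_lap_le ê I) (by positivity)
      _ = _ := by ring
  have t3 : |⟪grad h ê I, grad h w I⟫| ≤ ‖grad h ê I‖ * (2 * K) :=
    (abs_real_inner_le_norm _ _).trans (by gcongr)
  -- The only place where a factor 1/h survives, in front of a product of two errors.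
  have t4 : |⟪y I, lap h (extrap u' u + ê) I⟫| ≤ ‖y I‖ * (2 * K + 6 * h⁻¹ * ‖grad h ê I‖) := by
    refine (abs_real_inner_le_norm _ _).trans ?_
    gcongr
    rw [lap_add]
    refine (norm_add_le _ _).trans (add_le_add ?_ hlê)
    exact (norm_lap_extrap_le h u' u I).trans (by gcongr; exact max_le (hu.lap_le I) (hu.lap_le' I))
  have t5 : |⟪grad h (extrap u' u + ê) I, grad h y I⟫| ≤ 8 * K * ‖grad h y I‖ := by
    refine (abs_real_inner_le_norm _ _).trans ?_
    gcongr
    rw [grad_add]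
    refine (norm_add_le _ _).trans ?_
    linarith [norm_grad_extrap_le h u' u I, hu.grad_le I, hu.grad_le' I]
  have e1 : ⟪(extrap u' u + ê) I, lap h y I⟫ = -lap h (fun J => ⟪extrap u' u J, up J - u J⟫) I
      - (⟪ê I, lap h w I⟫ + ⟪w I, lap h ê I⟫ + ⟪grad h ê I, grad h w I⟫)
      - ⟪y I, lap h (extrap u' u + ê) I⟫ - ⟪grad h (extrap u' u + ê) I, grad h y I⟫ := by
    linarith
  rw [e1]
  set g := ‖grad h ê I‖
  have s1 : ‖ê I‖ * (2 * K) ≤ 4 * K ^ 2 * (‖e I‖ + ‖e' I‖) := by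
    calc _ ≤ 2 * (‖e I‖ + ‖e' I‖) * (2 * K ^ 2) := by gcongr
      _ = _ := by ring
  have s2 : 6 * K ^ 2 * g ≤ 12 * K ^ 2 * (‖grad h e I‖ + ‖grad h e' I‖) := by
    calc _ ≤ 6 * K ^ 2 * (2 * (‖grad h e I‖ + ‖grad h e' I‖)) := by gcongr
      _ = _ := by ring
  have s3 : g * (2 * K) ≤ 4 * K ^ 2 * (‖grad h e I‖ + ‖grad h e' I‖) := by
    calc _ ≤ 2 * (‖grad h e I‖ + ‖grad h e' I‖) * (2 * K ^ 2) := by gcongr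
      _ = _ := by ring
  have s4 : ‖y I‖ * (2 * K + 6 * h⁻¹ * g) ≤ 2 * K ^ 2 * ‖y I‖
      + 12 * h⁻¹ * (‖y I‖ * (‖grad h e I‖ + ‖grad h e' I‖)) := by
    calc _ ≤ ‖y I‖ * (2 * K ^ 2 + 6 * h⁻¹ * (2 * (‖grad h e I‖ + ‖grad h e' I‖))) := by gcongr
      _ = _ := by ring
  have s5 : 8 * K * ‖grad h y I‖ ≤ 8 * K ^ 2 * ‖grad h y I‖ := by gcongr
  have n1 : 0 ≤ K ^ 2 * ‖y I‖ := by positivity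
  have n2 : 0 ≤ K ^ 2 * ‖grad h y I‖ := by positivity
  have n3 : 0 ≤ K ^ 2 * (‖e I‖ + ‖e' I‖) := by positivity
  have n4 : 0 ≤ K ^ 2 * (‖grad h e I‖ + ‖grad h e' I‖) := by positivity
  rw [abs_le] at *
  have hq := abs_le.1 (le_refl |lap h (fun J => ⟪extrap u' u J, up J - u J⟫) I|)
  constructor <;> linarith

/-- The component of the Laplacian of the averaged error along the extrapolation `a`. -/
theorem abs_inner_lap_avg_le {u' u up X R : GridFun N} (hp : StepParam d K h k α ε)
    (hu : RefStep K h k α u' u up X R) {e' e y : GridFun N} (I : Index N)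
    (hm : ∀ J, ‖u J + e J‖ = 1) (he' : ‖e' I‖ ≤ h) (he : ‖e I‖ ≤ h)
    (hge' : ‖grad h e' I‖ ≤ 1) (hge : ‖grad h e I‖ ≤ 1)
    (horth : ∀ J, ⟪extrap (u' + e') (u + e) J, y J + (up J - u J)⟫ = 0) :
    |⟪extrap (u' + e') (u + e) I, lap h (e + (1 / 2 : ℝ) • y) I⟫| ≤
      |lap h (fun J => ⟪extrap u' u J, up J - u J⟫) I|
      + 20 * K ^ 2 * (‖e I‖ + ‖e' I‖ + ‖grad h e I‖ + ‖grad h e' I‖ + ‖y I‖ + ‖grad h y I‖)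
      + 6 * h⁻¹ * (‖y I‖ * (‖grad h e I‖ + ‖grad h e' I‖)) := by
  have hK := hp.one_le
  have hh := hp.h_pos
  have hKK : K ≤ K ^ 2 := by nlinarith
  have h1 := abs_inner_lap_incr_le hp hu I hge' hge horth
  have hgm : ‖grad h (u + e) I‖ ≤ 2 * K := by
    rw [grad_add]; linarith [norm_add_le (grad h u I) (grad h e I), hu.grad_le I]
  have h2 := abs_inner_lap_sub_le (m := u + e) hm hu.unit hgm (hu.grad_le I) (hu.lap_le I)
  rw [add_sub_cancel_left] at h2
  have h3 : |⟪(u + e) I - (u' + e') I, lap h e I⟫| ≤ 18 * K ^ 2 * ‖grad h e I‖ := by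
    refine (abs_real_inner_le_norm _ _).trans ?_
    have : ‖(u + e) I - (u' + e') I‖ ≤ 3 * K ^ 2 * h := by
      have e1 : (u + e) I - (u' + e') I = (u I - u' I) + (e I - e' I) := by
        simp only [Pi.add_apply]; abel
      have e2 := norm_add_le (u I - u' I) (e I - e' I)
      have e3 := norm_sub_le (e I) (e' I)
      have e4 : K * k ≤ K * (K * h) := by gcongr; exact hp.k_le_h
      rw [e1]
      nlinarith [hu.incr' I]
    calc _ ≤ 3 * K ^ 2 * h * ‖lap h e I‖ := by gcongr
      _ = 3 * K ^ 2 * (h * ‖lap h e I‖) := by ring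
      _ ≤ 3 * K ^ 2 * (6 * ‖grad h e I‖) := mul_le_mul_of_nonneg_left (hp.mul_lap_le e I) (by positivity)
      _ = _ := by ring
  -- The extrapolation is m plus half of m minus the previous value. The first part meets the unit
  -- field estimate; the second is O(h) by the maximum norm bounds and absorbs one difference of the
  -- Laplacian.
  have e1 : ⟪extrap (u' + e') (u + e) I, lap h (e + (1 / 2 : ℝ) • y) I⟫
      = ⟪(u + e) I, lap h e I⟫ + 1 / 2 * ⟪(u + e) I - (u' + e') I, lap h e I⟫
        + 1 / 2 * ⟪extrap (u' + e') (u + e) I, lap h y I⟫ := by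
    have : extrap (u' + e') (u + e) I
        = (u + e) I + (1 / 2 : ℝ) • ((u + e) I - (u' + e') I) := by rw [extrap]; module
    rw [lap_add, lap_smul, inner_add_right, inner_smul_right]
    nth_rewrite 1 [this]
    rw [inner_add_left, inner_smul_left]; simp
  rw [e1]
  have s1 : (2 * K + K) * ‖grad h e I‖ ≤ 3 * K ^ 2 * ‖grad h e I‖ := by gcongr; linarith
  have s2 : K * ‖e I‖ ≤ K ^ 2 * ‖e I‖ := by gcongr
  have n1 : 0 ≤ K ^ 2 * ‖y I‖ := by positivity
  have n2 : 0 ≤ K ^ 2 * ‖grad h y I‖ := by positivity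
  have n3 : 0 ≤ K ^ 2 * ‖e I‖ := by positivity
  have n4 : 0 ≤ K ^ 2 * ‖e' I‖ := by positivity
  have n5 : 0 ≤ K ^ 2 * ‖grad h e I‖ := by positivity
  have n6 : 0 ≤ K ^ 2 * ‖grad h e' I‖ := by positivity
  have n7 := abs_nonneg (lap h (fun J => ⟪extrap u' u J, up J - u J⟫) I)
  rw [abs_le] at h1 h2 h3 ⊢
  constructor <;> linarith

end Grid

end LLG

/-! ### One step of the scheme: energy inequality before projection. -/

namespace LLG

open scoped RealInnerProductSpace

section Grid

variable {d : ℕ} {N : Fin d → ℕ} {K h k α ε : ℝ}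

/-- One step of the scheme, written for the errors `e'`, `e` at two consecutive time levels and the
error `es` of the intermediate value, with respect to a reference solution. -/
structure ErrStep (K h k α ε : ℝ) (u' u up X R e' e es Fd : GridFun N) : Prop
    extends RefStep K h k α u' u up X R where
  step : ∀ I, k⁻¹ • ((es I - e I) + (up I - u I)) = llgRhs α (extrap (u' + e') (u + e) I)
    (ε • LLG.lap h (e + (1 / 2 : ℝ) • (es - e)) I + Fd I + X I)
  Fd_le : ∀ I, ‖Fd I‖ ≤ K * ‖extrap e' e I‖
  err'_le : ∀ I, ‖e' I‖ ≤ 1 / 8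
  err_le : ∀ I, ‖e I‖ ≤ 1 / 8
  grad_err'_le : ∀ I, ‖grad h e' I‖ ≤ 1
  grad_err_le : ∀ I, ‖grad h e I‖ ≤ 1

variable {u' u up X R e' e es Fd : GridFun N}

theorem extrap_add (u' u e' e : GridFun N) :
    extrap (u' + e') (u + e) = extrap u' u + extrap e' e := by
  ext1 J; simp only [extrap, Pi.add_apply]; module

theorem ErrStep.norm_extrap_err_le (hs : ErrStep K h k α ε u' u up X R e' e es Fd)
    (I : Index N) : ‖extrap e' e I‖ ≤ 1 / 2 := by
  linarith [norm_extrap_le e' e I, hs.err_le I, hs.err'_le I]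

/-- The extrapolation of two unit vectors has length at least 3/2 - 1/2, and the extrapolated error
removes at most 1/2. Nondegeneracy is needed to split vectors along and across the extrapolated
value. -/
theorem ErrStep.norm_extrap_ge (hs : ErrStep K h k α ε u' u up X R e' e es Fd)
    (I : Index N) : 1 / 2 ≤ ‖extrap (u' + e') (u + e) I‖ := by
  have h1 : 1 ≤ ‖extrap u' u I‖ := by
    rw [extrap_eq]
    have := norm_sub_norm_le ((3 / 2 : ℝ) • u I) ((1 / 2 : ℝ) • u' I)
    simp only [Pi.sub_apply, Pi.smul_apply]
    rw [norm_smul, norm_smul, hs.unit, hs.unit'] at this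
    norm_num at this ⊢
    linarith
  have h2 := norm_sub_norm_le (extrap u' u I) (-extrap e' e I)
  rw [extrap_add, Pi.add_apply]
  rw [norm_neg, sub_neg_eq_add] at h2
  linarith [hs.norm_extrap_err_le I]

theorem ErrStep.norm_extrap_le_three (hs : ErrStep K h k α ε u' u up X R e' e es Fd)
    (I : Index N) : ‖extrap (u' + e') (u + e) I‖ ≤ 3 := by
  rw [extrap_add, Pi.add_apply]
  linarith [norm_add_le (extrap u' u I) (extrap e' e I), hs.norm_extrap_err_le I,
    hs.toRefStep.norm_extrap_le I]

theorem ErrStep.inner_eq_zero (hp : StepParam d K h k α ε)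
    (hs : ErrStep K h k α ε u' u up X R e' e es Fd) (I : Index N) :
    ⟪extrap (u' + e') (u + e) I, (es - e) I + (up I - u I)⟫ = 0 := by
  have := congrArg (fun z => ⟪extrap (u' + e') (u + e) I, z⟫) (hs.step I)
  simpa only [inner_llgRhs, inner_smul_right, mul_eq_zero, inv_eq_zero, hp.k_pos.ne', false_or,
    Pi.sub_apply] using this

/-- The dissipated quantity. -/
noncomputable def dissip (h : ℝ) (u' u e' e es : GridFun N) (I : Index N) : ℝ :=
  ‖cross (extrap (u' + e') (u + e) I) (lap h (e + (1 / 2 : ℝ) • (es - e)) I)‖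

theorem ErrStep.incr_le_and_energy (hp : StepParam d K h k α ε)
    (hs : ErrStep K h k α ε u' u up X R e' e es Fd) (I : Index N) :
    ‖es I - e I‖ ≤ k * (4 * K ^ 2 * (dissip h u' u e' e es I + ‖extrap e' e I‖ + ‖R I‖)) ∧
    -⟪es I - e I, lap h (e + (1 / 2 : ℝ) • (es - e)) I⟫ ≤
      k * (-(ε * α) * dissip h u' u e' e es I ^ 2
        + 3 * K ^ 2 * (‖extrap e' e I‖ + ‖R I‖) * dissip h u' u e' e es I)
      + 4 * (|⟪extrap (u' + e') (u + e) I, up I - u I⟫|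
        * |⟪extrap (u' + e') (u + e) I, lap h (e + (1 / 2 : ℝ) • (es - e)) I⟫|) := by
  have hsub : extrap (u' + e') (u + e) I - extrap u' u I = extrap e' e I := by
    rw [extrap_add, Pi.add_apply]; abel
  have := energy_pointwise hp.α_pos hp.ε_pos hp.one_le hp.α_le hp.ε_le hp.k_pos
    (hs.norm_extrap_ge I) (hs.norm_extrap_le_three I) (hs.toRefStep.norm_extrap_le I)
    (hs.field I) (by rw [hsub]; exact hs.Fd_le I) (hs.step I) (hs.eqn I)
  rw [hsub] at this
  exact this

/-- Because the Laplacian acts on the average of the old and new errors, summation by parts turns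
the pairing with their difference into a difference of squares. -/
theorem gridSum_energy (h : ℝ) (e es : GridFun N) :
    gridSum h (fun I => ‖es I‖ ^ 2 - ‖e I‖ ^ 2
      - 2 * ⟪es I - e I, lap h (e + (1 / 2 : ℝ) • (es - e)) I⟫) = h1Sq h es - h1Sq h e := by
  have h1 := gridSum_inner_lap h (es - e) (e + (1 / 2 : ℝ) • (es - e))
  have h2 : (fun I => ⟪grad h (es - e) I, grad h (e + (1 / 2 : ℝ) • (es - e)) I⟫)
      = fun I => 1 / 2 * (‖grad h es I‖ ^ 2 - ‖grad h e I‖ ^ 2) := by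
    ext1 I
    rw [grad_add, grad_smul, grad_sub, ← real_inner_self_eq_norm_sq, ← real_inner_self_eq_norm_sq]
    simp only [inner_add_right, inner_smul_right, inner_sub_left, inner_sub_right,
      real_inner_comm (grad h es I)]
    ring
  rw [h2, gridSum_mul, gridSum_sub] at h1
  rw [gridSum_sub, gridSum_sub, gridSum_mul]
  simp only [Pi.sub_apply] at h1
  rw [h1, h1Sq, h1Sq]; ring

theorem young {c b S M : ℝ} (hc : 0 < c) : M * b * S ≤ c * b ^ 2 + M ^ 2 / (4 * c) * S ^ 2 := by
  have : c * b ^ 2 + M ^ 2 / (4 * c) * S ^ 2 - M * b * S = (2 * c * b - M * S) ^ 2 / (4 * c) := by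
    field_simp; ring
  have h2 : 0 ≤ (2 * c * b - M * S) ^ 2 / (4 * c) := by positivity
  linarith

/-- The sum of all quantities that are of the order of the error at a cell. -/
noncomputable def errSize (h k : ℝ) (u' u up R e' e es : GridFun N) (I : Index N) : ℝ :=
  ‖e I‖ + ‖e' I‖ + ‖grad h e I‖ + ‖grad h e' I‖ + ‖es I‖ + ‖grad h es I‖
    + |lap h (fun J => ⟪extrap u' u J, up J - u J⟫) I| + ‖R I‖ + k ^ 2

theorem ErrStep.incr_le (hp : StepParam d K h k α ε)
    (hs : ErrStep K h k α ε u' u up X R e' e es Fd) (I : Index N) :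
    ‖es I - e I‖ ≤ k * (8 * K ^ 2 * (dissip h u' u e' e es I + errSize h k u' u up R e' e es I))
      := by
  refine (hs.incr_le_and_energy hp I).1.trans ?_
  have hk := hp.k_pos
  rw [show 8 * K ^ 2 * (dissip h u' u e' e es I + errSize h k u' u up R e' e es I)
    = 4 * K ^ 2 * (2 * (dissip h u' u e' e es I + errSize h k u' u up R e' e es I)) by ring]
  gcongr
  have := norm_extrap_le e' e I
  have h0 : 0 ≤ dissip h u' u e' e es I := norm_nonneg _
  rw [errSize]
  linarith [norm_nonneg (grad h e I), norm_nonneg (grad h e' I), norm_nonneg (es I),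
    norm_nonneg (grad h es I), abs_nonneg (lap h (fun J => ⟪extrap u' u J, up J - u J⟫) I),
    norm_nonneg (R I), sq_nonneg k]

/-- The normal product is estimated with two different bounds for the component of the reference
increment: one by the error, for the part of the Laplacian that is linear in the errors, and one of
size k h, for the part carrying 1/h. The remaining terms are linear in the dissipated quantity or
quadratic in the errors. Half of the dissipation is left over for the projection. -/
theorem ErrStep.energy_le (hp : StepParam d K h k α ε)
    (hs : ErrStep K h k α ε u' u up X R e' e es Fd) (I : Index N)
    (hm : ∀ J, ‖u J + e J‖ = 1) (he' : ‖e' I‖ ≤ h) (he : ‖e I‖ ≤ h) :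
    ‖es I‖ ^ 2 - ‖e I‖ ^ 2 - 2 * ⟪es I - e I, lap h (e + (1 / 2 : ℝ) • (es - e)) I⟫ ≤
      k * (-(ε * α) * dissip h u' u e' e es I ^ 2
        + (1000 + 64 / (ε * α)) * K ^ 4 * errSize h k u' u up R e' e es I ^ 2) := by
  have hK := hp.one_le
  have hh := hp.h_pos
  have hk := hp.k_pos
  have hc : 0 < ε * α := mul_pos hp.ε_pos hp.α_pos
  obtain ⟨h1, h2⟩ := hs.incr_le_and_energy hp I
  have h3 := abs_inner_lap_avg_le hp hs.toRefStep I hm he' he (hs.grad_err'_le I)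
    (hs.grad_err_le I) (hs.inner_eq_zero hp)
  have h4 := hs.toRefStep.abs_inner_le hp (extrap (u' + e') (u + e)) I
  rw [show extrap (u' + e') (u + e) I - extrap u' u I = extrap e' e I by
    rw [extrap_add, Pi.add_apply]; abel] at h4
  have h5 := norm_extrap_le e' e I
  set b := dissip h u' u e' e es I with hb
  have hb0 : 0 ≤ b := norm_nonneg _
  set S := errSize h k u' u up R e' e es I with hS
  set q := |lap h (fun J => ⟪extrap u' u J, up J - u J⟫) I| with hq
  set aw := |⟪extrap (u' + e') (u + e) I, up I - u I⟫|
  set aD := |⟪extrap (u' + e') (u + e) I, lap h (e + (1 / 2 : ℝ) • (es - e)) I⟫|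
  have n1 := norm_nonneg (e I)
  have n2 := norm_nonneg (e' I)
  have n3 := norm_nonneg (grad h e I)
  have n4 := norm_nonneg (grad h e' I)
  have n5 := norm_nonneg (es I)
  have n6 := norm_nonneg (grad h es I)
  have n7 : 0 ≤ q := abs_nonneg _
  have n8 := norm_nonneg (R I)
  have n9 : 0 ≤ k ^ 2 := by positivity
  have hSe : S = ‖e I‖ + ‖e' I‖ + ‖grad h e I‖ + ‖grad h e' I‖ + ‖es I‖ + ‖grad h es I‖
    + q + ‖R I‖ + k ^ 2 := rfl
  have hS0 : 0 ≤ S := by rw [hSe]; positivity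
  have haw0 : 0 ≤ aw := abs_nonneg _
  clear_value S b aw aD q
  have hy : ‖(es - e) I‖ ≤ ‖es I‖ + ‖e I‖ := norm_sub_le _ _
  have hgy : ‖grad h (es - e) I‖ ≤ ‖grad h es I‖ + ‖grad h e I‖ := by
    rw [grad_sub]; exact norm_sub_le _ _
  have haD : aD ≤ 41 * K ^ 2 * S + 6 * h⁻¹ * S ^ 2 := by
    refine h3.trans ?_
    have p1 : q ≤ K ^ 2 * S := by
      calc q ≤ S := by rw [hSe]; linarith
        _ ≤ _ := le_mul_of_one_le_left hS0 (by nlinarith)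
    have p2 : ‖e I‖ + ‖e' I‖ + ‖grad h e I‖ + ‖grad h e' I‖ + ‖(es - e) I‖
        + ‖grad h (es - e) I‖ ≤ 2 * S := by rw [hSe]; linarith
    have p3 : ‖(es - e) I‖ * (‖grad h e I‖ + ‖grad h e' I‖) ≤ S * S :=
      mul_le_mul (by rw [hSe]; linarith) (by rw [hSe]; linarith) (by positivity) hS0
    have p4 := mul_le_mul_of_nonneg_left p2 (by positivity : 0 ≤ 20 * K ^ 2)
    have p5 := mul_le_mul_of_nonneg_left p3 (by positivity : 0 ≤ 6 * h⁻¹)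
    linarith
  -- This bound is linear in the error; the next one, of size k h, needs the maximum norm bounds on
  -- both errors together with k ≤ 1 and k ≤ K h.
  have haw1 : aw ≤ 2 * k * K ^ 2 * S := by
    refine h4.trans ?_
    calc _ ≤ k * (K ^ 2 * (2 * S)) := by gcongr; rw [hSe]; linarith
      _ = _ := by ring
  have haw2 : aw ≤ 5 * k * K ^ 3 * h := by
    refine h4.trans ?_
    have : ‖extrap e' e I‖ + k ^ 2 ≤ 5 * K * h := by
      have q1 : k ^ 2 ≤ K * h := by
        rw [sq]
        exact (mul_le_of_le_one_left hk.le hp.k_le).trans hp.k_le_h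
      have q2 : h ≤ K * h := le_mul_of_one_le_left hh.le hK
      linarith
    calc _ ≤ k * (K ^ 2 * (5 * K * h)) := by gcongr
      _ = _ := by ring
  have hprod : aw * aD ≤ k * (112 * K ^ 4 * S ^ 2) := by
    calc aw * aD ≤ aw * (41 * K ^ 2 * S) + aw * (6 * h⁻¹ * S ^ 2) := by
          rw [← mul_add]; gcongr
      _ ≤ 2 * k * K ^ 2 * S * (41 * K ^ 2 * S) + 5 * k * K ^ 3 * h * (6 * h⁻¹ * S ^ 2) := by
          gcongr
      _ = k * ((82 * K ^ 4 + 30 * K ^ 3) * S ^ 2) := by field_simp; ring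
      _ ≤ _ := by
          gcongr
          have : K ^ 3 ≤ K ^ 4 := pow_le_pow_right₀ hK (by norm_num)
          linarith
  have hl2 : ‖es I‖ ^ 2 - ‖e I‖ ^ 2 ≤ k * (4 * K ^ 2 * b * S + 8 * K ^ 2 * S ^ 2) := by
    have p0 : ‖es I‖ ^ 2 - ‖e I‖ ^ 2 ≤ ‖es I - e I‖ * S := by
      have q1 := abs_norm_sub_norm_le (es I) (e I)
      rw [sq_sub_sq, mul_comm]
      calc _ ≤ ‖es I - e I‖ * (‖es I‖ + ‖e I‖) := by
            gcongr; exact (le_abs_self _).trans q1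
        _ ≤ _ := by gcongr; rw [hSe]; linarith
    calc _ ≤ _ := p0
      _ ≤ k * (4 * K ^ 2 * (b + 2 * S)) * S := by
          have : b + ‖extrap e' e I‖ + ‖R I‖ ≤ b + 2 * S := by rw [hSe]; linarith
          exact mul_le_mul_of_nonneg_right (h1.trans (mul_le_mul_of_nonneg_left
            (mul_le_mul_of_nonneg_left this (by positivity)) hk.le)) (by positivity)
      _ = _ := by ring
  have hen : 3 * K ^ 2 * (‖extrap e' e I‖ + ‖R I‖) * b ≤ 6 * K ^ 2 * b * S := by
    calc _ ≤ 3 * K ^ 2 * (2 * S) * b := by gcongr; rw [hSe]; linarith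
      _ = _ := by ring
  -- The coefficient 16 collects 4 from the L² part and twice 6 from the field terms. Young's
  -- inequality consumes one of the two copies of the dissipation.
  have hyo := young (b := b) (S := S) (M := 16 * K ^ 2) hc
  have e1 : (16 * K ^ 2) ^ 2 / (4 * (ε * α)) = 64 / (ε * α) * K ^ 4 := by field_simp; norm_num
  rw [e1] at hyo
  have hK24 : K ^ 2 * S ^ 2 ≤ K ^ 4 * S ^ 2 := by
    gcongr; norm_num
  have fin : -(2 * (ε * α)) * b ^ 2 + 2 * (3 * K ^ 2 * (‖extrap e' e I‖ + ‖R I‖) * b)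
      + 8 * (112 * K ^ 4 * S ^ 2) + (4 * K ^ 2 * b * S + 8 * K ^ 2 * S ^ 2)
      ≤ -(ε * α) * b ^ 2 + (1000 + 64 / (ε * α)) * K ^ 4 * S ^ 2 := by
    have : 0 ≤ K ^ 4 * S ^ 2 := by positivity
    linarith
  have fin2 := mul_le_mul_of_nonneg_left fin hk.le
  linarith

/-- The cruder bound that is used for the first step. -/
theorem ErrStep.energy_le_first (hp : StepParam d K h k α ε)
    (hs : ErrStep K h k α ε u' u up X R e' e es Fd) (I : Index N) {S : ℝ}
    (hS : ‖e I‖ + ‖e' I‖ + ‖grad h e I‖ + ‖R I‖ + k ^ 2 ≤ S) :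
    ‖es I‖ ^ 2 - ‖e I‖ ^ 2 - 2 * ⟪es I - e I, lap h (e + (1 / 2 : ℝ) • (es - e)) I⟫ ≤
      k * ((8 + 64 / (ε * α)) * K ^ 4 * (‖es I‖ + S) ^ 2) + 1 / 4 * ‖grad h es I‖ ^ 2
        + 30000 * K ^ 6 * S ^ 2 := by
  have hK := hp.one_le
  have hh := hp.h_pos
  have hk := hp.k_pos
  have hc : 0 < ε * α := mul_pos hp.ε_pos hp.α_pos
  obtain ⟨h1, h2⟩ := hs.incr_le_and_energy hp I
  have h4 := hs.toRefStep.abs_inner_le hp (extrap (u' + e') (u + e)) I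
  rw [show extrap (u' + e') (u + e) I - extrap u' u I = extrap e' e I by
    rw [extrap_add, Pi.add_apply]; abel] at h4
  have h5 := norm_extrap_le e' e I
  set b := dissip h u' u e' e es I with hb
  have hb0 : 0 ≤ b := norm_nonneg _
  set aw := |⟪extrap (u' + e') (u + e) I, up I - u I⟫|
  set aD := |⟪extrap (u' + e') (u + e) I, lap h (e + (1 / 2 : ℝ) • (es - e)) I⟫|
  have n1 := norm_nonneg (e I)
  have n2 := norm_nonneg (e' I)
  have n3 := norm_nonneg (grad h e I)
  have n5 := norm_nonneg (es I)
  have n6 := norm_nonneg (grad h es I)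
  have n8 := norm_nonneg (R I)
  have n9 : 0 ≤ k ^ 2 := by positivity
  have hS0 : 0 ≤ S := le_trans (by positivity) hS
  set P := ‖es I‖ + S with hP
  have hP0 : 0 ≤ P := by positivity
  clear_value b
  -- No unit length is available here, so the normal component is bounded crudely by the inverse
  -- estimate, using k ≤ K h. The price is a gradient of the new error without a factor k.
  have haD : k * aD ≤ 9 * K * (‖grad h es I‖ + S) := by
    have p1 : aD ≤ 3 * ‖lap h (e + (1 / 2 : ℝ) • (es - e)) I‖ :=
      (abs_real_inner_le_norm _ _).trans (by gcongr; exact hs.norm_extrap_le_three I)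
    have p2 : ‖grad h (e + (1 / 2 : ℝ) • (es - e)) I‖ ≤ 1 / 2 * (‖grad h es I‖ + S) := by
      rw [show e + (1 / 2 : ℝ) • (es - e) = (1 / 2 : ℝ) • (es + e) by module, grad_smul, grad_add,
        norm_smul]
      norm_num
      linarith [norm_add_le (grad h es I) (grad h e I)]
    calc k * aD ≤ (K * h) * (3 * ‖lap h (e + (1 / 2 : ℝ) • (es - e)) I‖) := by
          gcongr; exact hp.k_le_h
      _ = 3 * K * (h * ‖lap h (e + (1 / 2 : ℝ) • (es - e)) I‖) := by ring
      _ ≤ 3 * K * (6 * ‖grad h (e + (1 / 2 : ℝ) • (es - e)) I‖) :=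
          mul_le_mul_of_nonneg_left (hp.mul_lap_le _ I) (by positivity)
      _ ≤ 3 * K * (6 * (1 / 2 * (‖grad h es I‖ + S))) := by gcongr
      _ = _ := by ring
  have hprod : aw * aD ≤ 18 * K ^ 3 * S * (‖grad h es I‖ + S) := by
    calc aw * aD ≤ k * (K ^ 2 * (2 * S)) * aD := by
          gcongr
          refine h4.trans ?_
          gcongr
          linarith
      _ = K ^ 2 * (2 * S) * (k * aD) := by ring
      _ ≤ K ^ 2 * (2 * S) * (9 * K * (‖grad h es I‖ + S)) := by gcongr
      _ = _ := by ring
  have hl2 : ‖es I‖ ^ 2 - ‖e I‖ ^ 2 ≤ k * (4 * K ^ 2 * b * P + 8 * K ^ 2 * P ^ 2) := by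
    have p0 : ‖es I‖ ^ 2 - ‖e I‖ ^ 2 ≤ ‖es I - e I‖ * P := by
      have q1 := abs_norm_sub_norm_le (es I) (e I)
      rw [sq_sub_sq, mul_comm]
      calc _ ≤ ‖es I - e I‖ * (‖es I‖ + ‖e I‖) := by
            gcongr; exact (le_abs_self _).trans q1
        _ ≤ _ := by gcongr; rw [hP]; linarith
    calc _ ≤ _ := p0
      _ ≤ k * (4 * K ^ 2 * (b + 2 * P)) * P := by
          have : b + ‖extrap e' e I‖ + ‖R I‖ ≤ b + 2 * P := by rw [hP]; linarith
          exact mul_le_mul_of_nonneg_right (h1.trans (mul_le_mul_of_nonneg_left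
            (mul_le_mul_of_nonneg_left this (by positivity)) hk.le)) (by positivity)
      _ = _ := by ring
  have hen : 3 * K ^ 2 * (‖extrap e' e I‖ + ‖R I‖) * b ≤ 6 * K ^ 2 * b * P := by
    calc _ ≤ 3 * K ^ 2 * (2 * P) * b := by gcongr; rw [hP]; linarith
      _ = _ := by ring
  have hyo := young (b := b) (S := P) (M := 16 * K ^ 2) hc
  have e1 : (16 * K ^ 2) ^ 2 / (4 * (ε * α)) = 64 / (ε * α) * K ^ 4 := by field_simp; norm_num
  rw [e1] at hyo
  -- The constant 1/4 leaves half of the gradient part of `h1Sq`, so this term can later be absorbed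
  -- on the left.
  have hyo2 := young (c := 1 / 4) (b := ‖grad h es I‖) (S := S) (M := 144 * K ^ 3) (by norm_num)
  have hK24 : K ^ 2 * P ^ 2 ≤ K ^ 4 * P ^ 2 := by
    gcongr; norm_num
  have hK36 : K ^ 3 * S ^ 2 ≤ K ^ 6 * S ^ 2 := by
    gcongr; norm_num
  have fin : -(2 * (ε * α)) * b ^ 2 + 2 * (3 * K ^ 2 * (‖extrap e' e I‖ + ‖R I‖) * b)
      + (4 * K ^ 2 * b * P + 8 * K ^ 2 * P ^ 2)
      ≤ (8 + 64 / (ε * α)) * K ^ 4 * P ^ 2 := by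
    have : 0 ≤ ε * α * b ^ 2 := by positivity
    linarith
  have fin2 := mul_le_mul_of_nonneg_left fin hk.le
  have : 0 ≤ K ^ 6 * S ^ 2 := by positivity
  linarith

end Grid

end LLG

/-! ### The pointwise projection to the sphere. -/

namespace LLG

open scoped RealInnerProductSpace

theorem norm_normalize_sub_le {E : Type*} [NormedAddCommGroup E] [NormedSpace ℝ E] {x y : E}
    (hx : x ≠ 0) (hy : y ≠ 0) :
    ‖‖x‖⁻¹ • x - ‖y‖⁻¹ • y‖ ≤ 2 * ‖x‖⁻¹ * ‖x - y‖ := by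
  have hx' : ‖x‖ ≠ 0 := by simpa
  have hy' : ‖y‖ ≠ 0 := by simpa
  have : ‖x‖⁻¹ • x - ‖y‖⁻¹ • y = ‖x‖⁻¹ • (x - y) + (‖x‖⁻¹ * (‖y‖ - ‖x‖) * ‖y‖⁻¹) • y := by
    have e : ‖x‖⁻¹ * (‖y‖ - ‖x‖) * ‖y‖⁻¹ = ‖x‖⁻¹ - ‖y‖⁻¹ := by field_simp
    rw [e]; module
  rw [this]
  refine (norm_add_le _ _).trans ?_
  rw [norm_smul, norm_smul, norm_mul, norm_mul, norm_inv, norm_inv, norm_norm, norm_norm,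
    Real.norm_eq_abs]
  have h1 : |‖y‖ - ‖x‖| ≤ ‖x - y‖ := by rw [norm_sub_rev]; exact abs_norm_sub_norm_le _ _
  calc _ = ‖x‖⁻¹ * ‖x - y‖ + ‖x‖⁻¹ * |‖y‖ - ‖x‖| := by field_simp
    _ ≤ ‖x‖⁻¹ * ‖x - y‖ + ‖x‖⁻¹ * ‖x - y‖ := by gcongr
    _ = _ := by ring

section Grid

variable {d : ℕ} {N : Fin d → ℕ} {K h k α ε : ℝ}

/-- The pointwise projection to the sphere. -/
noncomputable def normalize (m : GridFun N) : GridFun N := fun I => ‖m I‖⁻¹ • m I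

theorem norm_grad_normalize_le {m : GridFun N} (hm : ∀ I, 1 / 2 ≤ ‖m I‖) (I : Index N) :
    ‖grad h (normalize m) I‖ ≤ 4 * ‖grad h m I‖ := by
  have hne : ∀ J, m J ≠ 0 := fun J h0 => by have := hm J; rw [h0, norm_zero] at this; linarith
  rw [show (4 : ℝ) * ‖grad h m I‖ = ‖(4 : ℝ) • grad h m I‖ by rw [norm_smul]; norm_num,
    PiLp.norm_eq_of_L2, PiLp.norm_eq_of_L2]
  apply Real.sqrt_le_sqrt
  gcongr with p
  rw [PiLp.smul_apply, grad_apply, grad_apply, norm_smul, norm_smul, norm_smul]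
  have h1 := norm_normalize_sub_le (hne (nbr I p)) (hne I)
  have h2 : ‖m (nbr I p)‖⁻¹ ≤ 2 := by
    rw [inv_le_comm₀ (by linarith [hm (nbr I p)]) (by norm_num)]; linarith [hm (nbr I p)]
  calc _ ≤ ‖h⁻¹‖ * (2 * 2 * ‖m (nbr I p) - m I‖) := by
        gcongr
        exact h1.trans (by gcongr)
    _ = _ := by norm_num; ring

variable {u' u up X R e' e es Fd : GridFun N}

/-- The error before projection is the error `ep` after it plus `δ`, the deviation r - 1 times the
projected field `mp`. For two unit fields ⟨ep, mp⟩ is half of |ep|², and the Laplacian of `ep` is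
almost orthogonal to `mp`; hence all cross terms carry a factor |r - 1| and at most one difference
of `ep`. -/
theorem h1Sq_projection_le (hh : 0 < h) (hK : 1 ≤ K) (hup : ∀ I, ‖up I‖ = 1)
    (hgu : ∀ I, ‖grad h up I‖ ≤ K) (hlu : ∀ I, ‖lap h up I‖ ≤ K)
    (hes : ∀ I, ‖es I‖ ≤ 1 / 2) (hges : ∀ I, ‖grad h es I‖ ≤ 1) :
    h1Sq h (normalize (up + es) - up) ≤ h1Sq h es + 20 * K *
      gridSum h (fun I => |‖(up + es) I‖ - 1| * (‖(normalize (up + es) - up) I‖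
        + ‖grad h (normalize (up + es) - up) I‖)) := by
  have hr : ∀ I, 1 / 2 ≤ ‖(up + es) I‖ := fun I => by
    have := norm_sub_norm_le (up I) (-es I)
    rw [norm_neg, sub_neg_eq_add, hup] at this
    rw [Pi.add_apply]; linarith [hes I]
  set mp := normalize (up + es) with hmp
  set ep := mp - up with hep
  set r : Index N → ℝ := fun I => ‖(up + es) I‖ with hrd
  have hmp1 : ∀ I, ‖mp I‖ = 1 := fun I => by
    rw [hmp, normalize, norm_smul, norm_inv, norm_norm, inv_mul_cancel₀]
    linarith [hr I]
  set δ : GridFun N := fun I => (r I - 1) • mp I with hδ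
  have hes' : es = ep + δ := by
    ext1 I
    simp only [hep, hδ, Pi.add_apply, Pi.sub_apply]
    have : (r I) • mp I = up I + es I := by
      rw [hmp, normalize, smul_smul, mul_inv_cancel₀, one_smul]; · rfl
      linarith [hr I]
    rw [sub_smul, this]; module
  have hl2 : ∀ I, ‖ep I‖ ^ 2 ≤ ‖es I‖ ^ 2 + 2 * (|r I - 1| * ‖ep I‖) := by
    intro I
    have e1 : ⟪ep I, mp I⟫ = 1 / 2 * ‖ep I‖ ^ 2 := by
      rw [hep, Pi.sub_apply, norm_sub_sq_real, inner_sub_left, real_inner_self_eq_norm_sq, hmp1,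
        hup, real_inner_comm]; ring
    have e2 : ‖es I‖ ^ 2 = ‖ep I‖ ^ 2 + (r I - 1) * ‖ep I‖ ^ 2 + ‖δ I‖ ^ 2 := by
      rw [hes', Pi.add_apply, norm_add_sq_real, hδ]
      simp only [inner_smul_right]; rw [e1]; ring
    have e3 : ‖ep I‖ ≤ 2 := by
      have := norm_sub_le (mp I) (up I)
      rw [hmp1, hup] at this
      rw [hep, Pi.sub_apply]; linarith
    have e4 : -(r I - 1) * ‖ep I‖ ^ 2 ≤ |r I - 1| * (2 * ‖ep I‖) := by
      gcongr
      · exact neg_le_abs _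
      · rw [sq]; gcongr
    have := sq_nonneg ‖δ I‖
    linarith
  -- Summation by parts moves both differences of the cross term onto `ep`. The gradient of `δ`,
  -- over which there is no control, enters only as a square of favourable sign.
  have hgr : gridSum h (fun I => ‖grad h es I‖ ^ 2) = gridSum h (fun I => ‖grad h ep I‖ ^ 2)
      + -4 * gridSum h (fun I => ⟪δ I, lap h ep I⟫) + gridSum h (fun I => ‖grad h δ I‖ ^ 2) := by
    rw [gridSum_inner_lap h δ ep, hes']
    rw [show -4 * (-(1 / 2) * gridSum h fun I => ⟪grad h δ I, grad h ep I⟫)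
      = 2 * gridSum h fun I => ⟪grad h δ I, grad h ep I⟫ by ring, ← gridSum_mul, ← gridSum_add,
      ← gridSum_add]
    congr 1; ext1 I
    rw [grad_add, norm_add_sq_real, real_inner_comm]
  have hlp : ∀ I, ⟪δ I, lap h ep I⟫ ≤ 9 * K * (|r I - 1| * (‖ep I‖ + ‖grad h ep I‖)) := by
    intro I
    have g1 : ‖grad h mp I‖ ≤ 8 * K := by
      refine (norm_grad_normalize_le hr I).trans ?_
      rw [grad_add]
      linarith [norm_add_le (grad h up I) (grad h es I), hgu I, hges I]
    have g2 := abs_inner_lap_sub_le hmp1 hup g1 (hgu I) (hlu I)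
    rw [hδ]
    simp only [inner_smul_left]
    have g3 : (8 * K + K) * ‖grad h ep I‖ + K * ‖ep I‖
        ≤ 9 * K * (‖ep I‖ + ‖grad h ep I‖) := by
      have : 0 ≤ K * ‖ep I‖ := by positivity
      linarith
    calc _ ≤ |r I - 1| * |⟪mp I, lap h ep I⟫| := by
          rw [← abs_mul]; exact le_abs_self _
      _ ≤ |r I - 1| * (9 * K * (‖ep I‖ + ‖grad h ep I‖)) := by gcongr; exact g2.trans g3
      _ = _ := by ring
  have s1 := gridSum_mono hh hl2
  have s2 := gridSum_mono hh hlp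
  have s3 := gridSum_nonneg hh fun I => sq_nonneg ‖grad h δ I‖
  have s4 : gridSum h (fun I => |r I - 1| * ‖ep I‖)
      ≤ K * gridSum h (fun I => |r I - 1| * (‖ep I‖ + ‖grad h ep I‖)) := by
    rw [← gridSum_mul]
    refine gridSum_mono hh fun I => ?_
    calc _ ≤ |r I - 1| * (‖ep I‖ + ‖grad h ep I‖) := by
          gcongr; linarith [norm_nonneg (grad h ep I)]
      _ ≤ _ := le_mul_of_one_le_left (by positivity) hK
  rw [gridSum_add, gridSum_mul] at s1
  rw [gridSum_mul] at s2
  rw [h1Sq, h1Sq, hgr]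
  linarith

theorem abs_norm_sub_one_le (hup : ∀ I, ‖up I‖ = 1) (I : Index N) :
    |‖(up + es) I‖ - 1| ≤ ‖es I‖ := by
  have := abs_norm_sub_norm_le ((up + es) I) (up I)
  rwa [hup, Pi.add_apply, add_sub_cancel_left] at this

/-- The deviation of the intermediate value from the sphere. -/
theorem ErrStep.abs_norm_sub_one_le (hp : StepParam d K h k α ε)
    (hs : ErrStep K h k α ε u' u up X R e' e es Fd) (hm : ∀ J, ‖u J + e J‖ = 1)
    (I : Index N) (hes : ‖es I‖ ≤ 1 / 2) :
    |‖(up + es) I‖ - 1| ≤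
      k * (18 * K ^ 3 * (dissip h u' u e' e es I + errSize h k u' u up R e' e es I)) := by
  have hK := hp.one_le
  have hk := hp.k_pos
  set S := errSize h k u' u up R e' e es I with hS
  have hb0 : 0 ≤ dissip h u' u e' e es I := norm_nonneg _
  have hy := hs.incr_le hp I
  rw [← hS] at hy
  set b := dissip h u' u e' e es I with hb
  set x := (up + es) I with hx
  set m := (u + e) I with hmd
  have hm1 : ‖m‖ = 1 := hm I
  have n1 := norm_nonneg (e I)
  have n2 := norm_nonneg (e' I)
  have n5 := norm_nonneg (es I)
  -- Both x - m and hence its pairing with the extrapolation a vanish against a, so |x|² - |m|² = ⟨x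
  -- - m, x + m - 2a⟩. The second factor is a second difference in time: small for the reference, of
  -- the size of the errors otherwise.
  have e1 : ‖x‖ ^ 2 - 1 = ⟪(es - e) I + (up I - u I),
      (up I - (2 : ℝ) • u I + u' I) + (es I - (2 : ℝ) • e I + e' I)⟫ := by
    have h0 := hs.inner_eq_zero hp I
    have q1 : (es - e) I + (up I - u I) = x - m := by
      simp only [hx, hmd, Pi.add_apply, Pi.sub_apply]; abel
    have q2 : (up I - (2 : ℝ) • u I + u' I) + (es I - (2 : ℝ) • e I + e' I)
        = x + m - (2 : ℝ) • extrap (u' + e') (u + e) I := by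
      simp only [hx, hmd, extrap, Pi.add_apply]; module
    rw [real_inner_comm] at h0
    rw [q2, inner_sub_right, inner_smul_right, h0, q1, inner_add_right, inner_sub_left,
      inner_sub_left, real_inner_self_eq_norm_sq, real_inner_self_eq_norm_sq, hm1,
      real_inner_comm x m]
    ring
  have e2 : |‖x‖ - 1| ≤ |‖x‖ ^ 2 - 1| := by
    rw [show ‖x‖ ^ 2 - 1 = (‖x‖ + 1) * (‖x‖ - 1) by ring, abs_mul,
      abs_of_pos (by positivity : (0 : ℝ) < ‖x‖ + 1)]
    exact le_mul_of_one_le_left (abs_nonneg _) (by linarith [norm_nonneg x])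
  have hv : ‖(up I - (2 : ℝ) • u I + u' I) + (es I - (2 : ℝ) • e I + e' I)‖
      ≤ K * k ^ 2 + (‖es I‖ + 2 * ‖e I‖ + ‖e' I‖) := by
    refine (norm_add_le _ _).trans (add_le_add (hs.incr2 I) ?_)
    refine (norm_add_le _ _).trans ?_
    gcongr
    refine (norm_sub_le _ _).trans ?_
    rw [norm_smul]; norm_num
  have hk2 : k ^ 2 ≤ 1 := pow_le_one₀ hk.le hp.k_le
  have hS1 : K * k ^ 2 + (‖es I‖ + 2 * ‖e I‖ + ‖e' I‖) ≤ 2 * K * S := by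
    have q1 : K * k ^ 2 + (‖es I‖ + 2 * ‖e I‖ + ‖e' I‖)
        ≤ 2 * K * (k ^ 2 + ‖es I‖ + ‖e I‖ + ‖e' I‖) := by
      have r1 : 0 ≤ K * k ^ 2 := by positivity
      have r2 : ‖es I‖ ≤ K * ‖es I‖ := le_mul_of_one_le_left n5 hK
      have r3 : ‖e I‖ ≤ K * ‖e I‖ := le_mul_of_one_le_left n1 hK
      have r4 : ‖e' I‖ ≤ K * ‖e' I‖ := le_mul_of_one_le_left n2 hK
      linarith
    refine q1.trans ?_
    gcongr
    rw [hS, errSize]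
    linarith [norm_nonneg (grad h e I), norm_nonneg (grad h e' I), norm_nonneg (grad h es I),
      abs_nonneg (lap h (fun J => ⟪extrap u' u J, up J - u J⟫) I), norm_nonneg (R I)]
  have hS2 : K * k ^ 2 + (‖es I‖ + 2 * ‖e I‖ + ‖e' I‖) ≤ 2 * K := by
    have : K * k ^ 2 ≤ K * 1 := by gcongr
    linarith [hs.err_le I, hs.err'_le I]
  clear_value S b
  have hS0 : 0 ≤ S := nonneg_of_mul_nonneg_right
    (le_trans (by positivity) hS1 : (0 : ℝ) ≤ 2 * K * S) (by positivity)
  refine e2.trans ?_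
  rw [e1]
  refine (abs_real_inner_le_norm _ _).trans ?_
  have hy2 : ‖(es - e) I + (up I - u I)‖ ≤ ‖es I - e I‖ + K * k :=
    (norm_add_le _ _).trans (add_le_add le_rfl (hs.incr I))
  calc _ ≤ (‖es I - e I‖ + K * k) * (K * k ^ 2 + (‖es I‖ + 2 * ‖e I‖ + ‖e' I‖)) := by gcongr
    _ = ‖es I - e I‖ * (K * k ^ 2 + (‖es I‖ + 2 * ‖e I‖ + ‖e' I‖))
        + K * k * (K * k ^ 2 + (‖es I‖ + 2 * ‖e I‖ + ‖e' I‖)) := by ring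
    _ ≤ k * (8 * K ^ 2 * (b + S)) * (2 * K) + K * k * (2 * K * S) := by gcongr
    _ = k * (16 * K ^ 3 * (b + S) + 2 * K ^ 2 * S) := by ring
    _ ≤ _ := by
        have : K ^ 2 * S ≤ K ^ 3 * (b + S) := by
          gcongr
          · norm_num
          · linarith
        have : 16 * K ^ 3 * (b + S) + 2 * K ^ 2 * S ≤ 18 * K ^ 3 * (b + S) := by linarith
        gcongr

end Grid

end LLG

/-! ### Summed one-step stability estimates. -/

namespace LLG

open scoped RealInnerProductSpace

theorem add_sq_le_two (a b : ℝ) : (a + b) ^ 2 ≤ 2 * a ^ 2 + 2 * b ^ 2 := by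
  linarith [sq_nonneg (a - b), add_sq a b, sub_sq a b]

section Grid

variable {d : ℕ} {N : Fin d → ℕ} {K h k α ε : ℝ} {u' u up X R e' e es Fd : GridFun N}

theorem gridSum_sq_add_grad_le (hh : 0 < h) (f : GridFun N) :
    gridSum h (fun I => ‖f I‖ ^ 2 + ‖grad h f I‖ ^ 2) ≤ 2 * h1Sq h f := by
  have := gridSum_nonneg hh fun I => sq_nonneg ‖f I‖
  rw [gridSum_add, h1Sq]; linarith

/-- Square-summed bounds for the residuals of the reference solution. -/
structure RefResidual (K h k : ℝ) (u' u up R : GridFun N) : Prop where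
  vol : gridSum h (fun _ : Index N => 1) ≤ K
  res : gridSum h (fun I => ‖R I‖ ^ 2) ≤ K * (k ^ 2 + h ^ 2) ^ 2
  normal : gridSum h (fun I => lap h (fun J => ⟪extrap u' u J, up J - u J⟫) I ^ 2)
    ≤ K * (k ^ 2 + h ^ 2) ^ 2

theorem RefResidual.gridSum_pow_le (hp : StepParam d K h k α ε) (hr : RefResidual K h k u' u up R) :
    gridSum h (fun _ : Index N => (k ^ 2) ^ 2) ≤ K * (k ^ 2 + h ^ 2) ^ 2 := by
  have : (fun _ : Index N => (k ^ 2) ^ 2) = fun _ : Index N => (k ^ 2) ^ 2 * 1 := by simp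
  have h1 : gridSum h (fun _ : Index N => 1) ≤ K := hr.vol
  have h2 : 0 ≤ gridSum h (fun _ : Index N => (1 : ℝ)) := gridSum_nonneg hp.h_pos fun _ => zero_le_one
  rw [this, gridSum_mul, mul_comm K]
  have h3 : k ^ 2 ≤ k ^ 2 + h ^ 2 := by linarith [sq_nonneg h]
  gcongr

theorem RefResidual.gridSum_errSize_le (hp : StepParam d K h k α ε)
    (hr : RefResidual K h k u' u up R) :
    gridSum h (fun I => errSize h k u' u up R e' e es I ^ 2) ≤
      768 * (h1Sq h e + h1Sq h e' + h1Sq h es + K * (k ^ 2 + h ^ 2) ^ 2) := by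
  have hh := hp.h_pos
  have h1 : ∀ I, errSize h k u' u up R e' e es I ^ 2 ≤
      256 * ((‖e I‖ ^ 2 + ‖grad h e I‖ ^ 2) + (‖e' I‖ ^ 2 + ‖grad h e' I‖ ^ 2)
        + (‖es I‖ ^ 2 + ‖grad h es I‖ ^ 2)
        + lap h (fun J => ⟪extrap u' u J, up J - u J⟫) I ^ 2 + ‖R I‖ ^ 2 + (k ^ 2) ^ 2) := by
    intro I
    have key : ∀ a b c d e f g h i : ℝ, (a + b + c + d + e + f + |g| + h + i) ^ 2 ≤
        256 * ((a ^ 2 + c ^ 2) + (b ^ 2 + d ^ 2) + (e ^ 2 + f ^ 2) + g ^ 2 + h ^ 2 + i ^ 2) := by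
      intro a b c d e f g h i
      have t1 := add_sq_le_two (a + b + c + d + e + f + |g| + h) i
      have t2 := add_sq_le_two (a + b + c + d + e + f + |g|) h
      have t3 := add_sq_le_two (a + b + c + d + e + f) |g|
      have t4 := add_sq_le_two (a + b + c + d + e) f
      have t5 := add_sq_le_two (a + b + c + d) e
      have t6 := add_sq_le_two (a + b + c) d
      have t7 := add_sq_le_two (a + b) c
      have t8 := add_sq_le_two a b
      have := sq_abs g
      linarith [sq_nonneg a, sq_nonneg b, sq_nonneg c, sq_nonneg d, sq_nonneg e, sq_nonneg f,
        sq_nonneg g, sq_nonneg h, sq_nonneg i]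
    exact key _ _ _ _ _ _ _ _ _
  refine (gridSum_mono hh h1).trans ?_
  rw [gridSum_mul, gridSum_add, gridSum_add, gridSum_add, gridSum_add, gridSum_add]
  have := gridSum_sq_add_grad_le hh e
  have := gridSum_sq_add_grad_le hh e'
  have := gridSum_sq_add_grad_le hh es
  have := hr.gridSum_pow_le hp
  linarith [hr.res, hr.normal, h1Sq_nonneg hh e, h1Sq_nonneg hh e', h1Sq_nonneg hh es]

theorem h1Sq_step (hp : StepParam d K h k α ε) (hs : ErrStep K h k α ε u' u up X R e' e es Fd)
    (hm : ∀ J, ‖u J + e J‖ = 1) (he' : ∀ I, ‖e' I‖ ≤ h) (he : ∀ I, ‖e I‖ ≤ h) :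
    h1Sq h es ≤ h1Sq h e - k * (ε * α) * gridSum h (fun I => dissip h u' u e' e es I ^ 2)
      + k * ((1000 + 64 / (ε * α)) * K ^ 4)
        * gridSum h (fun I => errSize h k u' u up R e' e es I ^ 2) := by
  have h1 := gridSum_mono hp.h_pos fun I => hs.energy_le hp I hm (he' I) (he I)
  rw [gridSum_energy, gridSum_mul, gridSum_add, gridSum_mul, gridSum_mul] at h1
  linarith

/-- The deviation from the sphere contains the dissipated quantity with a factor k. Young's
inequality with coefficient exactly εα makes the resulting term equal to the dissipation that
`h1Sq_step` leaves, so the two cancel when added. -/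
theorem h1Sq_step_projection (hp : StepParam d K h k α ε)
    (hs : ErrStep K h k α ε u' u up X R e' e es Fd) (hm : ∀ J, ‖u J + e J‖ = 1)
    (hes : ∀ I, ‖es I‖ ≤ 1 / 2) (hges : ∀ I, ‖grad h es I‖ ≤ 1) :
    h1Sq h (normalize (up + es) - up) ≤ h1Sq h es
      + k * (ε * α) * gridSum h (fun I => dissip h u' u e' e es I ^ 2)
      + k * (180 * K ^ 4) * gridSum h (fun I => errSize h k u' u up R e' e es I ^ 2)
      + k * (4 * ((360 * K ^ 4) ^ 2 / (4 * (ε * α)) + 180 * K ^ 4))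
        * h1Sq h (normalize (up + es) - up) := by
  have hK := hp.one_le
  have hk := hp.k_pos
  have hh := hp.h_pos
  have hc : 0 < ε * α := mul_pos hp.ε_pos hp.α_pos
  have h1 := h1Sq_projection_le hh hK hs.unitp hs.gradp_le hs.lapp_le hes hges
  set ep := normalize (up + es) - up with hep
  set M := (360 * K ^ 4) ^ 2 / (4 * (ε * α)) + 180 * K ^ 4 with hM
  have hM0 : 0 ≤ M := by positivity
  have h2 : ∀ I, 20 * K * (|‖(up + es) I‖ - 1| * (‖ep I‖ + ‖grad h ep I‖)) ≤
      k * (ε * α) * dissip h u' u e' e es I ^ 2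
      + k * (180 * K ^ 4) * errSize h k u' u up R e' e es I ^ 2
      + k * M * (2 * (‖ep I‖ ^ 2 + ‖grad h ep I‖ ^ 2)) := by
    intro I
    have q1 := hs.abs_norm_sub_one_le hp hm I (hes I)
    set b := dissip h u' u e' e es I
    set S := errSize h k u' u up R e' e es I
    set P := ‖ep I‖ + ‖grad h ep I‖ with hP
    have hP0 : 0 ≤ P := by positivity
    have q2 := young (b := b) (S := P) (M := 360 * K ^ 4) hc
    have q3 : 360 * K ^ 4 * S * P ≤ 180 * K ^ 4 * S ^ 2 + 180 * K ^ 4 * P ^ 2 := by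
      have := mul_nonneg (by positivity : 0 ≤ 180 * K ^ 4) (sq_nonneg (S - P))
      linarith
    have q4 : P ^ 2 ≤ 2 * (‖ep I‖ ^ 2 + ‖grad h ep I‖ ^ 2) := by
      have := add_sq_le_two ‖ep I‖ ‖grad h ep I‖
      linarith
    clear_value b S P
    calc _ ≤ 20 * K * (k * (18 * K ^ 3 * (b + S)) * P) := by gcongr
      _ = k * (360 * K ^ 4 * b * P + 360 * K ^ 4 * S * P) := by ring
      _ ≤ k * (ε * α * b ^ 2 + 180 * K ^ 4 * S ^ 2
          + M * (2 * (‖ep I‖ ^ 2 + ‖grad h ep I‖ ^ 2))) := by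
          refine mul_le_mul_of_nonneg_left ?_ hk.le
          have := mul_le_mul_of_nonneg_left q4 hM0
          rw [hM] at this ⊢
          linarith
      _ = _ := by ring
  have h3 := gridSum_mono hh h2
  rw [gridSum_mul, gridSum_add, gridSum_add, gridSum_mul, gridSum_mul, gridSum_mul, gridSum_mul]
    at h3
  have h4 := mul_le_mul_of_nonneg_left (gridSum_sq_add_grad_le hh ep)
    (by positivity : 0 ≤ k * M * 2)
  linarith

/-- Stability of one step of the scheme. -/
theorem exists_step_const (K α ε : ℝ) (hK : 1 ≤ K) (hα : 0 < α) (hε : 0 < ε) :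
    ∃ C : ℝ, 1 ≤ C ∧ ∀ {d : ℕ} {N : Fin d → ℕ} {h k : ℝ} {u' u up X R e' e es Fd : GridFun N},
      StepParam d K h k α ε → k * C ≤ 1 → ErrStep K h k α ε u' u up X R e' e es Fd →
      RefResidual K h k u' u up R → (∀ J, ‖u J + e J‖ = 1) → (∀ I, ‖e' I‖ ≤ h) →
      (∀ I, ‖e I‖ ≤ h) →
      h1Sq h es ≤ C * (h1Sq h e + h1Sq h e' + (k ^ 2 + h ^ 2) ^ 2) ∧
      ((∀ I, ‖es I‖ ≤ 1 / 2) → (∀ I, ‖grad h es I‖ ≤ 1) →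
        h1Sq h (normalize (up + es) - up) ≤
          h1Sq h e + C * k * (h1Sq h e + h1Sq h e' + (k ^ 2 + h ^ 2) ^ 2)) := by
  have hc : 0 < ε * α := mul_pos hε hα
  set C1 := (1000 + 64 / (ε * α)) * K ^ 4 with hC1
  set C2 := 4 * ((360 * K ^ 4) ^ 2 / (4 * (ε * α)) + 180 * K ^ 4) with hC2
  have hC1p : 0 < C1 := by positivity
  have hC2p : 0 < C2 := by positivity
  -- The factor 3072 is 768 · 4: `errSize` also contains the new error, which is at most three times
  -- the given data.
  set C3 := (C1 + 180 * K ^ 4) * 3072 * K with hC3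
  have hC3p : 0 < C3 := by positivity
  refine ⟨1 + 3 * K + 2000 * C1 + 2 * C2 + 2 * C3, by linarith, ?_⟩
  intro d N h k u' u up X R e' e es Fd hp hkC hs hr hm he' he
  have hh := hp.h_pos
  have hk := hp.k_pos
  set τ := (k ^ 2 + h ^ 2) ^ 2 with hτ
  have hτ0 : 0 ≤ τ := by positivity
  have n1 := h1Sq_nonneg hh e
  have n2 := h1Sq_nonneg hh e'
  have n3 := h1Sq_nonneg hh es
  have n4 := h1Sq_nonneg hh (normalize (up + es) - up)
  have hS := hr.gridSum_errSize_le (e' := e') (e := e) (es := es) hp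
  have hA := h1Sq_step hp hs hm he' he
  have hB := h1Sq_step_projection hp hs hm
  set B := gridSum h (fun I => dissip h u' u e' e es I ^ 2) with hBd
  have hB0 : 0 ≤ B := gridSum_nonneg hh fun I => sq_nonneg _
  set S := gridSum h (fun I => errSize h k u' u up R e' e es I ^ 2) with hSd
  have hS0 : 0 ≤ S := gridSum_nonneg hh fun I => sq_nonneg _
  set E := h1Sq h e
  set E' := h1Sq h e'
  set Es := h1Sq h es
  set Ep := h1Sq h (normalize (up + es) - up)
  rw [← hτ] at hS
  rw [← hC1] at hA
  rw [← hC2] at hB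
  clear_value B S E E' Es Ep C1 C2 C3 τ
  have hk0 : 0 ≤ k * K := by positivity
  have hk1 : 0 ≤ k * C1 := by positivity
  have hk2 : 0 ≤ k * C2 := by positivity
  have hk3 : 0 ≤ k * C3 := by positivity
  have hkC' : k + 3 * (k * K) + 2000 * (k * C1) + 2 * (k * C2) + 2 * (k * C3) ≤ 1 := by linarith
  have hZ : E + E' + K * τ ≤ K * (E + E' + τ) := by
    have := mul_le_mul_of_nonneg_right hK (by linarith : 0 ≤ E + E')
    linarith
  have hkB : 0 ≤ k * (ε * α) * B := by positivity
  -- The smallness of k absorbs the new error on the left: 768 k C1 ≤ 1/2, since 2000 C1 is part of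
  -- the constant.
  have hEs : Es ≤ 3 * (E + E' + K * τ) := by
    have t1 : k * C1 * S ≤ 1 / 2 * (E + E' + Es + K * τ) := by
      calc _ ≤ k * C1 * (768 * (E + E' + Es + K * τ)) := by gcongr
        _ = (768 * (k * C1)) * (E + E' + Es + K * τ) := by ring
        _ ≤ _ := by
          have : 0 ≤ E + E' + Es + K * τ := by positivity
          gcongr; linarith
    have : 0 ≤ K * τ := by positivity
    linarith
  have hS2 : S ≤ 3072 * (E + E' + K * τ) := by linarith
  constructor
  · calc Es ≤ 3 * (K * (E + E' + τ)) := by linarith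
      _ = (3 * K) * (E + E' + τ) := by ring
      _ ≤ _ := by gcongr; linarith
  · intro h1 h2
    have hB' := hB h1 h2
    have t2 : k * C1 * S + k * (180 * K ^ 4) * S ≤ k * C3 * (E + E' + τ) := by
      calc _ = k * (C1 + 180 * K ^ 4) * S := by ring
        _ ≤ k * (C1 + 180 * K ^ 4) * (3072 * (K * (E + E' + τ))) := by
            gcongr; linarith
        _ = _ := by rw [hC3]; ring
    have t3 : Ep * (1 - k * C2) ≤ E + k * C3 * (E + E' + τ) := by linarith
    have hx : 0 ≤ E + E' + τ := by positivity
    -- Here 1/(1 - x) ≤ 1 + 2x with x = k C2 ≤ 1/2. The coefficient of E in the result stays 1 +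
    -- O(k), as Gronwall requires.
    have t4 : Ep ≤ (E + k * C3 * (E + E' + τ)) * (1 + 2 * (k * C2)) := by
      have : 1 ≤ (1 - k * C2) * (1 + 2 * (k * C2)) := by nlinarith
      calc Ep = Ep * 1 := by ring
        _ ≤ Ep * ((1 - k * C2) * (1 + 2 * (k * C2))) := by gcongr
        _ = Ep * (1 - k * C2) * (1 + 2 * (k * C2)) := by ring
        _ ≤ _ := by gcongr
    have t5 : k * C3 * (E + E' + τ) * (1 + 2 * (k * C2)) ≤ k * C3 * (E + E' + τ) * 2 := by
      gcongr; linarith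
    have t6 : E * (2 * (k * C2)) ≤ (E + E' + τ) * (2 * (k * C2)) := by gcongr; linarith
    have t7 : 0 ≤ k * (1 + 3 * K + 2000 * C1) * (E + E' + τ) := by positivity
    linarith

/-- Stability of the first step, where the value at the later initial time is not on the sphere. -/
theorem exists_first_step_const (K α ε : ℝ) (hK : 1 ≤ K) (hα : 0 < α) (hε : 0 < ε) :
    ∃ C : ℝ, 1 ≤ C ∧ ∀ {d : ℕ} {N : Fin d → ℕ} {h k : ℝ} {u' u up X R e' e es Fd : GridFun N},
      StepParam d K h k α ε → k * C ≤ 1 → ErrStep K h k α ε u' u up X R e' e es Fd →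
      RefResidual K h k u' u up R →
      h1Sq h es ≤ C * (h1Sq h e + h1Sq h e' + (k ^ 2 + h ^ 2) ^ 2) ∧
      ((∀ I, ‖es I‖ ≤ 1 / 2) → (∀ I, ‖grad h es I‖ ≤ 1) →
        h1Sq h (normalize (up + es) - up) ≤
          C * (h1Sq h e + h1Sq h e' + (k ^ 2 + h ^ 2) ^ 2)) := by
  have hc : 0 < ε * α := mul_pos hε hα
  set C1 := (8 + 64 / (ε * α)) * K ^ 4 with hC1
  have hC1p : 0 < C1 := by positivity
  set C2 := 4 * (30000 * K ^ 6 + 1) * 48 * K with hC2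
  have hC2p : 0 < C2 := by positivity
  refine ⟨1 + 16 * C1 + C2 + 2 * (1 + (40 * K) ^ 2) * C2, by
    have : 0 ≤ 2 * (1 + (40 * K) ^ 2) * C2 := by positivity
    linarith, ?_⟩
  intro d N h k u' u up X R e' e es Fd hp hkC hs hr
  have hh := hp.h_pos
  have hk := hp.k_pos
  have hx1 : 0 ≤ 2 * (1 + (40 * K) ^ 2) * C2 := by positivity
  have hkC1 : 16 * (k * C1) ≤ 1 := by
    have q1 : 0 ≤ k * (2 * (1 + (40 * K) ^ 2) * C2) := by positivity
    have q2 : 0 ≤ k * C2 := by positivity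
    linarith
  -- The gradient of the new error is deliberately not part of this quantity; a quarter of its
  -- square appears separately and is absorbed.
  let T : Index N → ℝ := fun I => ‖e I‖ + ‖e' I‖ + ‖grad h e I‖ + ‖R I‖ + k ^ 2
  have h1 : ∀ I, ‖es I‖ ^ 2 - ‖e I‖ ^ 2
      - 2 * ⟪es I - e I, lap h (e + (1 / 2 : ℝ) • (es - e)) I⟫ ≤
      1 / 8 * ‖es I‖ ^ 2 + 1 / 4 * ‖grad h es I‖ ^ 2 + (30000 * K ^ 6 + 1) * T I ^ 2 := by
    intro I
    have q := hs.energy_le_first hp I (S := T I) le_rfl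
    have q2 := add_sq_le_two ‖es I‖ (T I)
    have q3 : k * (C1 * (‖es I‖ + T I) ^ 2) ≤ 1 / 16 * (2 * ‖es I‖ ^ 2 + 2 * T I ^ 2) := by
      rw [← mul_assoc]
      gcongr
      linarith
    linarith [sq_nonneg (T I)]
  have h2 := gridSum_mono hh h1
  rw [gridSum_energy, gridSum_add, gridSum_add, gridSum_mul, gridSum_mul, gridSum_mul] at h2
  have h3 : ∀ I, T I ^ 2 ≤ 16 * ((‖e I‖ ^ 2 + ‖grad h e I‖ ^ 2) + (‖e' I‖ ^ 2 + ‖grad h e' I‖ ^ 2)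
      + ‖R I‖ ^ 2 + (k ^ 2) ^ 2) := by
    intro I
    have t1 := add_sq_le_two (‖e I‖ + ‖e' I‖ + ‖grad h e I‖ + ‖R I‖) (k ^ 2)
    have t2 := add_sq_le_two (‖e I‖ + ‖e' I‖ + ‖grad h e I‖) ‖R I‖
    have t3 := add_sq_le_two (‖e I‖ + ‖e' I‖) ‖grad h e I‖
    have t4 := add_sq_le_two ‖e I‖ ‖e' I‖
    linarith [sq_nonneg ‖e I‖, sq_nonneg ‖e' I‖, sq_nonneg ‖grad h e I‖, sq_nonneg ‖R I‖,
      sq_nonneg (k ^ 2), sq_nonneg ‖grad h e' I‖]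
  have h4 := gridSum_mono hh h3
  rw [gridSum_mul, gridSum_add, gridSum_add, gridSum_add] at h4
  have g1 := gridSum_sq_add_grad_le hh e
  have g2 := gridSum_sq_add_grad_le hh e'
  have g3 := hr.gridSum_pow_le hp
  have g4 := hr.res
  have g5 := gridSum_nonneg hh fun I => sq_nonneg ‖es I‖
  have g6 := gridSum_nonneg hh fun I => sq_nonneg ‖grad h es I‖
  have n1 := h1Sq_nonneg hh e
  have n2 := h1Sq_nonneg hh e'
  have hTs : gridSum h (fun I => T I ^ 2)
      ≤ 48 * K * (h1Sq h e + h1Sq h e' + (k ^ 2 + h ^ 2) ^ 2) := by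
    have := mul_le_mul_of_nonneg_right hK (by linarith : 0 ≤ h1Sq h e + h1Sq h e')
    have : 0 ≤ K * (k ^ 2 + h ^ 2) ^ 2 := by positivity
    linarith
  set Z := h1Sq h e + h1Sq h e' + (k ^ 2 + h ^ 2) ^ 2 with hZ
  have hZ0 : 0 ≤ Z := by positivity
  have hEs : h1Sq h es ≤ C2 * Z := by
    have q1 : h1Sq h es - h1Sq h e ≤ 1 / 2 * h1Sq h es
        + (30000 * K ^ 6 + 1) * (48 * K * Z) := by
      have := mul_le_mul_of_nonneg_left hTs (by positivity : 0 ≤ 30000 * K ^ 6 + 1)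
      have e1 : h1Sq h es = gridSum h (fun I => ‖es I‖ ^ 2)
        + 1 / 2 * gridSum h (fun I => ‖grad h es I‖ ^ 2) := rfl
      linarith
    have q2 : h1Sq h e ≤ (30000 * K ^ 6 + 1) * (48 * K * Z) := by
      have : h1Sq h e ≤ Z := by rw [hZ]; linarith [sq_nonneg (k ^ 2 + h ^ 2)]
      refine this.trans ?_
      rw [← mul_assoc]
      refine le_mul_of_one_le_left hZ0 ?_
      have : (1 : ℝ) ≤ K ^ 6 := one_le_pow₀ hK
      nlinarith
    rw [hC2]; linarith
  constructor
  · refine hEs.trans ?_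
    gcongr; linarith
  · intro r1 r2
    have p1 := h1Sq_projection_le hh hK hs.unitp hs.gradp_le hs.lapp_le r1 r2
    set ep := normalize (up + es) - up with hep
    have p2 : ∀ I, 20 * K * (|‖(up + es) I‖ - 1| * (‖ep I‖ + ‖grad h ep I‖)) ≤
        (40 * K) ^ 2 * (1 / 2) * ‖es I‖ ^ 2 + 1 / 4 * (‖ep I‖ ^ 2 + ‖grad h ep I‖ ^ 2) := by
      intro I
      have q1 := abs_norm_sub_one_le (es := es) hs.unitp I
      have q2 := young (c := 1 / 8) (b := ‖ep I‖ + ‖grad h ep I‖) (S := ‖es I‖) (M := 20 * K)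
        (by norm_num)
      have q3 := add_sq_le_two ‖ep I‖ ‖grad h ep I‖
      have q4 : 20 * K * (|‖(up + es) I‖ - 1| * (‖ep I‖ + ‖grad h ep I‖))
          ≤ 20 * K * (‖es I‖ * (‖ep I‖ + ‖grad h ep I‖)) := by gcongr
      have : (20 * K) ^ 2 / (4 * (1 / 8)) = (40 * K) ^ 2 * (1 / 2) := by ring
      rw [this] at q2
      linarith
    have p3 := gridSum_mono hh p2
    rw [gridSum_mul, gridSum_add, gridSum_mul, gridSum_mul] at p3
    have p4 := gridSum_sq_add_grad_le hh ep
    have p5 := mul_le_mul_of_nonneg_left (gridSum_sq_le_h1Sq hh es)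
      (by positivity : 0 ≤ (40 * K) ^ 2 * (1 / 2))
    have p6 : h1Sq h ep ≤ 2 * (1 + (40 * K) ^ 2) * h1Sq h es := by
      have := h1Sq_nonneg hh es
      have : 0 ≤ (40 * K) ^ 2 * h1Sq h es := by positivity
      linarith
    refine p6.trans ?_
    calc _ ≤ 2 * (1 + (40 * K) ^ 2) * (C2 * Z) := by gcongr
      _ = 2 * (1 + (40 * K) ^ 2) * C2 * Z := by ring
      _ ≤ _ := by gcongr; linarith

end Grid

end LLG

/-! ### Maximum norm bounds from the discrete H¹ norm. -/

namespace LLG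

open scoped RealInnerProductSpace

section Grid

variable {d : ℕ} {N : Fin d → ℕ} {K h k α ε : ℝ}

theorem norm_update_sub_le_of_le (hh : 0 < h) {f : GridFun N} {c : ℝ}
    (hf : ∀ I, ‖grad h f I‖ ≤ c) (I : Index N) (i : Fin d) (a : Fin (N i)) (n : ℕ)
    (hn : (a : ℕ) + n < N i) :
    ‖f (Function.update I i ⟨a + n, hn⟩) - f (Function.update I i a)‖ ≤ n * (h * c) := by
  induction n with
  | zero => simp
  | succ n ih =>
    have hn' : (a : ℕ) + n < N i := by omega
    have h1 : nbr (Function.update I i ⟨a + n, hn'⟩) (i, true)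
        = Function.update I i ⟨a + (n + 1), hn⟩ := by
      have : (a : ℕ) + n + 1 < N i := by omega
      simp [nbr, this]; rfl
    have h2 := norm_sub_le_mul_grad hh f (Function.update I i ⟨a + n, hn'⟩) (i, true)
    rw [h1] at h2
    have h3 := norm_sub_le_norm_sub_add_norm_sub (f (Function.update I i ⟨a + (n + 1), hn⟩))
      (f (Function.update I i ⟨a + n, hn'⟩)) (f (Function.update I i a))
    have h4 : h * ‖grad h f (Function.update I i ⟨a + n, hn'⟩)‖ ≤ h * c := by gcongr; exact hf _
    push_cast
    linarith [ih hn']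

theorem norm_update_sub_le (hh : 0 < h) {f : GridFun N} {c : ℝ} (hf : ∀ I, ‖grad h f I‖ ≤ c)
    (I : Index N) (i : Fin d) (a b : Fin (N i)) {p : ℕ} (hab : (a : ℕ) ≤ b + p)
    (hba : (b : ℕ) ≤ a + p) :
    ‖f (Function.update I i a) - f (Function.update I i b)‖ ≤ p * (h * c) := by
  have hc : 0 ≤ c := (norm_nonneg _).trans (hf I)
  rcases le_total (a : ℕ) b with hle | hle
  · obtain ⟨n, hn⟩ := Nat.exists_eq_add_of_le hle
    have hb : b = ⟨a + n, hn ▸ b.2⟩ := Fin.ext hn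
    have h1 := norm_update_sub_le_of_le hh hf I i a n (hn ▸ b.2)
    rw [← hb, norm_sub_rev] at h1
    refine h1.trans ?_
    gcongr; omega
  · obtain ⟨n, hn⟩ := Nat.exists_eq_add_of_le hle
    have hb : a = ⟨b + n, hn ▸ a.2⟩ := Fin.ext hn
    have h1 := norm_update_sub_le_of_le hh hf I i b n (hn ▸ a.2)
    rw [← hb] at h1
    refine h1.trans ?_
    gcongr; omega

/-- Coordinates are changed one at a time, each by at most p cells. -/
theorem norm_sub_le_of_grad_le (hh : 0 < h) {f : GridFun N} {c : ℝ}
    (hf : ∀ I, ‖grad h f I‖ ≤ c) (I J : Index N) {p : ℕ}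
    (hIJ : ∀ i, (I i : ℕ) ≤ J i + p ∧ (J i : ℕ) ≤ I i + p) :
    ‖f J - f I‖ ≤ d * (p * (h * c)) := by
  have key : ∀ s : Finset (Fin d), ‖f (s.piecewise J I) - f I‖ ≤ s.card * (p * (h * c)) := by
    intro s
    induction s using Finset.induction_on with
    | empty => simp
    | insert a s has ih =>
      rw [Finset.piecewise_insert, Finset.card_insert_of_notMem has]
      have h1 : s.piecewise J I = Function.update (s.piecewise J I) a (I a) := by
        rw [eq_comm, Function.update_eq_self_iff, Finset.piecewise_eq_of_notMem _ _ _ has]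
      have h2 := norm_update_sub_le hh hf (s.piecewise J I) a (J a) (I a) (hIJ a).2 (hIJ a).1
      rw [← h1] at h2
      have h3 := norm_sub_le_norm_sub_add_norm_sub (f (Function.update (s.piecewise J I) a (J a)))
        (f (s.piecewise J I)) (f I)
      push_cast
      linarith
  have := key Finset.univ
  simpa using this

/-- A grid function with small gradient that is large at a cell is large on a block of cells. -/
theorem block_le_gridSum (hh : 0 < h) {f : GridFun N} {c : ℝ} (hf : ∀ I, ‖grad h f I‖ ≤ c)
    (I : Index N) {p : ℕ} (hp : ∀ i, 2 * p ≤ N i) (hc : d * (p * (h * c)) ≤ ‖f I‖ / 2) :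
    (p * h) ^ d * (‖f I‖ / 2) ^ 2 ≤ gridSum h (fun J => ‖f J‖ ^ 2) := by
  classical
  -- In each coordinate the block extends upwards if that fits and downwards otherwise; one of the
  -- two fits because 2p ≤ N i.
  let φ : (Fin d → Fin p) → Index N := fun q i =>
    if hI : (I i : ℕ) + p ≤ N i then ⟨I i + q i, by omega⟩ else ⟨I i - q i, by omega⟩
  have hφ : Function.Injective φ := by
    intro q q' hq
    ext i
    have h1 := congrArg (fun J : Index N => (J i : ℕ)) hq
    have := hp i
    have := (I i).2
    by_cases hI : (I i : ℕ) + p ≤ N i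
    · simp only [φ, hI, dite_true] at h1
      omega
    · simp only [φ, hI, dite_false] at h1
      omega
  have h1 : ∀ q, (‖f I‖ / 2) ^ 2 ≤ ‖f (φ q)‖ ^ 2 := by
    intro q
    have h2 := norm_sub_le_of_grad_le hh hf I (φ q) (p := p) fun i => by
      have := (q i).2
      by_cases hI : (I i : ℕ) + p ≤ N i
      · simp only [φ, hI, dite_true]; omega
      · simp only [φ, hI, dite_false]; omega
    have h3 := norm_sub_norm_le (f I) (f I - f (φ q))
    rw [sub_sub_cancel, norm_sub_rev (f I)] at h3
    gcongr
    linarith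
  have h2 : (p : ℝ) ^ d * (‖f I‖ / 2) ^ 2 ≤ ∑ J, ‖f J‖ ^ 2 := by
    calc (p : ℝ) ^ d * (‖f I‖ / 2) ^ 2 = ∑ _q : Fin d → Fin p, (‖f I‖ / 2) ^ 2 := by simp
      _ ≤ ∑ q, ‖f (φ q)‖ ^ 2 := Finset.sum_le_sum fun q _ => h1 q
      _ = ∑ J ∈ Finset.univ.image φ, ‖f J‖ ^ 2 := by
          rw [Finset.sum_image fun a _ b _ hab => hφ hab]
      _ ≤ _ := Finset.sum_le_sum_of_subset_of_nonneg (Finset.subset_univ _)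
          fun J _ _ => sq_nonneg _
  rw [gridSum, mul_pow, mul_comm ((p : ℝ) ^ d), mul_assoc]
  gcongr

/-- A single cell has weight h^d ≥ h³. The resulting bound of order √h suffices for the gradient,
but falls short of h for the function itself. -/
theorem sq_norm_le_of_h1Sq_le (hd : d ≤ 3) (hh : 0 < h) (hh1 : h ≤ 1) {f : GridFun N} {M : ℝ}
    (hf : h1Sq h f ≤ M * h ^ 4) (I : Index N) :
    ‖f I‖ ^ 2 ≤ 2 * M * h ∧ ‖grad h f I‖ ^ 2 ≤ 2 * M * h := by
  have h3 : h ^ 3 ≤ h ^ d := pow_le_pow_of_le_one hh.le hh1 hd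
  have hM : 0 ≤ M := nonneg_of_mul_nonneg_left ((h1Sq_nonneg hh f).trans hf) (by positivity)
  constructor
  · have h1 := (pow_mul_le_gridSum hh (fun J => sq_nonneg ‖f J‖) I).trans
      ((gridSum_sq_le_h1Sq hh f).trans hf)
    have h2 : h ^ 3 * ‖f I‖ ^ 2 ≤ h ^ 3 * (2 * M * h) := by
      have : h ^ 3 * ‖f I‖ ^ 2 ≤ h ^ d * ‖f I‖ ^ 2 := by gcongr
      have : 0 ≤ M * h ^ 4 := by positivity
      linarith
    exact le_of_mul_le_mul_left h2 (by positivity)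
  · have h1 := (pow_mul_le_gridSum hh (fun J => sq_nonneg ‖grad h f J‖) I).trans
      (gridSum_sq_grad_le_h1Sq hh f)
    have h2 : h ^ 3 * ‖grad h f I‖ ^ 2 ≤ h ^ 3 * (2 * M * h) := by
      have : h ^ 3 * ‖grad h f I‖ ^ 2 ≤ h ^ d * ‖grad h f I‖ ^ 2 := by gcongr
      linarith
    exact le_of_mul_le_mul_left h2 (by positivity)

/-- A grid function of size `O(h²)` in `H¹` is smaller than `h` in the maximum norm. -/
theorem exists_norm_le_mesh (hd : d ≤ 3) (L : Fin d → ℝ) (hL : ∀ i, 0 < L i) (M : ℝ) (hM : 1 ≤ M) :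
    ∃ δ > 0, ∀ {N : Fin d → ℕ} {h : ℝ} {f : GridFun N}, 0 < h → h < δ →
      (∀ i, (N i : ℝ) * h = L i) → h1Sq h f ≤ M * h ^ 4 → ∀ I, ‖f I‖ ≤ h := by
  obtain ⟨ℓ, hℓ, hℓL⟩ : ∃ ℓ > 0, ∀ i, ℓ ≤ L i := by
    rcases isEmpty_or_nonempty (Fin d) with he | hne
    · exact ⟨1, one_pos, fun i => he.elim i⟩
    · obtain ⟨i₀, hi₀⟩ := Finite.exists_min L
      exact ⟨L i₀, hL i₀, hi₀⟩
  -- The gradient is at most 2M√h, so over a block of side about a√h the function varies by at most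
  -- 6aMh = h/2. If it exceeded h somewhere, its squared ℓ² norm would be at least of order h^{3/2}
  -- · h² = h^{7/2}, which contradicts M h⁴ for small h.
  set a := 1 / (12 * M) with ha
  have ha0 : 0 < a := by positivity
  have ha1 : a ≤ 1 := by
    rw [ha, div_le_one (by positivity)]; linarith
  set s := min 1 (min (a / 2) (min (ℓ / 2) (a ^ 3 / (32 * M)))) with hs
  have hs0 : 0 < s := by positivity
  refine ⟨s ^ 2, by positivity, ?_⟩
  intro N h f hh hhs hN hf I
  obtain ⟨r, hr0, rfl⟩ : ∃ r : ℝ, 0 < r ∧ h = r ^ 2 :=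
    ⟨Real.sqrt h, Real.sqrt_pos.2 hh, (Real.sq_sqrt hh.le).symm⟩
  have hrs : r < s := lt_of_pow_lt_pow_left₀ 2 hs0.le hhs
  have hr1 : r < 1 := hrs.trans_le (min_le_left _ _)
  have hr2 : r < a / 2 := hrs.trans_le ((min_le_right _ _).trans (min_le_left _ _))
  have hr3 : r < ℓ / 2 := hrs.trans_le
    ((min_le_right _ _).trans ((min_le_right _ _).trans (min_le_left _ _)))
  have hr4 : r < a ^ 3 / (32 * M) := hrs.trans_le
    ((min_le_right _ _).trans ((min_le_right _ _).trans (min_le_right _ _)))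
  by_contra! hlt
  -- With r = √h, the number p of cells per side is a/r rounded down; r < a/2 keeps the rounding
  -- loss within a factor 2.
  obtain ⟨p, hp1, hp2⟩ : ∃ p : ℕ, a / 2 ≤ p * r ∧ p * r ≤ a := by
    refine ⟨⌊a / r⌋₊, ?_, ?_⟩
    · have := Nat.lt_floor_add_one (a / r)
      rw [div_lt_iff₀ hr0] at this
      linarith
    · have := Nat.floor_le (by positivity : 0 ≤ a / r)
      rwa [le_div_iff₀ hr0] at this
  have hgrad : ∀ J, ‖grad (r ^ 2) f J‖ ≤ 2 * M * r := by
    intro J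
    have := (sq_norm_le_of_h1Sq_le hd hh (by nlinarith) hf J).2
    refine abs_le_of_sq_le_sq' (this.trans ?_) (by positivity) |>.2
    have : 0 ≤ M * r ^ 2 := by positivity
    nlinarith
  have hd' : (d : ℝ) ≤ 3 := by exact_mod_cast hd
  have hblock := block_le_gridSum hh hgrad I (p := p) (fun i => by
    have : (2 * p : ℝ) * r ^ 2 ≤ N i * r ^ 2 := by
      rw [hN i]
      have := hℓL i
      nlinarith
    have := le_of_mul_le_mul_right this (by positivity)
    exact_mod_cast this) (by
    calc (d : ℝ) * (p * (r ^ 2 * (2 * M * r))) = d * ((p * r) * (r ^ 2 * (2 * M))) := by ring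
      _ ≤ 3 * (a * (r ^ 2 * (2 * M))) := by gcongr
      _ = r ^ 2 / 2 := by rw [ha]; field_simp; norm_num
      _ ≤ _ := by linarith)
  have h1 := hblock.trans ((gridSum_sq_le_h1Sq hh f).trans hf)
  have hpr : (p : ℝ) * r ^ 2 = (p * r) * r := by ring
  have h2 : (a / 2 * r) ^ 3 ≤ (p * r ^ 2) ^ d := by
    calc (a / 2 * r) ^ 3 ≤ (p * r ^ 2) ^ 3 := by rw [hpr]; gcongr
      _ ≤ _ := by
        refine pow_le_pow_of_le_one (by positivity) ?_ hd
        rw [hpr]; nlinarith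
  have h3 : (a / 2 * r) ^ 3 * (r ^ 2 / 2) ^ 2 ≤ M * (r ^ 2) ^ 4 := by
    refine le_trans ?_ h1
    gcongr
  have h4 : a ^ 3 / 32 * r ^ 7 ≤ M * r * r ^ 7 := by
    calc _ = (a / 2 * r) ^ 3 * (r ^ 2 / 2) ^ 2 := by ring
      _ ≤ _ := h3
      _ = _ := by ring
  have h5 := le_of_mul_le_mul_right h4 (by positivity)
  rw [lt_div_iff₀ (by positivity)] at hr4
  linarith

end Grid

end LLG

/-! ### Stability over the whole time interval by induction. -/

namespace LLG

open scoped RealInnerProductSpace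

section Grid

variable {d : ℕ} {N : Fin d → ℕ} {K h k α ε Q T : ℝ} {he : ℝ → Space d → Vec3}

/-- The effective field of a sequence of grid functions at the half time level. -/
noncomputable def halfField (ε Q h k : ℝ) (he : ℝ → Space d → Vec3) (u : ℕ → GridFun N) (n : ℕ) :
    GridFun N :=
  fun I => ε • lap h ((1 / 2 : ℝ) • (u (n + 1) + u n)) I + extrapolate (gridField Q h k he u) n I

/-- A sequence of grid functions with values in the sphere that satisfies the scheme up to a small
residual between the time levels `n` and `n + 1`. -/
def RefAt (K h k α ε Q : ℝ) (he : ℝ → Space d → Vec3) (u : ℕ → GridFun N) (n : ℕ) : Prop :=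
  ∃ R, RefStep K h k α (u (n - 1)) (u n) (u (n + 1)) (halfField ε Q h k he u n) R ∧
    RefResidual K h k (u (n - 1)) (u n) (u (n + 1)) R

theorem extrapolate_gridField_sub (u v : ℕ → GridFun N) (n : ℕ) (I : Index N) :
    extrapolate (gridField Q h k he u) n I - extrapolate (gridField Q h k he v) n I
      = lowerField Q (extrap (u (n - 1) - v (n - 1)) (u n - v n) I) 0 := by
  simp only [extrapolate, gridField, lowerField, extrap, Pi.sub_apply, PiLp.sub_apply,
    PiLp.smul_apply, smul_eq_mul]
  module

/-- The right-hand side is linear in the field only, so the first argument stays the numerical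
extrapolation, while the numerical field splits into the Laplacian of the averaged error, the lower
order error and the reference field. -/
theorem ErrStep.of_solution (hQ : |Q| ≤ K) {u mh ms : ℕ → GridFun N} {n : ℕ} {R : GridFun N}
    (hn : 1 ≤ n) (hnT : ((n + 1 : ℕ) : ℝ) * k ≤ T)
    (href : RefStep K h k α (u (n - 1)) (u n) (u (n + 1)) (halfField ε Q h k he u n) R)
    (hsol : IsSICNSolution T α ε Q h k he mh ms)
    (h1 : ∀ I, ‖(mh (n - 1) - u (n - 1)) I‖ ≤ 1 / 8) (h2 : ∀ I, ‖(mh n - u n) I‖ ≤ 1 / 8)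
    (h3 : ∀ I, ‖grad h (mh (n - 1) - u (n - 1)) I‖ ≤ 1)
    (h4 : ∀ I, ‖grad h (mh n - u n) I‖ ≤ 1) :
    ErrStep K h k α ε (u (n - 1)) (u n) (u (n + 1)) (halfField ε Q h k he u n) R
      (mh (n - 1) - u (n - 1)) (mh n - u n) (ms (n + 1) - u (n + 1))
      (extrapolate (gridField Q h k he mh) n - extrapolate (gridField Q h k he u) n) where
  toRefStep := href
  step I := by
    have e1 : u (n - 1) + (mh (n - 1) - u (n - 1)) = mh (n - 1) := add_sub_cancel _ _
    have e2 : u n + (mh n - u n) = mh n := add_sub_cancel _ _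
    rw [e1, e2]
    have e3 := (hsol n hn hnT I).1
    have e4 : (ms (n + 1) - u (n + 1)) I - (mh n - u n) I + (u (n + 1) I - u n I)
        = ms (n + 1) I - mh n I := by simp only [Pi.sub_apply]; abel
    have e5 : (fun J => (1 / 2 : ℝ) • (ms (n + 1) J + mh n J))
        = (mh n - u n) + (1 / 2 : ℝ) • ((ms (n + 1) - u (n + 1)) - (mh n - u n))
          + (1 / 2 : ℝ) • (u (n + 1) + u n) := by
      ext1 J; simp only [Pi.add_apply, Pi.sub_apply, Pi.smul_apply]; module
    rw [e4, e3, discreteLaplacian_eq_lap, e5, lap_add h _ ((1 / 2 : ℝ) • (u (n + 1) + u n)),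
      halfField]
    show llgRhs α (extrap (mh (n - 1)) (mh n) I) _ = _
    congr 1
    simp only [Pi.sub_apply]
    module
  Fd_le I := by
    rw [Pi.sub_apply, extrapolate_gridField_sub]
    refine (norm_lowerField_le _ _ _).trans ?_
    rw [norm_zero, add_zero]
    gcongr
  err'_le := h1
  err_le := h2
  grad_err'_le := h3
  grad_err_le := h4

theorem one_add_mul_pow_le {c : ℝ} (hc : 0 ≤ c) (hk : 0 ≤ k) {n : ℕ} (hn : n * k ≤ T) :
    (1 + c * k) ^ n ≤ Real.exp (c * T) := by
  have h0 : 0 ≤ c * k := mul_nonneg hc hk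
  calc (1 + c * k) ^ n ≤ Real.exp (c * k) ^ n := by
        gcongr
        linarith [Real.add_one_le_exp (c * k)]
    _ = Real.exp (c * (n * k)) := by rw [← Real.exp_nat_mul]; congr 1; ring
    _ ≤ _ := by gcongr

/-- Stability of the scheme: a numerical solution stays close to every reference solution that
satisfies the scheme up to a small residual. -/
theorem exists_stability (hd : d ≤ 3) (L : Fin d → ℝ) (hL : ∀ i, 0 < L i) (K α ε Q T B₀ : ℝ)
    (hK : 1 ≤ K) (hα : 0 < α) (hε : 0 < ε) (hαK : 1 + 5 * α ≤ K) (hεK : ε ≤ K) (hQ : |Q| ≤ K)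
    (hT : 0 < T) (hB₀ : 1 ≤ B₀) (he : ℝ → Space d → Vec3) :
    ∃ C > 0, ∃ δ > 0, ∀ (h k : ℝ) (N : Fin d → ℕ),
      0 < h → h < δ → 0 < k → k < δ → k ≤ K * h → (∀ i, (N i : ℝ) * h = L i) →
      ∀ u mh ms : ℕ → GridFun N,
        (∀ n : ℕ, 1 ≤ n → ((n + 1 : ℕ) : ℝ) * k ≤ T → RefAt K h k α ε Q he u n) →
        IsSICNSolution T α ε Q h k he mh ms →
        h1Sq h (mh 0 - u 0) ≤ B₀ * (k ^ 2 + h ^ 2) ^ 2 →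
        h1Sq h (mh 1 - u 1) ≤ B₀ * (k ^ 2 + h ^ 2) ^ 2 →
        ∀ n : ℕ, 2 ≤ n → (n : ℝ) * k ≤ T →
          h1Sq h (mh n - u n) ≤ C * (k ^ 2 + h ^ 2) ^ 2 := by
  obtain ⟨Ca, hCa, hstep⟩ := exists_step_const K α ε hK hα hε
  obtain ⟨Cb, hCb, hfirst⟩ := exists_first_step_const K α ε hK hα hε
  -- D bounds the error after the first step, B below includes the Gronwall factor, and M expresses
  -- every bound that occurs, also those before projection, as a multiple of h⁴ through k ≤ K h.
  set D := Cb * (2 * B₀ + 1) with hD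
  have hDB : B₀ ≤ D := by
    rw [hD]; nlinarith
  have hD1 : 1 ≤ D := hB₀.trans hDB
  set B := D * Real.exp (3 * Ca * T) with hB
  have hDB' : D ≤ B := le_mul_of_one_le_right (by linarith) (Real.one_le_exp (by positivity))
  have hB1 : 1 ≤ B := hD1.trans hDB'
  set M := 3 * (Ca + Cb) * B * (K ^ 2 + 1) ^ 2 with hM
  have hCab : 1 ≤ 3 * (Ca + Cb) := by linarith
  have hMB : B * (K ^ 2 + 1) ^ 2 ≤ M := by
    rw [hM, mul_assoc (3 * (Ca + Cb))]
    exact le_mul_of_one_le_left (by positivity) hCab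
  have hM1 : 1 ≤ M := by
    have : (1 : ℝ) ≤ (K ^ 2 + 1) ^ 2 := one_le_pow₀ (by nlinarith)
    nlinarith
  clear_value D B M
  obtain ⟨δ₁, hδ₁, hsob⟩ := exists_norm_le_mesh hd L hL M hM1
  refine ⟨B, by positivity, min δ₁ (min (1 / 8) (min (1 / (8 * M)) (min (1 / Ca) (1 / Cb)))),
    by positivity, ?_⟩
  intro h k N hh hhδ hk hkδ hkh hN u mh ms href hsol he0 he1
  simp only [lt_min_iff] at hhδ hkδ
  obtain ⟨hh1, hh2, hh3, -, -⟩ := hhδ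
  obtain ⟨-, hk2, -, hk4, hk5⟩ := hkδ
  rw [lt_div_iff₀ (by positivity)] at hh3 hk4 hk5
  have hp : StepParam d K h k α ε :=
    ⟨hK, hh, hk, by linarith, by linarith, hkh, hα, hε, hαK, hεK, by exact_mod_cast hd⟩
  set τ := (k ^ 2 + h ^ 2) ^ 2 with hτ
  have hτ0 : 0 ≤ τ := by positivity
  have hτh : τ ≤ (K ^ 2 + 1) ^ 2 * h ^ 4 := by
    have : k ^ 2 + h ^ 2 ≤ (K ^ 2 + 1) * h ^ 2 := by
      have : k ^ 2 ≤ (K * h) ^ 2 := by gcongr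
      linarith
    calc τ ≤ ((K ^ 2 + 1) * h ^ 2) ^ 2 := by rw [hτ]; gcongr
      _ = _ := by ring
  have hsmall : ∀ {f : GridFun N} {c : ℝ}, c ≤ 3 * (Ca + Cb) * B → h1Sq h f ≤ c * τ →
      h1Sq h f ≤ M * h ^ 4 := by
    intro f c hc hf
    refine hf.trans ?_
    calc c * τ ≤ 3 * (Ca + Cb) * B * ((K ^ 2 + 1) ^ 2 * h ^ 4) := by
          have : 0 ≤ 3 * (Ca + Cb) * B := by positivity
          gcongr
      _ = _ := by rw [hM]; ring
  have hBM : B ≤ 3 * (Ca + Cb) * B := le_mul_of_one_le_left (by linarith) hCab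
  clear_value τ
  have hsup : ∀ {f : GridFun N}, h1Sq h f ≤ M * h ^ 4 → ∀ I, ‖f I‖ ≤ h ∧ ‖grad h f I‖ ≤ 1 := by
    intro f hf I
    refine ⟨hsob hh hh1 hN hf I, ?_⟩
    have := (sq_norm_le_of_h1Sq_le hd hh hp.h_le hf I).2
    refine abs_le_of_sq_le_sq' (this.trans ?_) zero_le_one |>.2
    linarith
  have herr : ∀ n : ℕ, 1 ≤ n → ((n + 1 : ℕ) : ℝ) * k ≤ T →
      h1Sq h (mh (n - 1) - u (n - 1)) ≤ B * τ → h1Sq h (mh n - u n) ≤ B * τ →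
      ∃ X R Fd, ErrStep K h k α ε (u (n - 1)) (u n) (u (n + 1)) X R
        (mh (n - 1) - u (n - 1)) (mh n - u n) (ms (n + 1) - u (n + 1)) Fd ∧
        RefResidual K h k (u (n - 1)) (u n) (u (n + 1)) R := by
    intro n hn hnT g1 g2
    obtain ⟨R, hR1, hR2⟩ := href n hn hnT
    have s1 := hsup (hsmall hBM g1)
    have s2 := hsup (hsmall hBM g2)
    exact ⟨_, R, _, ErrStep.of_solution hQ hn hnT hR1 hsol (fun I => by linarith [(s1 I).1])
      (fun I => by linarith [(s2 I).1]) (fun I => (s1 I).2) (fun I => (s2 I).2), hR2⟩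
  have hproj : ∀ n : ℕ, 1 ≤ n → ((n + 1 : ℕ) : ℝ) * k ≤ T →
      mh (n + 1) = normalize (u (n + 1) + (ms (n + 1) - u (n + 1))) := by
    intro n hn hnT
    rw [add_sub_cancel]
    ext1 I
    exact (hsol n hn hnT I).2
  have hunit : ∀ n : ℕ, 1 ≤ n → ((n + 1 : ℕ) : ℝ) * k ≤ T →
      (∀ I, ‖(ms (n + 1) - u (n + 1)) I‖ ≤ 1 / 2) → ∀ I, ‖mh (n + 1) I‖ = 1 := by
    intro n hn hnT hes I
    obtain ⟨R, hR1, -⟩ := href n hn hnT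
    have h1 := hR1.unitp I
    have h2 : ms (n + 1) I ≠ 0 := by
      intro h0
      have := hes I
      rw [Pi.sub_apply, h0, zero_sub, norm_neg, h1] at this
      norm_num at this
    rw [(hsol n hn hnT I).2, norm_smul, norm_inv, norm_norm, inv_mul_cancel₀ (by simpa using h2)]
  -- Two consecutive levels are carried along because of the extrapolation. Unit length is claimed
  -- from level 2 on, after the first projection, and is what the refined step needs.
  have hmain : ∀ n : ℕ, ((n + 2 : ℕ) : ℝ) * k ≤ T →
      h1Sq h (mh (n + 1) - u (n + 1)) ≤ D * (1 + 3 * Ca * k) ^ n * τ ∧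
      h1Sq h (mh (n + 2) - u (n + 2)) ≤ D * (1 + 3 * Ca * k) ^ n * τ ∧
      ∀ I, ‖mh (n + 2) I‖ = 1 := by
    intro n
    induction n with
    | zero =>
      intro hnT
      have g0 : h1Sq h (mh 0 - u 0) ≤ B * τ := he0.trans (by gcongr; exact hDB.trans hDB')
      have g1 : h1Sq h (mh 1 - u 1) ≤ B * τ := he1.trans (by gcongr; exact hDB.trans hDB')
      obtain ⟨X, R, Fd, hs, hr⟩ := herr 1 le_rfl hnT g0 g1
      obtain ⟨r1, r2⟩ := hfirst hp (by linarith) hs hr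
      simp only [← hτ] at r1 r2
      have hZ : h1Sq h (mh 1 - u 1) + h1Sq h (mh (1 - 1) - u (1 - 1)) + τ
          ≤ (2 * B₀ + 1) * τ := by
        have : h1Sq h (mh (1 - 1) - u (1 - 1)) ≤ B₀ * τ := he0
        linarith
      have hDτ : Cb * (h1Sq h (mh 1 - u 1) + h1Sq h (mh (1 - 1) - u (1 - 1)) + τ)
          ≤ D * τ := by
        rw [hD, mul_assoc]; gcongr
      have hes := hsup (hsmall (hDB'.trans hBM) (r1.trans hDτ))
      have hes1 : ∀ I, ‖(ms (1 + 1) - u (1 + 1)) I‖ ≤ 1 / 2 := fun I => by linarith [(hes I).1]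
      have r3 := r2 hes1 (fun I => (hes I).2)
      rw [← hproj 1 le_rfl hnT] at r3
      refine ⟨?_, ?_, hunit 1 le_rfl hnT hes1⟩
      · rw [pow_zero, mul_one]; exact he1.trans (by gcongr)
      · rw [pow_zero, mul_one]; exact r3.trans hDτ
    | succ n ih =>
      intro hnT
      have hnT' : ((n + 2 : ℕ) : ℝ) * k ≤ T := by
        push_cast at hnT ⊢; linarith
      obtain ⟨i1, i2, i3⟩ := ih hnT'
      set A := D * (1 + 3 * Ca * k) ^ n with hA
      have hAn : 1 ≤ (1 + 3 * Ca * k) ^ n := one_le_pow₀ (by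
        have : 0 ≤ 3 * Ca * k := by positivity
        linarith)
      have hA1 : 1 ≤ A := by rw [hA]; nlinarith
      have hAB : A ≤ B := by
        rw [hA, hB]
        gcongr
        refine one_add_mul_pow_le (by positivity) hk.le (le_trans ?_ hnT')
        gcongr
        omega
      have hnT2 : (((n + 2) + 1 : ℕ) : ℝ) * k ≤ T := hnT
      obtain ⟨X, R, Fd, hs, hr⟩ := herr (n + 2) (by omega) hnT2
        (i1.trans (by gcongr)) (i2.trans (by gcongr))
      have b1 := hsup (hsmall hBM (i1.trans (by gcongr : A * τ ≤ B * τ)))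
      have b2 := hsup (hsmall hBM (i2.trans (by gcongr : A * τ ≤ B * τ)))
      obtain ⟨r1, r2⟩ := hstep hp (by linarith) hs hr
        (fun J => by rw [Pi.sub_apply, add_sub_cancel]; exact i3 J)
        (fun I => (b1 I).1) (fun I => (b2 I).1)
      simp only [← hτ] at r1 r2
      have hZ : h1Sq h (mh (n + 2) - u (n + 2)) + h1Sq h (mh (n + 2 - 1) - u (n + 2 - 1)) + τ
          ≤ 3 * A * τ := by
        have q1 : h1Sq h (mh (n + 2 - 1) - u (n + 2 - 1)) ≤ A * τ := i1
        have q2 : τ ≤ A * τ := le_mul_of_one_le_left hτ0 hA1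
        linarith
      have hes := hsup (f := ms (n + 2 + 1) - u (n + 2 + 1)) (hsmall (c := Ca * (3 * A)) (by
          calc Ca * (3 * A) ≤ Ca * (3 * B) := by gcongr
            _ ≤ _ := by
              have : 0 ≤ Cb * B := by positivity
              linarith)
        (r1.trans (by rw [mul_assoc]; gcongr)))
      have hes1 : ∀ I, ‖(ms (n + 2 + 1) - u (n + 2 + 1)) I‖ ≤ 1 / 2 :=
        fun I => by linarith [(hes I).1]
      have r3 := r2 hes1 (fun I => (hes I).2)
      rw [← hproj (n + 2) (by omega) hnT2] at r3
      -- The rate 3 Ca arises because the two errors and τ are each at most A τ.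
      have hgrow : D * (1 + 3 * Ca * k) ^ (n + 1) * τ = A * τ + Ca * k * (3 * A * τ) := by
        rw [hA, pow_succ]; ring
      rw [hgrow]
      refine ⟨i2.trans ?_, ?_, hunit (n + 2) (by omega) hnT2 hes1⟩
      · have : 0 ≤ Ca * k * (3 * A * τ) := by positivity
        linarith
      · refine r3.trans ?_
        have : Ca * k * (h1Sq h (mh (n + 2) - u (n + 2))
          + h1Sq h (mh (n + 2 - 1) - u (n + 2 - 1)) + τ) ≤ Ca * k * (3 * A * τ) := by gcongr
        linarith
  intro n hn hnT
  obtain ⟨n, rfl⟩ := Nat.exists_eq_add_of_le' hn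
  refine (hmain n hnT).2.1.trans ?_
  gcongr
  rw [hB]
  gcongr
  refine one_add_mul_pow_le (by positivity) hk.le (le_trans ?_ hnT)
  gcongr
  omega

end Grid

end LLG

/-! ### Consistency in time of a unit reference sequence. -/

namespace LLG

open scoped RealInnerProductSpace

section Grid

variable {d : ℕ} {N : Fin d → ℕ} {K h k α ε : ℝ}

/-- Pointwise bounds, at one time level, for a grid function `u` with values in the sphere whose
tangential discrete Laplacian is close to `S`. -/
structure RefLevel (K h ε : ℝ) (u S : GridFun N) : Prop where
  unit : ∀ I, ‖u I‖ = 1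
  grad_le : ∀ I, ‖grad h u I‖ ≤ K
  lap_le : ∀ I, ‖lap h u I‖ ≤ K
  perp_lap : ∀ I, ‖perp (u I) (ε • lap h u I) - S I‖ ≤ K * h ^ 2

/-- Pointwise bounds for the increment between two consecutive time levels. -/
structure RefIncr (K h k : ℝ) (u S up Sp : GridFun N) : Prop where
  incr : ∀ I, ‖up I - u I‖ ≤ K * k
  incr_field : ∀ I, ‖Sp I - S I‖ ≤ K * k
  incr_grad : ∀ I, ‖grad h (up - u) I‖ ^ 2 ≤ K * (k + h ^ 2)

/-- The constants of the consistency estimates. -/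
structure ConsParam (K h k α ε : ℝ) : Prop where
  one_le : 1 ≤ K
  h_pos : 0 < h
  k_pos : 0 < k
  h_le : h ≤ 1
  k_le : k ≤ 1
  α_pos : 0 < α
  ε_pos : 0 < ε
  α_le : 1 + 5 * α ≤ K
  ε_le : ε ≤ K
  inv_ε_le : ε⁻¹ ≤ K

theorem RefLevel.abs_inner_lap_le {u S : GridFun N} (hu : RefLevel K h ε u S) (I : Index N) :
    |⟪u I, lap h u I⟫| ≤ K ^ 2 / 2 := by
  rw [inner_lap_of_unit h hu.unit, abs_mul, abs_of_nonneg (sq_nonneg ‖grad h u I‖)]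
  norm_num
  have := hu.grad_le I
  have : ‖grad h u I‖ ^ 2 ≤ K ^ 2 := by gcongr
  linarith

theorem RefLevel.abs_inner_lap_sub_le {u S up Sp : GridFun N} (hu : RefLevel K h ε u S)
    (hup : RefLevel K h ε up Sp) (I : Index N) :
    |⟪up I, lap h up I⟫ - ⟪u I, lap h u I⟫| ≤ K * ‖grad h (up - u) I‖ := by
  rw [inner_lap_of_unit h hu.unit, inner_lap_of_unit h hup.unit, grad_sub]
  have h1 := hu.grad_le I
  have h2 := hup.grad_le I
  have h3 := abs_norm_sub_norm_le (grad h up I) (grad h u I)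
  have : -(1 / 2) * ‖grad h up I‖ ^ 2 - -(1 / 2) * ‖grad h u I‖ ^ 2
    = -(1 / 2) * ((‖grad h up I‖ + ‖grad h u I‖) * (‖grad h up I‖ - ‖grad h u I‖)) := by ring
  rw [this, abs_mul, abs_mul, abs_of_nonneg (by positivity : 0 ≤ ‖grad h up I‖ + ‖grad h u I‖)]
  norm_num
  have hK : 0 ≤ K := (norm_nonneg _).trans h1
  calc 1 / 2 * ((‖grad h up I‖ + ‖grad h u I‖) * |‖grad h up I‖ - ‖grad h u I‖|)
      ≤ 1 / 2 * ((K + K) * ‖grad h up I - grad h u I‖) := by gcongr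
    _ = _ := by ring

/-- The increment of the discrete Laplacian is controlled by that of the gradient. -/
theorem RefIncr.norm_lap_le (hp : ConsParam K h k α ε) {u S up Sp : GridFun N}
    (hu : RefLevel K h ε u S) (hup : RefLevel K h ε up Sp) (hi : RefIncr K h k u S up Sp)
    (I : Index N) : ‖lap h (up - u) I‖ ≤ 4 * K ^ 5 * (k + h ^ 2 + ‖grad h (up - u) I‖) := by
  have hK := hp.one_le
  have hh := hp.h_pos
  have hk := hp.k_pos
  have hε := hp.ε_pos
  set Np := ⟪up I, lap h up I⟫ with hNp
  set Nu := ⟪u I, lap h u I⟫ with hNu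
  -- The Laplacian is split into its tangential part, close to S, and its normal part along u. The
  -- increment of S is O(k), and that of the normal part is a difference of squared gradients.
  have e : ε • lap h (up - u) I = (perp (up I) (ε • lap h up I) - Sp I)
      - (perp (u I) (ε • lap h u I) - S I) + (Sp I - S I)
      + (ε * (Np - Nu)) • up I + (ε * Nu) • (up I - u I) := by
    rw [lap_sub, perp, perp, inner_smul_right, inner_smul_right, ← hNp, ← hNu]
    module
  have b : ‖ε • lap h (up - u) I‖ ≤ K * h ^ 2 + K * h ^ 2 + K * k
      + K * (K * ‖grad h (up - u) I‖) + K * (K ^ 2 / 2) * (K * k) := by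
    rw [e]
    refine (norm_add_le _ _).trans (add_le_add ((norm_add_le _ _).trans
      (add_le_add ((norm_add_le _ _).trans (add_le_add ((norm_sub_le _ _).trans
        (add_le_add (hup.perp_lap I) (hu.perp_lap I))) (hi.incr_field I))) ?_)) ?_)
    · rw [norm_smul, hup.unit, mul_one, Real.norm_eq_abs, abs_mul, abs_of_pos hε]
      gcongr
      exacts [hp.ε_le, hu.abs_inner_lap_sub_le hup I]
    · rw [norm_smul, Real.norm_eq_abs, abs_mul, abs_of_pos hε]
      gcongr
      exacts [hp.ε_le, hu.abs_inner_lap_le I, hi.incr I]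
  rw [norm_smul, Real.norm_eq_abs, abs_of_pos hε] at b
  have b2 : ‖lap h (up - u) I‖ ≤ K * (K * h ^ 2 + K * h ^ 2 + K * k
      + K * (K * ‖grad h (up - u) I‖) + K * (K ^ 2 / 2) * (K * k)) := by
    rw [← inv_mul_cancel_left₀ hε.ne' ‖lap h (up - u) I‖]
    gcongr
    exact hp.inv_ε_le
  refine b2.trans ?_
  set G := ‖grad h (up - u) I‖ with hG
  have hG0 : 0 ≤ G := norm_nonneg _
  have k2 : K ^ 2 ≤ K ^ 5 := pow_le_pow_right₀ hK (by norm_num)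
  have k3 : K ^ 3 ≤ K ^ 5 := pow_le_pow_right₀ hK (by norm_num)
  calc _ = K ^ 2 * (2 * h ^ 2 + k) + K ^ 3 * G + K ^ 5 * k / 2 := by ring
    _ ≤ K ^ 5 * (2 * h ^ 2 + k) + K ^ 5 * G + K ^ 5 * k / 2 := by gcongr
    _ ≤ _ := by
      have t1 : 0 ≤ K ^ 5 * k := by positivity
      have t2 : 0 ≤ K ^ 5 * h ^ 2 := by positivity
      have t3 : 0 ≤ K ^ 5 * G := by positivity
      linarith

/-- By summation by parts the squared gradient is a pairing of the increment, which is O(k), with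
its Laplacian, which is itself controlled by the gradient; Young's inequality absorbs the latter. In
the sum this gains a factor k over the pointwise assumption. -/
theorem RefIncr.gridSum_sq_grad_le (hp : ConsParam K h k α ε) {u S up Sp : GridFun N}
    (hu : RefLevel K h ε u S) (hup : RefLevel K h ε up Sp) (hi : RefIncr K h k u S up Sp)
    (hvol : gridSum h (fun _ : Index N => 1) ≤ K) :
    gridSum h (fun I => ‖grad h (up - u) I‖ ^ 2) ≤ 160 * K ^ 13 * (k * (k + h ^ 2)) := by
  have hK := hp.one_le
  have hh := hp.h_pos
  have hk := hp.k_pos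
  have h1 := gridSum_sq_grad h (up - u)
  have h2 : gridSum h (fun I => -2 * ⟪(up - u) I, lap h (up - u) I⟫)
      ≤ gridSum h (fun I => 1 / 2 * ‖grad h (up - u) I‖ ^ 2
        + 80 * K ^ 12 * (k * (k + h ^ 2)) * 1) := by
    refine gridSum_mono hh fun I => ?_
    have a1 : -2 * ⟪(up - u) I, lap h (up - u) I⟫
        ≤ 2 * ((K * k) * (4 * K ^ 5 * (k + h ^ 2 + ‖grad h (up - u) I‖))) := by
      have := neg_le_of_abs_le ((abs_real_inner_le_norm ((up - u) I) (lap h (up - u) I)).trans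
        (mul_le_mul (hi.incr I) (hi.norm_lap_le hp hu hup I) (norm_nonneg _) (by positivity)))
      linarith
    refine a1.trans ?_
    set G := ‖grad h (up - u) I‖
    have a2 := sq_nonneg (G - 8 * K ^ 6 * k)
    have a3 : K ^ 6 ≤ K ^ 12 := pow_le_pow_right₀ hK (by norm_num)
    have a5 : K ^ 6 * (k * (k + h ^ 2)) ≤ K ^ 12 * (k * (k + h ^ 2)) := by gcongr
    have a6 : K ^ 12 * (k * k) ≤ K ^ 12 * (k * (k + h ^ 2)) := by
      gcongr; linarith [sq_nonneg h]
    have a7 : 0 ≤ K ^ 12 * (k * (k + h ^ 2)) := by positivity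
    linarith
  rw [gridSum_add, gridSum_mul, gridSum_mul, gridSum_mul] at h2
  have h3 : 80 * K ^ 12 * (k * (k + h ^ 2)) * gridSum h (fun _ : Index N => 1)
      ≤ 80 * K ^ 12 * (k * (k + h ^ 2)) * K := by gcongr
  nlinarith

/-- The improved gradient bound, put back into `RefIncr.norm_lap_le`, gives order k + h² in ℓ². -/
theorem RefIncr.gridSum_sq_lap_le (hp : ConsParam K h k α ε) {u S up Sp : GridFun N}
    (hu : RefLevel K h ε u S) (hup : RefLevel K h ε up Sp) (hi : RefIncr K h k u S up Sp)
    (hvol : gridSum h (fun _ : Index N => 1) ≤ K) :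
    gridSum h (fun I => ‖lap h (up - u) I‖ ^ 2) ≤ 6000 * K ^ 23 * (k + h ^ 2) ^ 2 := by
  have hK := hp.one_le
  have hh := hp.h_pos
  have hk := hp.k_pos
  have h1 : gridSum h (fun I => ‖lap h (up - u) I‖ ^ 2)
      ≤ gridSum h (fun I => 32 * K ^ 10 * ((k + h ^ 2) ^ 2 * 1 + ‖grad h (up - u) I‖ ^ 2)) := by
    refine gridSum_mono hh fun I => ?_
    have := hi.norm_lap_le hp hu hup I
    calc _ ≤ (4 * K ^ 5 * (k + h ^ 2 + ‖grad h (up - u) I‖)) ^ 2 := by gcongr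
      _ = 16 * K ^ 10 * (k + h ^ 2 + ‖grad h (up - u) I‖) ^ 2 := by ring
      _ ≤ 16 * K ^ 10 * (2 * (k + h ^ 2) ^ 2 + 2 * ‖grad h (up - u) I‖ ^ 2) := by
        gcongr; exact add_sq_le_two _ _
      _ = _ := by ring
  rw [gridSum_mul, gridSum_add, gridSum_mul] at h1
  refine h1.trans ?_
  have h2 := hi.gridSum_sq_grad_le hp hu hup hvol
  have h3 : k * (k + h ^ 2) ≤ (k + h ^ 2) ^ 2 := by
    rw [sq (k + h ^ 2)]; gcongr; linarith [sq_nonneg h]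
  have h4 : K ≤ K ^ 13 := by simpa using pow_le_pow_right₀ hK (by norm_num : 1 ≤ 13)
  have e0 : 0 ≤ K ^ 13 * (k + h ^ 2) ^ 2 := by positivity
  calc _ ≤ 32 * K ^ 10 * ((k + h ^ 2) ^ 2 * K ^ 13 + 160 * K ^ 13 * (k + h ^ 2) ^ 2) := by
        gcongr
        exacts [hvol.trans h4, h2.trans (by gcongr)]
    _ = 5152 * K ^ 23 * (k + h ^ 2) ^ 2 := by ring
    _ ≤ _ := by gcongr; norm_num

theorem gridSum_sq_lap_incr2_le (hp : ConsParam K h k α ε) {u' S' u S up Sp : GridFun N}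
    (hu' : RefLevel K h ε u' S') (hu : RefLevel K h ε u S) (hup : RefLevel K h ε up Sp)
    (hi' : RefIncr K h k u' S' u S) (hi : RefIncr K h k u S up Sp)
    (hvol : gridSum h (fun _ : Index N => 1) ≤ K) :
    gridSum h (fun I => ‖lap h (up - (2 : ℝ) • u + u') I‖ ^ 2)
      ≤ 24000 * K ^ 23 * (k + h ^ 2) ^ 2 := by
  have h1 : gridSum h (fun I => ‖lap h (up - (2 : ℝ) • u + u') I‖ ^ 2)
      ≤ gridSum h (fun I => 2 * ‖lap h (up - u) I‖ ^ 2 + 2 * ‖lap h (u - u') I‖ ^ 2) := by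
    refine gridSum_mono hp.h_pos fun I => ?_
    rw [show up - (2 : ℝ) • u + u' = (up - u) - (u - u') by module, lap_sub]
    refine le_trans ?_ (add_sq_le_two _ _)
    gcongr
    exact norm_sub_le _ _
  rw [gridSum_add, gridSum_mul, gridSum_mul] at h1
  have h2 := hi.gridSum_sq_lap_le hp hu hup hvol
  have h3 := hi'.gridSum_sq_lap_le hp hu' hu hvol
  linarith

/-- Interpolation of the second time difference between its size k² and the size k + h² of its
Laplacian. The factor k + h² on the left avoids a division and is the one by which
`RefIncr.incr_grad` bounds the gradient of the increment. -/
theorem gridSum_sq_grad_incr2_le (hp : ConsParam K h k α ε) {u' S' u S up Sp : GridFun N}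
    (hu' : RefLevel K h ε u' S') (hu : RefLevel K h ε u S) (hup : RefLevel K h ε up Sp)
    (hi' : RefIncr K h k u' S' u S) (hi : RefIncr K h k u S up Sp)
    (hincr2 : ∀ I, ‖up I - (2 : ℝ) • u I + u' I‖ ≤ K * k ^ 2)
    (hvol : gridSum h (fun _ : Index N => 1) ≤ K) :
    (k + h ^ 2) * gridSum h (fun I => ‖grad h (up - (2 : ℝ) • u + u') I‖ ^ 2)
      ≤ 25000 * K ^ 24 * (k ^ 2 * (k + h ^ 2) ^ 2) := by
  have hK := hp.one_le
  have hh := hp.h_pos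
  have hk := hp.k_pos
  set f := up - (2 : ℝ) • u + u' with hf
  have h1 := gridSum_sq_grad h f
  have h2 : (k + h ^ 2) * gridSum h (fun I => -2 * ⟪f I, lap h f I⟫)
      ≤ gridSum h (fun I => K * k ^ 2 * (‖lap h f I‖ ^ 2 + (k + h ^ 2) ^ 2 * 1)) := by
    rw [← gridSum_mul]
    refine gridSum_mono hh fun I => ?_
    have a1 : -2 * ⟪f I, lap h f I⟫ ≤ 2 * ((K * k ^ 2) * ‖lap h f I‖) := by
      have := neg_le_of_abs_le ((abs_real_inner_le_norm (f I) (lap h f I)).trans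
        (mul_le_mul_of_nonneg_right (hincr2 I) (norm_nonneg _)))
      linarith
    calc _ ≤ (k + h ^ 2) * (2 * ((K * k ^ 2) * ‖lap h f I‖)) := by gcongr
      _ = K * k ^ 2 * (2 * ‖lap h f I‖ * (k + h ^ 2)) := by ring
      _ ≤ _ := by
        gcongr
        linarith [two_mul_le_add_sq ‖lap h f I‖ (k + h ^ 2)]
  rw [gridSum_mul, gridSum_mul, gridSum_add, gridSum_mul, ← h1] at h2
  refine h2.trans ?_
  have h3 : gridSum h (fun I => ‖lap h f I‖ ^ 2) ≤ 24000 * K ^ 23 * (k + h ^ 2) ^ 2 :=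
    gridSum_sq_lap_incr2_le hp hu' hu hup hi' hi hvol
  have h4 : K ≤ K ^ 23 := by simpa using pow_le_pow_right₀ hK (by norm_num : 1 ≤ 23)
  calc _ ≤ K * k ^ 2 * (24000 * K ^ 23 * (k + h ^ 2) ^ 2 + (k + h ^ 2) ^ 2 * K ^ 23) := by
        gcongr
        exact hvol.trans h4
    _ = 24001 * K ^ 24 * (k ^ 2 * (k + h ^ 2) ^ 2) := by ring
    _ ≤ _ := by gcongr; norm_num

theorem extrap_eq_avg_sub (u' u up : GridFun N) (I : Index N) :
    extrap u' u I
      = (1 / 2 : ℝ) • (up I + u I) - (1 / 2 : ℝ) • (up I - (2 : ℝ) • u I + u' I) := by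
  simp only [extrap]; module

theorem inner_extrap_incr {u' u up : GridFun N} (hu : ∀ I, ‖u I‖ = 1) (hup : ∀ I, ‖up I‖ = 1)
    (I : Index N) : ⟪extrap u' u I, up I - u I⟫
      = -(1 / 2) * ⟪up I - u I, up I - (2 : ℝ) • u I + u' I⟫ := by
  have h1 : ⟪up I + u I, up I - u I⟫ = 0 := by
    rw [inner_add_left, inner_sub_right, inner_sub_right, real_inner_self_eq_norm_sq,
      real_inner_self_eq_norm_sq, hu, hup, real_inner_comm]; ring
  rw [extrap_eq_avg_sub u' u up, inner_sub_left, inner_smul_left, inner_smul_left, h1,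
    real_inner_comm]
  simp

/-- The component of the increments normal to the extrapolated value is smooth up to order two. -/
theorem gridSum_sq_lap_inner_extrap_le (hp : ConsParam K h k α ε) {u' S' u S up Sp : GridFun N}
    (hu' : RefLevel K h ε u' S') (hu : RefLevel K h ε u S) (hup : RefLevel K h ε up Sp)
    (hi' : RefIncr K h k u' S' u S) (hi : RefIncr K h k u S up Sp)
    (hincr2 : ∀ I, ‖up I - (2 : ℝ) • u I + u' I‖ ≤ K * k ^ 2)
    (hvol : gridSum h (fun _ : Index N => 1) ≤ K) :
    gridSum h (fun I => lap h (fun J => ⟪extrap u' u J, up J - u J⟫) I ^ 2)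
      ≤ 100000 * K ^ 25 * (k ^ 2 + h ^ 2) ^ 2 := by
  have hK := hp.one_le
  have hh := hp.h_pos
  have hk := hp.k_pos
  set f := up - (2 : ℝ) • u + u' with hf
  set w := up - u with hw
  have e : (fun J => ⟪extrap u' u J, up J - u J⟫) = (-(1 / 2) : ℝ) • fun J => ⟪w J, f J⟫ := by
    ext1 J
    exact inner_extrap_incr hu.unit hup.unit J
  have h1 : ∀ I, lap h (fun J => ⟪extrap u' u J, up J - u J⟫) I ^ 2
      ≤ K ^ 2 * k ^ 2 * ‖lap h f I‖ ^ 2 + K ^ 2 * k ^ 2 * ‖lap h w I‖ ^ 2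
        + K * ((k + h ^ 2) * ‖grad h f I‖ ^ 2) := by
    intro I
    rw [e, lap_smul, lap_inner, smul_eq_mul]
    have a1 : |⟪w I, lap h f I⟫| ≤ K * k * ‖lap h f I‖ :=
      (abs_real_inner_le_norm _ _).trans (by gcongr; exact hi.incr I)
    have a2 : |⟪f I, lap h w I⟫| ≤ K * k * ‖lap h w I‖ :=
      (abs_real_inner_le_norm _ _).trans (by
        gcongr
        refine (hincr2 I).trans ?_
        gcongr
        nlinarith [hp.k_le])
    have a3 : |⟪grad h w I, grad h f I⟫| ≤ ‖grad h w I‖ * ‖grad h f I‖ :=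
      abs_real_inner_le_norm _ _
    have a4 := hi.incr_grad I
    have b1 : ⟪w I, lap h f I⟫ ^ 2 ≤ (K * k * ‖lap h f I‖) ^ 2 := sq_le_sq' (neg_le_of_abs_le a1)
      (le_of_abs_le a1)
    have b2 : ⟪f I, lap h w I⟫ ^ 2 ≤ (K * k * ‖lap h w I‖) ^ 2 := sq_le_sq' (neg_le_of_abs_le a2)
      (le_of_abs_le a2)
    -- The gradient of the increment is bounded pointwise and that of the second difference in ℓ²,
    -- so no maximum norm bound for the latter is needed.
    have b3 : ⟪grad h w I, grad h f I⟫ ^ 2 ≤ K * ((k + h ^ 2) * ‖grad h f I‖ ^ 2) := by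
      calc _ ≤ (‖grad h w I‖ * ‖grad h f I‖) ^ 2 := sq_le_sq' (neg_le_of_abs_le a3)
            (le_of_abs_le a3)
        _ = ‖grad h w I‖ ^ 2 * ‖grad h f I‖ ^ 2 := by ring
        _ ≤ K * (k + h ^ 2) * ‖grad h f I‖ ^ 2 := by gcongr
        _ = _ := by ring
    have c1 := add_sq_le_two (⟪w I, lap h f I⟫ + ⟪f I, lap h w I⟫) ⟪grad h w I, grad h f I⟫
    have c2 := add_sq_le_two ⟪w I, lap h f I⟫ ⟪f I, lap h w I⟫
    have b4 : 0 ≤ ⟪grad h w I, grad h f I⟫ ^ 2 := sq_nonneg _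
    rw [mul_pow, show (-(1 / 2) : ℝ) ^ 2 = 1 / 4 by norm_num]
    linarith
  have h2 := gridSum_mono hh h1
  rw [gridSum_add, gridSum_add, gridSum_mul, gridSum_mul, gridSum_mul, gridSum_mul] at h2
  have h3 : gridSum h (fun I => ‖lap h f I‖ ^ 2) ≤ 24000 * K ^ 23 * (k + h ^ 2) ^ 2 :=
    gridSum_sq_lap_incr2_le hp hu' hu hup hi' hi hvol
  have h4 := hi.gridSum_sq_lap_le hp hu hup hvol
  have h5 : (k + h ^ 2) * gridSum h (fun I => ‖grad h f I‖ ^ 2)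
      ≤ 25000 * K ^ 24 * (k ^ 2 * (k + h ^ 2) ^ 2) :=
    gridSum_sq_grad_incr2_le hp hu' hu hup hi' hi hincr2 hvol
  have h6 : k ^ 2 * (k + h ^ 2) ^ 2 ≤ (k ^ 2 + h ^ 2) ^ 2 := by
    rw [← mul_pow]
    gcongr
    nlinarith [hp.k_le, sq_nonneg h]
  refine h2.trans ?_
  calc _ ≤ K ^ 2 * k ^ 2 * (24000 * K ^ 23 * (k + h ^ 2) ^ 2)
        + K ^ 2 * k ^ 2 * (6000 * K ^ 23 * (k + h ^ 2) ^ 2)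
        + K * (25000 * K ^ 24 * (k ^ 2 * (k + h ^ 2) ^ 2)) := by gcongr
    _ = 55000 * K ^ 25 * (k ^ 2 * (k + h ^ 2) ^ 2) := by ring
    _ ≤ 100000 * K ^ 25 * (k ^ 2 * (k + h ^ 2) ^ 2) := by gcongr; norm_num
    _ ≤ _ := by gcongr

/-- A sequence with values in the sphere that satisfies the equation at the midpoint up to second
order, with `S` in place of the tangential exchange field, satisfies the scheme up to second
order. -/
theorem refStep_and_refResidual (hp : ConsParam K h k α ε) {u' S' u S up Sp F : GridFun N}
    (hu' : RefLevel K h ε u' S') (hu : RefLevel K h ε u S) (hup : RefLevel K h ε up Sp)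
    (hi' : RefIncr K h k u' S' u S) (hi : RefIncr K h k u S up Sp)
    (hincr2 : ∀ I, ‖up I - (2 : ℝ) • u I + u' I‖ ≤ K * k ^ 2)
    (hF : ∀ I, ‖F I‖ ≤ K)
    (hmid : ∀ I, ‖k⁻¹ • (up I - u I)
      - llgRhs α (extrap u' u I) ((1 / 2 : ℝ) • (Sp I + S I) + F I)‖ ≤ K * (k ^ 2 + h ^ 2))
    (hvol : gridSum h (fun _ : Index N => 1) ≤ K) {K' : ℝ} (hK' : 100000 * K ^ 25 ≤ K') :
    ∃ R, RefStep K' h k α u' u up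
        (fun I => ε • lap h ((1 / 2 : ℝ) • (up + u)) I + F I) R ∧
      RefResidual K' h k u' u up R := by
  have hK := hp.one_le
  have hh := hp.h_pos
  have hk := hp.k_pos
  have hε := hp.ε_pos
  have hα := hp.α_pos
  have hK25 : ∀ n ≤ 25, ∀ c : ℝ, 0 ≤ c → c ≤ 100000 → c * K ^ n ≤ K' := by
    intro n hn c hc0 hc
    refine le_trans ?_ hK'
    gcongr
  have hKK : K ≤ K' := by simpa using hK25 1 (by norm_num) 1 (by norm_num) (by norm_num)
  have hfield : ∀ I, ‖ε • lap h ((1 / 2 : ℝ) • (up + u)) I + F I‖ ≤ K' := by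
    intro I
    rw [lap_smul, lap_add]
    have h2 : ‖ε • (1 / 2 : ℝ) • (lap h up I + lap h u I)‖ ≤ K * (1 / 2 * (K + K)) := by
      rw [norm_smul, norm_smul, Real.norm_eq_abs, abs_of_pos hε, Real.norm_eq_abs,
        abs_of_pos (by norm_num : (0 : ℝ) < 1 / 2)]
      gcongr
      · exact hp.ε_le
      · exact (norm_add_le _ _).trans (add_le_add (hup.lap_le I) (hu.lap_le I))
    have h3 := hK25 2 (by norm_num) 2 (by norm_num) (by norm_num)
    have := norm_add_le (ε • (1 / 2 : ℝ) • (lap h up I + lap h u I)) (F I)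
    have := hF I
    nlinarith
  refine ⟨fun I => k⁻¹ • (up I - u I) - llgRhs α (extrap u' u I)
    (ε • lap h ((1 / 2 : ℝ) • (up + u)) I + F I), ?_, ?_, ?_, ?_⟩
  · refine ⟨hu'.unit, hu.unit, hup.unit, fun I => (hu'.grad_le I).trans hKK,
      fun I => (hu.grad_le I).trans hKK, fun I => (hup.grad_le I).trans hKK,
      fun I => (hu'.lap_le I).trans hKK, fun I => (hu.lap_le I).trans hKK,
      fun I => (hup.lap_le I).trans hKK, fun I => (hi'.incr I).trans (by gcongr),
      fun I => (hi.incr I).trans (by gcongr), fun I => (hincr2 I).trans (by gcongr), hfield,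
      fun I => ?_⟩
    abel
  · exact hvol.trans hKK
  · have h1 : ∀ I, ‖k⁻¹ • (up I - u I) - llgRhs α (extrap u' u I)
        (ε • lap h ((1 / 2 : ℝ) • (up + u)) I + F I)‖
        ≤ 4 * K ^ 5 * (k ^ 2 + h ^ 2) + K ^ 4 * (k * ‖grad h (up - u) I‖) := by
      intro I
      set Np := ⟪up I, lap h up I⟫ with hNp
      set Nu := ⟪u I, lap h u I⟫ with hNu
      set a := extrap u' u I with ha
      -- Y collects the consistency errors of the exchange field. The normal parts act on the values
      -- up and u; they are regrouped as a multiple of the extrapolation `a`, annihilated by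
      -- `llgRhs_self`, plus small multiples of the second difference and of the increment.
      set Y := (1 / 2 : ℝ) • ((perp (up I) (ε • lap h up I) - Sp I)
          + (perp (u I) (ε • lap h u I) - S I))
        + (ε * (1 / 4 * (Np + Nu))) • (up I - (2 : ℝ) • u I + u' I)
        + (ε * (1 / 4 * (Np - Nu))) • (up I - u I) with hY
      have e1 : ε • lap h ((1 / 2 : ℝ) • (up + u)) I + F I
          = ((1 / 2 : ℝ) • (Sp I + S I) + F I) + Y + (ε * (1 / 2 * (Np + Nu))) • a := by
        rw [lap_smul, lap_add, hY, ha, extrap_eq_avg_sub u' u up, perp, perp, inner_smul_right,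
          inner_smul_right, ← hNp, ← hNu]
        module
      rw [e1, llgRhs_add, llgRhs_smul, llgRhs_self, smul_zero, add_zero, llgRhs_add, ← sub_sub]
      have ba : ‖a‖ ≤ 2 := by
        rw [ha, extrap_eq]
        refine (norm_sub_le _ _).trans ?_
        simp only [Pi.smul_apply, norm_smul, hu.unit, hu'.unit]
        norm_num
      have bY : ‖Y‖ ≤ 1 / 2 * (K * h ^ 2 + K * h ^ 2) + K * (1 / 4 * (K ^ 2 / 2 + K ^ 2 / 2))
          * (K * k ^ 2) + K * (1 / 4 * (K * ‖grad h (up - u) I‖)) * (K * k) := by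
        refine (norm_add_le _ _).trans (add_le_add ((norm_add_le _ _).trans (add_le_add ?_ ?_)) ?_)
        · rw [norm_smul, Real.norm_eq_abs, abs_of_pos (by norm_num : (0 : ℝ) < 1 / 2)]
          gcongr
          exact (norm_add_le _ _).trans (add_le_add (hup.perp_lap I) (hu.perp_lap I))
        · rw [norm_smul, Real.norm_eq_abs, abs_mul, abs_mul, abs_of_pos hε,
            abs_of_pos (by norm_num : (0 : ℝ) < 1 / 4)]
          gcongr
          · exact hp.ε_le
          · exact (abs_add_le _ _).trans
              (add_le_add (hup.abs_inner_lap_le I) (hu.abs_inner_lap_le I))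
          · exact hincr2 I
        · rw [norm_smul, Real.norm_eq_abs, abs_mul, abs_mul, abs_of_pos hε,
            abs_of_pos (by norm_num : (0 : ℝ) < 1 / 4)]
          gcongr
          · exact hp.ε_le
          · exact hu.abs_inner_lap_sub_le hup I
          · exact hi.incr I
      have bA : ‖llgRhs α a Y‖ ≤ 2 * K * ‖Y‖ := by
        refine (norm_llgRhs_le _ _ _).trans ?_
        rw [abs_of_pos hα]
        calc (1 + α * ‖a‖) * (‖a‖ * ‖Y‖) ≤ (1 + α * 2) * (2 * ‖Y‖) := by gcongr
          _ = 2 * (1 + 2 * α) * ‖Y‖ := by ring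
          _ ≤ 2 * K * ‖Y‖ := by gcongr; linarith [hp.α_le]
      refine (norm_sub_le _ _).trans ((add_le_add (hmid I) bA).trans ?_)
      set G := ‖grad h (up - u) I‖ with hG
      have hG0 : 0 ≤ G := norm_nonneg _
      have k1 : K ≤ K ^ 5 := by simpa using pow_le_pow_right₀ hK (by norm_num : 1 ≤ 5)
      have k2 : K ^ 2 ≤ K ^ 5 := pow_le_pow_right₀ hK (by norm_num)
      calc _ ≤ K * (k ^ 2 + h ^ 2) + 2 * K * (1 / 2 * (K * h ^ 2 + K * h ^ 2)
            + K * (1 / 4 * (K ^ 2 / 2 + K ^ 2 / 2)) * (K * k ^ 2)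
            + K * (1 / 4 * (K * G)) * (K * k)) := by gcongr
        _ = K * (k ^ 2 + h ^ 2) + 2 * K ^ 2 * h ^ 2 + 1 / 2 * K ^ 5 * k ^ 2
            + 1 / 2 * (K ^ 4 * (k * G)) := by ring
        _ ≤ K ^ 5 * (k ^ 2 + h ^ 2) + 2 * K ^ 5 * h ^ 2 + 1 / 2 * K ^ 5 * k ^ 2
            + 1 / 2 * (K ^ 4 * (k * G)) := by gcongr
        _ ≤ _ := by
          have t1 : 0 ≤ K ^ 5 * k ^ 2 := by positivity
          have t2 : 0 ≤ K ^ 5 * h ^ 2 := by positivity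
          have t3 : 0 ≤ K ^ 4 * (k * G) := by positivity
          linarith
    have h2 := gridSum_mono hh (ψ := fun I => 32 * K ^ 10 * (k ^ 2 + h ^ 2) ^ 2 * 1
        + 2 * K ^ 8 * k ^ 2 * ‖grad h (up - u) I‖ ^ 2) (fun I =>
      (pow_le_pow_left₀ (norm_nonneg _) (h1 I) 2).trans
        ((add_sq_le_two _ _).trans_eq (by ring)))
    rw [gridSum_add, gridSum_mul, gridSum_mul] at h2
    refine h2.trans ?_
    have h3 := hi.gridSum_sq_grad_le hp hu hup hvol
    have h4 : k * (k * (k * (k + h ^ 2))) ≤ (k ^ 2 + h ^ 2) ^ 2 := by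
      have := hp.k_le
      calc k * (k * (k * (k + h ^ 2))) = k ^ 2 * (k ^ 2 + k * h ^ 2) := by ring
        _ ≤ (k ^ 2 + h ^ 2) * (k ^ 2 + 1 * h ^ 2) := by gcongr; linarith [sq_nonneg h]
        _ = _ := by ring
    calc _ ≤ 32 * K ^ 10 * (k ^ 2 + h ^ 2) ^ 2 * K
          + 2 * K ^ 8 * k ^ 2 * (160 * K ^ 13 * (k * (k + h ^ 2))) := by gcongr
      _ = 32 * K ^ 11 * (k ^ 2 + h ^ 2) ^ 2
          + 320 * K ^ 21 * (k * (k * (k * (k + h ^ 2)))) := by ring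
      _ ≤ 32 * K ^ 25 * (k ^ 2 + h ^ 2) ^ 2 + 320 * K ^ 25 * (k ^ 2 + h ^ 2) ^ 2 := by
          gcongr <;> first | exact hK | norm_num
      _ = 352 * K ^ 25 * (k ^ 2 + h ^ 2) ^ 2 := by ring
      _ ≤ K' * (k ^ 2 + h ^ 2) ^ 2 := by
          gcongr; exact hK25 25 le_rfl 352 (by norm_num) (by norm_num)
  · exact (gridSum_sq_lap_inner_extrap_le hp hu' hu hup hi' hi hincr2 hvol).trans (by gcongr)

end Grid

end LLG

/-! ### Functions with bounded first and second difference quotients in time. -/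

namespace LLG

open scoped RealInnerProductSpace

section Time

variable {ι E F G : Type*} [NormedAddCommGroup E] [NormedSpace ℝ E] [NormedAddCommGroup F]
  [NormedSpace ℝ F] [NormedAddCommGroup G] [NormedSpace ℝ G] {T K : ℝ} {A : Set ι}

/-- Boundedness of a function on `[0, T]`, of its first difference quotients and of its second
difference quotients. -/
structure DiffBound (T K : ℝ) (f : ℝ → F) : Prop where
  bound : ∀ t ∈ Icc 0 T, ‖f t‖ ≤ K
  lip : ∀ t ∈ Icc 0 T, ∀ s ∈ Icc 0 T, ‖f t - f s‖ ≤ K * |t - s|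
  diff2 : ∀ t σ, 0 ≤ σ → t - σ ∈ Icc 0 T → t + σ ∈ Icc 0 T →
    ‖f (t + σ) - (2 : ℝ) • f t + f (t - σ)‖ ≤ K * σ ^ 2

/-- Functions of time and a parameter in `A` with uniformly bounded first and second difference
quotients in time. -/
def TimeC11 (T : ℝ) (A : Set ι) (f : ℝ → ι → F) : Prop :=
  ∃ K, 0 ≤ K ∧ ∀ x ∈ A, DiffBound T K fun t => f t x

theorem DiffBound.mono {K' : ℝ} (hK : K ≤ K') {f : ℝ → F} (hf : DiffBound T K f) :
    DiffBound T K' f where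
  bound t ht := (hf.bound t ht).trans hK
  lip t ht s hs := (hf.lip t ht s hs).trans (by gcongr)
  diff2 t σ h0 h1 h2 := (hf.diff2 t σ h0 h1 h2).trans (by gcongr)

theorem DiffBound.add {K₁ K₂ : ℝ} {f g : ℝ → F} (hf : DiffBound T K₁ f) (hg : DiffBound T K₂ g) :
    DiffBound T (K₁ + K₂) (fun t => f t + g t) where
  bound t ht := (norm_add_le _ _).trans (add_le_add (hf.bound t ht) (hg.bound t ht))
  lip t ht s hs := by
    rw [add_mul, show f t + g t - (f s + g s) = (f t - f s) + (g t - g s) by abel]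
    exact (norm_add_le _ _).trans (add_le_add (hf.lip t ht s hs) (hg.lip t ht s hs))
  diff2 t σ h0 h1 h2 := by
    rw [add_mul, show f (t + σ) + g (t + σ) - (2 : ℝ) • (f t + g t) + (f (t - σ) + g (t - σ))
      = (f (t + σ) - (2 : ℝ) • f t + f (t - σ)) + (g (t + σ) - (2 : ℝ) • g t + g (t - σ)) by module]
    exact (norm_add_le _ _).trans (add_le_add (hf.diff2 t σ h0 h1 h2) (hg.diff2 t σ h0 h1 h2))

theorem mem_Icc_of_sub_add {t σ : ℝ} (h0 : 0 ≤ σ) (h1 : t - σ ∈ Icc 0 T) (h2 : t + σ ∈ Icc 0 T) :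
    t ∈ Icc 0 T :=
  ⟨by linarith [h1.1], by linarith [h2.2]⟩

/-- Leibniz rule: the second difference of a product consists of two second differences and two
products of first differences, centred at the middle point. -/
theorem DiffBound.bilin {K₁ K₂ C : ℝ} (hC : 0 ≤ C) (h₁ : 0 ≤ K₁) (h₂ : 0 ≤ K₂)
    (B : E →ₗ[ℝ] F →ₗ[ℝ] G)
    (hB : ∀ a b, ‖B a b‖ ≤ C * ‖a‖ * ‖b‖) {f : ℝ → E} {g : ℝ → F} (hf : DiffBound T K₁ f)
    (hg : DiffBound T K₂ g) : DiffBound T (4 * C * K₁ * K₂) (fun t => B (f t) (g t)) := by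
  have hCK : 0 ≤ C * K₁ * K₂ := by positivity
  refine ⟨fun t ht => ?_, fun t ht s hs => ?_, fun t σ h0 h1 h2 => ?_⟩
  · refine (hB _ _).trans ?_
    have : C * ‖f t‖ * ‖g t‖ ≤ C * K₁ * K₂ := by
      gcongr
      exacts [hf.bound t ht, hg.bound t ht]
    linarith
  · have e : B (f t) (g t) - B (f s) (g s) = B (f t - f s) (g t) + B (f s) (g t - g s) := by
      simp only [map_sub, LinearMap.sub_apply]; abel
    rw [e]
    refine (norm_add_le _ _).trans ((add_le_add (hB _ _) (hB _ _)).trans ?_)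
    have a1 : C * ‖f t - f s‖ * ‖g t‖ ≤ C * (K₁ * |t - s|) * K₂ := by
      gcongr
      exacts [hf.lip t ht s hs, hg.bound t ht]
    have a2 : C * ‖f s‖ * ‖g t - g s‖ ≤ C * K₁ * (K₂ * |t - s|) := by
      gcongr
      exacts [hf.bound s hs, hg.lip t ht s hs]
    have : 0 ≤ C * K₁ * K₂ * |t - s| := by positivity
    linarith
  · have ht := mem_Icc_of_sub_add h0 h1 h2
    have e : B (f (t + σ)) (g (t + σ)) - (2 : ℝ) • B (f t) (g t) + B (f (t - σ)) (g (t - σ))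
        = B (f (t + σ) - (2 : ℝ) • f t + f (t - σ)) (g t)
          + B (f t) (g (t + σ) - (2 : ℝ) • g t + g (t - σ))
          + B (f (t + σ) - f t) (g (t + σ) - g t) + B (f (t - σ) - f t) (g (t - σ) - g t) := by
      simp only [map_sub, map_add, map_smul, LinearMap.sub_apply, LinearMap.add_apply,
        LinearMap.smul_apply]
      module
    rw [e]
    refine (norm_add_le _ _).trans ((add_le_add ((norm_add_le _ _).trans (add_le_add
      ((norm_add_le _ _).trans (add_le_add (hB _ _) (hB _ _))) (hB _ _))) (hB _ _)).trans ?_)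
    have l1 := hf.lip _ h2 t ht
    have l2 := hg.lip _ h2 t ht
    have l3 := hf.lip _ h1 t ht
    have l4 := hg.lip _ h1 t ht
    rw [add_sub_cancel_left, abs_of_nonneg h0] at l1 l2
    rw [sub_sub_cancel_left, abs_neg, abs_of_nonneg h0] at l3 l4
    have a1 : C * ‖f (t + σ) - (2 : ℝ) • f t + f (t - σ)‖ * ‖g t‖ ≤ C * (K₁ * σ ^ 2) * K₂ := by
      gcongr
      exacts [hf.diff2 t σ h0 h1 h2, hg.bound t ht]
    have a2 : C * ‖f t‖ * ‖g (t + σ) - (2 : ℝ) • g t + g (t - σ)‖ ≤ C * K₁ * (K₂ * σ ^ 2) := by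
      gcongr
      exacts [hf.bound t ht, hg.diff2 t σ h0 h1 h2]
    have a3 : C * ‖f (t + σ) - f t‖ * ‖g (t + σ) - g t‖ ≤ C * (K₁ * σ) * (K₂ * σ) := by gcongr
    have a4 : C * ‖f (t - σ) - f t‖ * ‖g (t - σ) - g t‖ ≤ C * (K₁ * σ) * (K₂ * σ) := by gcongr
    linarith

/-- The lower bound 1 makes all denominators harmless. It is used for the normalizing factor of the
correction. -/
theorem DiffBound.inv {f : ℝ → ℝ} (hK : 0 ≤ K) (hf : DiffBound T K f)
    (h1 : ∀ t ∈ Icc 0 T, 1 ≤ f t) : DiffBound T (1 + K + 2 * K ^ 2) (fun t => (f t)⁻¹) := by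
  refine ⟨fun t ht => ?_, fun t ht s hs => ?_, fun t σ h0 i1 i2 => ?_⟩
  · have := h1 t ht
    rw [Real.norm_eq_abs, abs_of_pos (by positivity)]
    have : (f t)⁻¹ ≤ 1 := inv_le_one_of_one_le₀ this
    nlinarith [sq_nonneg K]
  · have t1 := h1 t ht
    have s1 := h1 s hs
    have e : (f t)⁻¹ - (f s)⁻¹ = -(f t - f s) / (f t * f s) := by field_simp; ring
    rw [e, norm_div, norm_neg, Real.norm_eq_abs (f t * f s), abs_of_pos (by positivity)]
    have l := hf.lip t ht s hs
    have : ‖f t - f s‖ / (f t * f s) ≤ ‖f t - f s‖ :=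
      div_le_self (norm_nonneg _) (by nlinarith)
    have : 0 ≤ (1 + 2 * K ^ 2) * |t - s| := by positivity
    nlinarith
  · have ht := mem_Icc_of_sub_add h0 i1 i2
    have l1 := hf.lip _ i2 t ht
    have l3 := hf.lip _ i1 t ht
    have l2 := hf.diff2 t σ h0 i1 i2
    rw [add_sub_cancel_left, abs_of_nonneg h0] at l1
    rw [sub_sub_cancel_left, abs_neg, abs_of_nonneg h0] at l3
    have p1 := h1 _ i2
    have p2 := h1 t ht
    have p3 := h1 _ i1
    set a := f (t + σ)
    set b := f t
    set c := f (t - σ)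
    have e : a⁻¹ - (2 : ℝ) • b⁻¹ + c⁻¹
        = -((a - (2 : ℝ) • b + c) / (a * c)) - 2 * ((a - b) * (c - b)) / (a * b * c) := by
      simp only [smul_eq_mul]; field_simp; ring
    have q1 : 1 ≤ a * c := by nlinarith
    have q2 : 1 ≤ a * b * c := by nlinarith
    rw [e]
    refine (norm_sub_le _ _).trans ?_
    rw [norm_neg, norm_div, norm_div, Real.norm_eq_abs (a * c), Real.norm_eq_abs (a * b * c),
      abs_of_pos (by positivity), abs_of_pos (by positivity), norm_mul, norm_mul,
      Real.norm_eq_abs 2, abs_two]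
    have r1 : ‖a - (2 : ℝ) • b + c‖ / (a * c) ≤ K * σ ^ 2 :=
      (div_le_self (norm_nonneg _) q1).trans l2
    have r2 : 2 * (‖a - b‖ * ‖c - b‖) / (a * b * c) ≤ 2 * ((K * σ) * (K * σ)) :=
      (div_le_self (by positivity) q2).trans (by gcongr)
    nlinarith [sq_nonneg σ]

theorem TimeC11.comp {κ : Type*} {A' : Set κ} {f : ℝ → ι → F} (hf : TimeC11 T A f) {p : κ → ι}
    (hp : MapsTo p A' A) : TimeC11 T A' (fun t y => f t (p y)) := by
  obtain ⟨K, hK, H⟩ := hf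
  exact ⟨K, hK, fun y hy => H _ (hp hy)⟩

theorem TimeC11.add {f g : ℝ → ι → F} (hf : TimeC11 T A f) (hg : TimeC11 T A g) :
    TimeC11 T A (fun t x => f t x + g t x) := by
  obtain ⟨K, hK, H⟩ := hf
  obtain ⟨K', hK', H'⟩ := hg
  exact ⟨K + K', by positivity, fun x hx => (H x hx).add (H' x hx)⟩

theorem TimeC11.bilin {C : ℝ} (hC : 0 ≤ C) (B : E →ₗ[ℝ] F →ₗ[ℝ] G)
    (hB : ∀ a b, ‖B a b‖ ≤ C * ‖a‖ * ‖b‖) {f : ℝ → ι → E} {g : ℝ → ι → F} (hf : TimeC11 T A f)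
    (hg : TimeC11 T A g) : TimeC11 T A (fun t x => B (f t x) (g t x)) := by
  obtain ⟨K, hK, H⟩ := hf
  obtain ⟨K', hK', H'⟩ := hg
  exact ⟨4 * C * K * K', by positivity, fun x hx => (H x hx).bilin hC hK hK' B hB (H' x hx)⟩

theorem TimeC11.inv {f : ℝ → ι → ℝ} (hf : TimeC11 T A f)
    (h1 : ∀ t ∈ Icc 0 T, ∀ x ∈ A, 1 ≤ f t x) : TimeC11 T A (fun t x => (f t x)⁻¹) := by
  obtain ⟨K, hK, H⟩ := hf
  exact ⟨1 + K + 2 * K ^ 2, by positivity, fun x hx => (H x hx).inv hK fun t ht => h1 t ht x hx⟩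

theorem TimeC11.of_const {c : ι → F} {C : ℝ} (hC : ∀ x ∈ A, ‖c x‖ ≤ C) :
    TimeC11 T A (fun _ x => c x) := by
  refine ⟨max C 0, le_max_right _ _, fun x hx => ⟨fun t _ => (hC x hx).trans (le_max_left _ _),
    fun t _ s _ => ?_, fun t σ _ _ _ => ?_⟩⟩
  · rw [sub_self, norm_zero]; positivity
  · rw [show c x - (2 : ℝ) • c x + c x = 0 by module, norm_zero]; positivity

theorem TimeC11.smul {r : ℝ → ι → ℝ} {f : ℝ → ι → F} (hr : TimeC11 T A r) (hf : TimeC11 T A f) :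
    TimeC11 T A (fun t x => r t x • f t x) :=
  TimeC11.bilin zero_le_one (LinearMap.lsmul ℝ F) (fun a b => by simp [norm_smul]) hr hf

theorem TimeC11.const_smul (r : ℝ) {f : ℝ → ι → F} (hf : TimeC11 T A f) :
    TimeC11 T A (fun t x => r • f t x) :=
  TimeC11.smul (TimeC11.of_const (C := ‖r‖) fun _ _ => le_rfl) hf

theorem TimeC11.sub {f g : ℝ → ι → F} (hf : TimeC11 T A f) (hg : TimeC11 T A g) :
    TimeC11 T A (fun t x => f t x - g t x) := by
  simpa [sub_eq_add_neg] using hf.add (hg.const_smul (-1))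

theorem TimeC11.cross {f g : ℝ → ι → Vec3} (hf : TimeC11 T A f) (hg : TimeC11 T A g) :
    TimeC11 T A (fun t x => cross (f t x) (g t x)) :=
  TimeC11.bilin zero_le_one
    (LinearMap.mk₂ ℝ LLG.cross (fun a b c => cross_add_left a b c) (fun r a b => cross_smul_left r a b)
      (fun a b c => cross_add_right a b c) (fun r a b => cross_smul_right r a b))
    (fun a b => by simpa using norm_cross_le a b) hf hg

theorem TimeC11.inner {f g : ℝ → ι → Vec3} (hf : TimeC11 T A f) (hg : TimeC11 T A g) :
    TimeC11 T A (fun t x => ⟪f t x, g t x⟫) :=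
  TimeC11.bilin zero_le_one (innerₗ Vec3) (fun a b => by simpa using abs_real_inner_le_norm a b) hf hg

theorem TimeC11.perp {f g : ℝ → ι → Vec3} (hf : TimeC11 T A f) (hg : TimeC11 T A g) :
    TimeC11 T A (fun t x => perp (f t x) (g t x)) :=
  hg.sub ((hf.inner hg).smul hf)

theorem TimeC11.lowerField (Q : ℝ) {f g : ℝ → ι → Vec3} (hf : TimeC11 T A f)
    (hg : TimeC11 T A g) : TimeC11 T A (fun t x => lowerField Q (f t x) (g t x)) := by
  obtain ⟨K, hK, H⟩ := hf
  obtain ⟨K', hK', H'⟩ := hg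
  refine ⟨|Q| * K + K', by positivity, fun x hx => ⟨fun t ht => ?_, fun t ht s hs => ?_,
    fun t σ h0 h1 h2 => ?_⟩⟩
  · refine (norm_lowerField_le _ _ _).trans ?_
    gcongr
    exacts [(H x hx).bound t ht, (H' x hx).bound t ht]
  · rw [lowerField_sub, add_mul, mul_assoc]
    refine (norm_lowerField_le _ _ _).trans ?_
    gcongr
    exacts [(H x hx).lip t ht s hs, (H' x hx).lip t ht s hs]
  · rw [lowerField_smul, lowerField_sub, lowerField_add, add_mul, mul_assoc]
    refine (norm_lowerField_le _ _ _).trans ?_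
    gcongr
    exacts [(H x hx).diff2 t σ h0 h1 h2, (H' x hx).diff2 t σ h0 h1 h2]

theorem norm_sub_le_of_hasDerivWithinAt {f f' : ℝ → F} {C : ℝ}
    (hf : ∀ t ∈ Icc 0 T, HasDerivWithinAt f (f' t) (Icc 0 T) t) (hC : ∀ t ∈ Icc 0 T, ‖f' t‖ ≤ C)
    {t s : ℝ} (ht : t ∈ Icc 0 T) (hs : s ∈ Icc 0 T) : ‖f t - f s‖ ≤ C * |t - s| := by
  simpa using (convex_Icc 0 T).norm_image_sub_le_of_norm_hasDerivWithin_le hf hC hs ht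

theorem hasDerivWithinAt_comp_add {f f' : ℝ → F}
    (hf : ∀ t ∈ Icc 0 T, HasDerivWithinAt f (f' t) (Icc 0 T) t) {t σ : ℝ}
    (h1 : t - σ ∈ Icc 0 T) (h2 : t + σ ∈ Icc 0 T) {s : ℝ} (hs : s ∈ Icc 0 σ) :
    HasDerivWithinAt (fun s => f (t + s)) (f' (t + s)) (Icc 0 σ) s ∧
      HasDerivWithinAt (fun s => f (t - s)) (-f' (t - s)) (Icc 0 σ) s := by
  have m1 : ∀ s ∈ Icc 0 σ, t + s ∈ Icc 0 T := fun s hs =>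
    ⟨by linarith [h1.1, hs.1, hs.2], by linarith [h2.2, hs.2]⟩
  have m2 : ∀ s ∈ Icc 0 σ, t - s ∈ Icc 0 T := fun s hs =>
    ⟨by linarith [h1.1, hs.2], by linarith [h2.2, hs.1, hs.2]⟩
  constructor
  · have := (hf _ (m1 s hs)).scomp s ((hasDerivWithinAt_id s (Icc 0 σ)).const_add t) m1
    simpa [Function.comp_def] using this
  · have := (hf _ (m2 s hs)).scomp s ((hasDerivWithinAt_id s (Icc 0 σ)).const_sub t) m2
    simpa [Function.comp_def] using this

theorem norm_diff2_le_of_hasDerivWithinAt {f f' : ℝ → F} {C : ℝ}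
    (hf : ∀ t ∈ Icc 0 T, HasDerivWithinAt f (f' t) (Icc 0 T) t)
    (hC : ∀ t ∈ Icc 0 T, ∀ s ∈ Icc 0 T, ‖f' t - f' s‖ ≤ C * |t - s|)
    (hC0 : 0 ≤ C) {t σ : ℝ} (h0 : 0 ≤ σ) (h1 : t - σ ∈ Icc 0 T) (h2 : t + σ ∈ Icc 0 T) :
    ‖f (t + σ) - (2 : ℝ) • f t + f (t - σ)‖ ≤ 2 * C * σ ^ 2 := by
  have H : ∀ s ∈ Icc 0 σ, HasDerivWithinAt (fun s => f (t + s) + f (t - s))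
      (f' (t + s) + -f' (t - s)) (Icc 0 σ) s := fun s hs =>
    (hasDerivWithinAt_comp_add hf h1 h2 hs).1.add (hasDerivWithinAt_comp_add hf h1 h2 hs).2
  have := norm_image_sub_le_of_norm_deriv_le_segment' (C := 2 * C * σ) H (fun s hs => by
    rw [← sub_eq_add_neg]
    refine (hC _ ⟨by linarith [h1.1, hs.1], by linarith [h2.2, hs.2]⟩ _
      ⟨by linarith [h1.1, hs.2], by linarith [h2.2, hs.1]⟩).trans ?_
    rw [show t + s - (t - s) = 2 * s by ring, abs_of_nonneg (by linarith [hs.1])]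
    nlinarith [hs.2]) σ ⟨h0, le_rfl⟩
  refine le_trans (le_of_eq ?_) (this.trans_eq (by ring))
  congr 1
  simp only [add_zero, sub_zero]; module

/-- As a function of σ, the left-hand expression has the second difference of f' as its derivative,
which is O(σ²). Only a difference quotient bound for f' enters. -/
theorem norm_central_diff_le {f f' : ℝ → F} {C : ℝ}
    (hf : ∀ t ∈ Icc 0 T, HasDerivWithinAt f (f' t) (Icc 0 T) t) (hf' : DiffBound T C f')
    (hC0 : 0 ≤ C) {t σ : ℝ} (h0 : 0 ≤ σ) (h1 : t - σ ∈ Icc 0 T) (h2 : t + σ ∈ Icc 0 T) :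
    ‖f (t + σ) - f (t - σ) - (2 * σ) • f' t‖ ≤ C * σ ^ 3 := by
  have H : ∀ s ∈ Icc 0 σ, HasDerivWithinAt (fun s => f (t + s) - f (t - s) - (2 * s) • f' t)
      (f' (t + s) - -f' (t - s) - (2 * (1 : ℝ)) • f' t) (Icc 0 σ) s := fun s hs =>
    ((hasDerivWithinAt_comp_add hf h1 h2 hs).1.sub (hasDerivWithinAt_comp_add hf h1 h2 hs).2).sub
      (((hasDerivWithinAt_id s _).const_mul 2).smul_const (f' t))
  have := norm_image_sub_le_of_norm_deriv_le_segment' (C := C * σ ^ 2) H (fun s hs => by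
    rw [show f' (t + s) - -f' (t - s) - (2 * (1 : ℝ)) • f' t
      = f' (t + s) - (2 : ℝ) • f' t + f' (t - s) by module]
    refine (hf'.diff2 t s hs.1 ⟨by linarith [h1.1, hs.2], by linarith [h2.2, h1.1, hs.1, h0]⟩
      ⟨by linarith [h1.1, hs.1], by linarith [h2.2, hs.2]⟩).trans ?_
    have := hs.1
    have := hs.2.le
    gcongr) σ ⟨h0, le_rfl⟩
  refine le_trans (le_of_eq ?_) (this.trans_eq (by ring))
  congr 1
  simp

theorem exists_diffBound_of_contDiffOn (hT : 0 < T) {U : ℝ → E} (hU : ContDiffOn ℝ 2 U (Icc 0 T)) :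
    ∃ K, 0 ≤ K ∧ DiffBound T K U := by
  have hu := uniqueDiffOn_Icc hT
  have hb : ∀ V : ℝ → E, ContinuousOn V (Icc 0 T) → ∃ C, 0 ≤ C ∧ ∀ t ∈ Icc 0 T, ‖V t‖ ≤ C := by
    intro V hV
    obtain ⟨C, hC⟩ := isCompact_Icc.exists_bound_of_continuousOn hV
    exact ⟨max C 0, le_max_right _ _, fun t ht => (hC t ht).trans (le_max_left _ _)⟩
  have hU1 : ContDiffOn ℝ 1 (derivWithin U (Icc 0 T)) (Icc 0 T) := hU.derivWithin hu (by norm_num)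
  have hU2 : ContDiffOn ℝ 0 (derivWithin (derivWithin U (Icc 0 T)) (Icc 0 T)) (Icc 0 T) :=
    hU1.derivWithin hu (by norm_num)
  obtain ⟨C0, h00, hC0⟩ := hb _ hU.continuousOn
  obtain ⟨C1, h10, hC1⟩ := hb _ hU1.continuousOn
  obtain ⟨C2, h20, hC2⟩ := hb _ hU2.continuousOn
  have d1 : ∀ t ∈ Icc 0 T, HasDerivWithinAt U (derivWithin U (Icc 0 T) t) (Icc 0 T) t :=
    fun t ht => (hU.differentiableOn (by norm_num) t ht).hasDerivWithinAt
  have d2 : ∀ t ∈ Icc 0 T, HasDerivWithinAt (derivWithin U (Icc 0 T))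
      (derivWithin (derivWithin U (Icc 0 T)) (Icc 0 T) t) (Icc 0 T) t :=
    fun t ht => (hU1.differentiableOn (by norm_num) t ht).hasDerivWithinAt
  refine ⟨C0 + C1 + 2 * C2, by positivity, fun t ht => ?_, fun t ht s hs => ?_,
    fun t σ h0 h1 h2 => ?_⟩
  · linarith [hC0 t ht]
  · refine (norm_sub_le_of_hasDerivWithinAt d1 hC1 ht hs).trans ?_
    gcongr
    linarith
  · refine (norm_diff2_le_of_hasDerivWithinAt d1
      (fun t ht s hs => norm_sub_le_of_hasDerivWithinAt d2 hC2 ht hs) h20 h0 h1 h2).trans ?_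
    gcongr
    linarith

end Time

section TimeRegular

variable {d : ℕ} {L : Fin d → ℝ} {T : ℝ} {f : ℝ → Space d → Vec3}

/-- The bounds are taken in the Banach space of continuous functions and evaluated afterwards, which
makes them uniform in x. -/
theorem TimeRegular.timeC11 (hT : 0 < T) (hf : TimeRegular L T 2 f) :
    TimeC11 T (closedBox L) f := by
  obtain ⟨U, hU, hUf⟩ := hf
  obtain ⟨K, hK, H⟩ := exists_diffBound_of_contDiffOn hT hU
  refine ⟨K, hK, fun x hx => ⟨fun t ht => ?_, fun t ht s hs => ?_, fun t σ h0 h1 h2 => ?_⟩⟩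
  · rw [← hUf t ht ⟨x, hx⟩]
    exact ((U t).norm_coe_le_norm _).trans (H.bound t ht)
  · rw [← hUf t ht ⟨x, hx⟩, ← hUf s hs ⟨x, hx⟩]
    exact ((U t - U s).norm_coe_le_norm ⟨x, hx⟩).trans (H.lip t ht s hs)
  · have ht := mem_Icc_of_sub_add h0 h1 h2
    rw [← hUf _ h1 ⟨x, hx⟩, ← hUf _ h2 ⟨x, hx⟩, ← hUf _ ht ⟨x, hx⟩]
    exact ((U (t + σ) - (2 : ℝ) • U t + U (t - σ)).norm_coe_le_norm ⟨x, hx⟩).trans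
      (H.diff2 t σ h0 h1 h2)

theorem TimeRegular.mono {r s : ℕ} (hrs : r ≤ s) (hf : TimeRegular L T s f) :
    TimeRegular L T r f := by
  obtain ⟨U, hU, hUf⟩ := hf
  exact ⟨U, hU.of_le (by exact_mod_cast hrs), hUf⟩

theorem TimeRegular.exists_deriv (hT : 0 < T) {r : ℕ} (hf : TimeRegular L T (r + 1) f) :
    ∃ f' : ℝ → Space d → Vec3, TimeRegular L T r f' ∧
      ∀ x ∈ closedBox L, ∀ t ∈ Icc 0 T,
        HasDerivWithinAt (fun s => f s x) (f' t x) (Icc 0 T) t := by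
  obtain ⟨U, hU, hUf⟩ := hf
  have hu := uniqueDiffOn_Icc hT
  classical
  refine ⟨fun t x => if hx : x ∈ closedBox L then derivWithin U (Icc 0 T) t ⟨x, hx⟩ else 0,
    ⟨derivWithin U (Icc 0 T), hU.derivWithin hu (by norm_cast), fun t ht x => by simp⟩, ?_⟩
  intro x hx t ht
  have h1 : HasDerivWithinAt U (derivWithin U (Icc 0 T) t) (Icc 0 T) t :=
    (hU.differentiableOn (by norm_cast) t ht).hasDerivWithinAt
  have h2 := (BoundedContinuousFunction.evalCLM ℝ (⟨x, hx⟩ : closedBox L)).hasFDerivAt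
    (x := U t) |>.comp_hasDerivWithinAt t h1
  simp only [hx, dite_true]
  exact h2.congr (fun s hs => (hUf s hs ⟨x, hx⟩).symm) (hUf t ht ⟨x, hx⟩).symm

theorem TimeRegular.continuousOn {r : ℕ} (hf : TimeRegular L T r f) {x : Space d}
    (hx : x ∈ closedBox L) : ContinuousOn (fun t => f t x) (Icc 0 T) := by
  obtain ⟨U, hU, hUf⟩ := hf
  have h := (BoundedContinuousFunction.evalCLM ℝ (⟨x, hx⟩ : closedBox L)
    : (closedBox L →ᵇ Vec3) →L[ℝ] Vec3).continuous.comp_continuousOn hU.continuousOn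
  exact h.congr fun s hs => (hUf s hs ⟨x, hx⟩).symm

end TimeRegular

end LLG

/-! ### Differentiation and Taylor expansion on the closed box. -/

namespace LLG

open scoped RealInnerProductSpace

section Box

variable {d : ℕ} {L : Fin d → ℝ} {F : Type*} [NormedAddCommGroup F] [NormedSpace ℝ F] {M : ℝ}
  {n : ℕ} {f : Space d → F}

theorem convex_closedBox (L : Fin d → ℝ) : Convex ℝ (closedBox L) := by
  intro x hx y hy a b ha hb hab i
  exact convex_Icc 0 (L i) (hx i) (hy i) ha hb hab

theorem isOpen_openBox (L : Fin d → ℝ) : IsOpen (openBox L) := by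
  have : openBox L = ⋂ i, (fun x : Space d => x i) ⁻¹' Ioo 0 (L i) := by
    ext x; simp [openBox]
  rw [this]
  exact isOpen_iInter_of_finite fun i => isOpen_Ioo.preimage (by fun_prop)

theorem openBox_subset_closedBox (L : Fin d → ℝ) : openBox L ⊆ closedBox L :=
  fun _ hx i => Ioo_subset_Icc_self (hx i)

theorem closedBox_mem_nhds {x : Space d} (hx : x ∈ openBox L) : closedBox L ∈ nhds x :=
  Filter.mem_of_superset ((isOpen_openBox L).mem_nhds hx) (openBox_subset_closedBox L)

theorem interior_closedBox_nonempty (hL : ∀ i, 0 < L i) : (interior (closedBox L)).Nonempty := by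
  refine ⟨WithLp.toLp 2 fun i => L i / 2, ?_⟩
  rw [mem_interior_iff_mem_nhds]
  refine closedBox_mem_nhds fun i => ⟨?_, ?_⟩
  · exact half_pos (hL i)
  · exact half_lt_self (hL i)

theorem uniqueDiffOn_closedBox (hL : ∀ i, 0 < L i) : UniqueDiffOn ℝ (closedBox L) :=
  uniqueDiffOn_convex (convex_closedBox L) (interior_closedBox_nonempty hL)

/-- `f` is `n` times continuously differentiable on the closed box, with derivatives bounded by
`M`. -/
structure BoundedCn (L : Fin d → ℝ) (n : ℕ) (M : ℝ) (f : Space d → F) : Prop where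
  contDiffOn : ContDiffOn ℝ n f (closedBox L)
  bound : ∀ j ≤ n, ∀ x ∈ closedBox L, ‖iteratedFDerivWithin ℝ j f (closedBox L) x‖ ≤ M

/-- The derivative of `f` in the direction `θ`, within the closed box. -/
noncomputable def dirDeriv (L : Fin d → ℝ) (θ : Space d) (f : Space d → F) (x : Space d) : F :=
  fderivWithin ℝ f (closedBox L) x θ

theorem BoundedCn.mono {m : ℕ} (hf : BoundedCn L n M f) (hm : m ≤ n) : BoundedCn L m M f :=
  ⟨hf.contDiffOn.of_le (by exact_mod_cast hm), fun j hj => hf.bound j (hj.trans hm)⟩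

theorem BoundedCn.norm_le (hf : BoundedCn L n M f) {x : Space d} (hx : x ∈ closedBox L) :
    ‖f x‖ ≤ M := by
  simpa using hf.bound 0 (Nat.zero_le _) x hx

theorem BoundedCn.nonneg (hL : ∀ i, 0 < L i) (hf : BoundedCn L n M f) : 0 ≤ M := by
  obtain ⟨x, hx⟩ := interior_closedBox_nonempty hL
  exact (norm_nonneg _).trans (hf.norm_le (interior_subset hx))

theorem BoundedCn.differentiableOn (hf : BoundedCn L (n + 1) M f) :
    DifferentiableOn ℝ f (closedBox L) :=
  hf.contDiffOn.differentiableOn (by norm_cast)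

theorem dirDeriv_smul (r : ℝ) (θ : Space d) (f : Space d → F) :
    dirDeriv L (r • θ) f = r • dirDeriv L θ f := by
  ext1 x; simp [dirDeriv]

theorem dirDeriv_congr {g : Space d → F} (hfg : EqOn f g (closedBox L)) (θ : Space d) :
    EqOn (dirDeriv L θ f) (dirDeriv L θ g) (closedBox L) := by
  intro x hx
  rw [dirDeriv, dirDeriv, fderivWithin_congr hfg (hfg hx)]

theorem dirDeriv_const_smul (hL : ∀ i, 0 < L i) (r : ℝ) (θ : Space d) (f : Space d → F) :
    EqOn (dirDeriv L θ (r • f)) (r • dirDeriv L θ f) (closedBox L) := by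
  intro x hx
  simp [dirDeriv, fderivWithin_const_smul_field, (uniqueDiffOn_closedBox hL) x hx]

theorem BoundedCn.dirDeriv (hL : ∀ i, 0 < L i) (hf : BoundedCn L (n + 1) M f) {θ : Space d}
    (hθ : ‖θ‖ ≤ 1) : BoundedCn L n M (dirDeriv L θ f) := by
  have hu := uniqueDiffOn_closedBox hL
  have h1 : ContDiffOn ℝ n (fderivWithin ℝ f (closedBox L)) (closedBox L) :=
    hf.contDiffOn.fderivWithin hu (by norm_cast)
  have e : LLG.dirDeriv L θ f
      = ContinuousLinearMap.apply ℝ F θ ∘ fderivWithin ℝ f (closedBox L) := rfl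
  refine ⟨?_, fun j hj x hx => ?_⟩
  · rw [e]; exact (ContinuousLinearMap.contDiff _).comp_contDiffOn h1
  · rw [e]
    refine ((ContinuousLinearMap.apply ℝ F θ).norm_iteratedFDerivWithin_comp_left
      (h1 x hx) hu hx (by exact_mod_cast hj)).trans ?_
    rw [norm_iteratedFDerivWithin_fderivWithin hu hx]
    have a1 : ‖ContinuousLinearMap.apply ℝ F θ‖ ≤ 1 :=
      ContinuousLinearMap.opNorm_le_bound _ zero_le_one fun A => by
        rw [one_mul]
        exact (A.le_opNorm θ).trans (mul_le_of_le_one_right (norm_nonneg _) hθ)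
    exact (mul_le_of_le_one_left (norm_nonneg _) a1).trans (hf.bound (j + 1) (by omega) x hx)

theorem dirDeriv_dirDeriv (hL : ∀ i, 0 < L i) (hf : BoundedCn L 2 M f) (a b : Space d)
    {x : Space d} (hx : x ∈ closedBox L) : dirDeriv L a (dirDeriv L b f) x
      = fderivWithin ℝ (fderivWithin ℝ f (closedBox L)) (closedBox L) x a b := by
  have hu := uniqueDiffOn_closedBox hL
  have h1 : DifferentiableWithinAt ℝ (fderivWithin ℝ f (closedBox L)) (closedBox L) x :=
    (hf.contDiffOn.fderivWithin hu (m := 1) (by norm_num)).differentiableOn (by norm_num) x hx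
  have := ((ContinuousLinearMap.apply ℝ F b).hasFDerivAt.comp_hasFDerivWithinAt x
    h1.hasFDerivWithinAt).fderivWithin (hu x hx)
  exact congrArg (fun A => A a) this

/-- Symmetry persists up to the boundary because the box is the closure of its interior. -/
theorem dirDeriv_comm (hL : ∀ i, 0 < L i) (hf : BoundedCn L 2 M f) (a b : Space d) {x : Space d}
    (hx : x ∈ closedBox L) :
    dirDeriv L a (dirDeriv L b f) x = dirDeriv L b (dirDeriv L a f) x := by
  have hc : x ∈ closure (interior (closedBox L)) := by
    rw [(convex_closedBox L).closure_interior_eq_closure_of_nonempty_interior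
      (interior_closedBox_nonempty hL)]
    exact subset_closure hx
  rw [dirDeriv_dirDeriv hL hf a b hx, dirDeriv_dirDeriv hL hf b a hx]
  exact (hf.contDiffOn x hx).isSymmSndFDerivWithinAt (by simp) (uniqueDiffOn_closedBox hL) hc hx a b

/-- The sum of the second derivatives of `f` in the coordinate directions. -/
noncomputable def boxLaplacian (L : Fin d → ℝ) (f : Space d → F) (x : Space d) : F :=
  ∑ i, dirDeriv L (EuclideanSpace.single i 1) (dirDeriv L (EuclideanSpace.single i (1 : ℝ)) f) x

open scoped Laplacian in
theorem laplacian_eq_boxLaplacian (hL : ∀ i, 0 < L i) (hf : BoundedCn L 2 M f) {x : Space d}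
    (hx : x ∈ openBox L) : Δ f x = boxLaplacian L f x := by
  have hB := closedBox_mem_nhds hx
  rw [InnerProductSpace.laplacian_eq_iteratedFDeriv_orthonormalBasis f
    (EuclideanSpace.basisFun (Fin d) ℝ), boxLaplacian]
  refine Finset.sum_congr rfl fun i _ => ?_
  rw [dirDeriv_dirDeriv hL hf _ _ (mem_of_mem_nhds hB), ← iteratedFDerivWithin_univ,
    iteratedFDerivWithin_congr_set (t := closedBox L)
      (Filter.eventuallyEq_set.2 (by filter_upwards [hB] with y hy using by simp [hy])),
    iteratedFDerivWithin_two_apply f (uniqueDiffOn_closedBox hL) (mem_of_mem_nhds hB)]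
  simp

theorem line_mem_closedBox {x θ : Space d} {ℓ s : ℝ} (hx : x ∈ closedBox L)
    (hx' : x + ℓ • θ ∈ closedBox L) (hs : s ∈ Icc 0 ℓ) : x + s • θ ∈ closedBox L := by
  rcases hs.1.eq_or_lt with rfl | h0
  · simpa using hx
  have hℓ : 0 < ℓ := h0.trans_le hs.2
  have := (convex_closedBox L) hx hx' (a := 1 - s / ℓ) (b := s / ℓ)
    (by rw [sub_nonneg, div_le_one hℓ]; exact hs.2) (by positivity) (by ring)
  convert this using 1
  rw [smul_add, smul_smul, div_mul_cancel₀ _ hℓ.ne', ← add_assoc, ← add_smul]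
  simp

theorem hasDerivWithinAt_line (hf : DifferentiableOn ℝ f (closedBox L)) {x θ : Space d} {ℓ s : ℝ}
    (hx : x ∈ closedBox L) (hx' : x + ℓ • θ ∈ closedBox L) (hs : s ∈ Icc 0 ℓ) :
    HasDerivWithinAt (fun s => f (x + s • θ)) (dirDeriv L θ f (x + s • θ)) (Icc 0 ℓ) s := by
  have h1 := (hf _ (line_mem_closedBox hx hx' hs)).hasFDerivWithinAt
  have h2 : HasDerivWithinAt (fun s : ℝ => x + s • θ) ((1 : ℝ) • θ) (Icc 0 ℓ) s :=
    ((hasDerivWithinAt_id s _).smul_const θ).const_add x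
  rw [one_smul] at h2
  exact h1.comp_hasDerivWithinAt s h2 fun r hr => line_mem_closedBox hx hx' hr

theorem dirDeriv_eq_of_hasLineDerivWithinAt (hf : DifferentiableOn ℝ f (closedBox L))
    {x θ : Space d} {ℓ : ℝ} (hℓ : 0 < ℓ) (hx : x ∈ closedBox L) (hx' : x + ℓ • θ ∈ closedBox L)
    {c : F} (h : HasLineDerivWithinAt ℝ f c (closedBox L) x θ) : dirDeriv L θ f x = c := by
  have h0 : (0 : ℝ) ∈ Icc 0 ℓ := ⟨le_rfl, hℓ.le⟩
  have h1 := hasDerivWithinAt_line hf hx hx' h0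
  rw [zero_smul, add_zero] at h1
  have h2 : HasDerivWithinAt (fun s => f (x + s • θ)) c (Icc 0 ℓ) 0 :=
    HasDerivWithinAt.mono h fun s hs => line_mem_closedBox hx hx' hs
  exact (uniqueDiffOn_Icc hℓ 0 h0).eq_deriv _ h1 h2

/-- Taylor's formula along a line in the box. -/
theorem BoundedCn.taylor (hL : ∀ i, 0 < L i) {x θ : Space d} {ℓ : ℝ} (hθ : ‖θ‖ ≤ 1)
    (hx : x ∈ closedBox L) (hx' : x + ℓ • θ ∈ closedBox L) (hf : BoundedCn L n M f) {s : ℝ}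
    (hs : s ∈ Icc 0 ℓ) :
    ‖f (x + s • θ) - ∑ j ∈ Finset.range n, (s ^ j / j.factorial) • (LLG.dirDeriv L θ)^[j] f x‖
      ≤ M * ℓ ^ n := by
  have hℓ : 0 ≤ ℓ := hs.1.trans hs.2
  induction n generalizing f s with
  | zero => simpa using hf.norm_le (line_mem_closedBox hx hx' hs)
  | succ n ih =>
    have hM := hf.nonneg hL
    set g := LLG.dirDeriv L θ f with hg
    have hsum : ∀ s : ℝ, HasDerivAt
        (fun s : ℝ => ∑ j ∈ Finset.range (n + 1), (s ^ j / j.factorial) • (LLG.dirDeriv L θ)^[j] f x)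
        (∑ j ∈ Finset.range n, (s ^ j / j.factorial) • (LLG.dirDeriv L θ)^[j] g x) s := by
      intro s
      simp only [Finset.sum_range_succ' _ n, Function.iterate_succ_apply, ← hg]
      simp only [pow_zero, Nat.factorial_zero, Nat.cast_one, div_one, one_smul]
      refine HasDerivAt.add_const _ ?_
      refine HasDerivAt.fun_sum fun j _ => ?_
      refine HasDerivAt.smul_const ?_ _
      have := (hasDerivAt_pow (j + 1) s).div_const ((j + 1).factorial : ℝ)
      refine this.congr_deriv ?_
      rw [Nat.factorial_succ]
      push_cast
      have : (j.factorial : ℝ) ≠ 0 := by positivity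
      field_simp
    have H : ∀ s ∈ Icc 0 ℓ, HasDerivWithinAt (fun s : ℝ => f (x + s • θ)
        - ∑ j ∈ Finset.range (n + 1), (s ^ j / j.factorial) • (LLG.dirDeriv L θ)^[j] f x)
        (g (x + s • θ) - ∑ j ∈ Finset.range n, (s ^ j / j.factorial) • (LLG.dirDeriv L θ)^[j] g x)
        (Icc 0 ℓ) s := fun s hs =>
      (hasDerivWithinAt_line hf.differentiableOn hx hx' hs).sub (hsum s).hasDerivWithinAt
    have := norm_image_sub_le_of_norm_deriv_le_segment' H
      (fun s hs => ih (hf.dirDeriv hL hθ) ⟨hs.1, hs.2.le⟩) s hs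
    have e0 : f (x + (0 : ℝ) • θ) - ∑ j ∈ Finset.range (n + 1),
        ((0 : ℝ) ^ j / j.factorial) • (LLG.dirDeriv L θ)^[j] f x = 0 := by
      simp [Finset.sum_range_succ']
    rw [e0, sub_zero, sub_zero] at this
    refine this.trans ?_
    rw [pow_succ, ← mul_assoc]
    gcongr
    exact hs.2

/-- Consistency of the second difference quotient. -/
theorem BoundedCn.norm_diff2_sub_le (hL : ∀ i, 0 < L i) {x θ : Space d} {h : ℝ} (hθ : ‖θ‖ ≤ 1)
    (hh : 0 ≤ h) (hx : x + (-h) • θ ∈ closedBox L) (hx' : x + h • θ ∈ closedBox L)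
    (hf : BoundedCn L 4 M f) :
    ‖f (x + h • θ) - f x + (f (x + (-h) • θ) - f x)
      - h ^ 2 • LLG.dirDeriv L θ (LLG.dirDeriv L θ f) x‖ ≤ 52 * M * h ^ 4 := by
  -- The Taylor estimate runs in one direction only, so everything is expanded at the lower end
  -- point.
  set y := x + (-h) • θ with hy
  have e1 : x = y + h • θ := by rw [hy]; module
  have e2 : x + h • θ = y + (2 * h) • θ := by rw [hy]; module
  rw [e2] at hx' ⊢
  rw [e1]
  have m1 : h ∈ Icc 0 (2 * h) := ⟨hh, by linarith⟩
  have m2 : 2 * h ∈ Icc 0 (2 * h) := ⟨by linarith, le_rfl⟩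
  have t1 := hf.taylor hL hθ hx hx' m1
  have t2 := hf.taylor hL hθ hx hx' m2
  have t3 := ((hf.dirDeriv hL hθ).dirDeriv hL hθ).taylor hL hθ hx hx' m1
  simp only [Finset.sum_range_succ, Finset.range_zero, Finset.sum_empty, Function.iterate_succ,
    Function.iterate_zero, Function.comp_apply, id_eq, Nat.factorial] at t1 t2 t3
  norm_num at t1 t2 t3
  set a0 := f y
  set a1 := LLG.dirDeriv L θ f y
  set a2 := LLG.dirDeriv L θ (LLG.dirDeriv L θ f) y
  set a3 := LLG.dirDeriv L θ (LLG.dirDeriv L θ (LLG.dirDeriv L θ f)) y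
  set r1 := f (y + h • θ)
  set r2 := f (y + (2 * h) • θ)
  set r3 := LLG.dirDeriv L θ (LLG.dirDeriv L θ f) (y + h • θ)
  have e : r2 - r1 + (a0 - r1) - h ^ 2 • r3
      = (r2 - (a0 + (2 * h) • a1 + ((2 * h) ^ 2 / 2) • a2 + ((2 * h) ^ 3 / 6) • a3))
        - (2 : ℝ) • (r1 - (a0 + h • a1 + (h ^ 2 / 2) • a2 + (h ^ 3 / 6) • a3))
        - h ^ 2 • (r3 - (a2 + h • a3)) := by
    module
  rw [e]
  refine (norm_sub_le _ _).trans ((add_le_add_left (norm_sub_le _ _) _).trans ?_)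
  rw [norm_smul, norm_smul, Real.norm_eq_abs, Real.norm_eq_abs, abs_two, abs_of_nonneg (sq_nonneg h)]
  have : h ^ 2 * ‖r3 - (a2 + h • a3)‖ ≤ h ^ 2 * (M * (2 * h) ^ 2) := by gcongr
  linarith

/-- Consistency of the second difference quotient at the boundary, with a ghost value. -/
theorem BoundedCn.norm_diff_wall_sub_le (hL : ∀ i, 0 < L i) {x θ : Space d} {h : ℝ} (hθ : ‖θ‖ ≤ 1)
    (hh : 0 ≤ h) (hx : x + (-(h / 2)) • θ ∈ closedBox L) (hx' : x + h • θ ∈ closedBox L)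
    (hf : BoundedCn L 4 M f) (h0 : LLG.dirDeriv L θ f (x + (-(h / 2)) • θ) = 0) :
    ‖f (x + h • θ) - f x - h ^ 2 • LLG.dirDeriv L θ (LLG.dirDeriv L θ f) x
      - (h ^ 2 / 24) • (LLG.dirDeriv L θ (LLG.dirDeriv L θ f) (x + h • θ)
        - LLG.dirDeriv L θ (LLG.dirDeriv L θ f) x)‖ ≤ 52 * M * h ^ 4 := by
  set y := x + (-(h / 2)) • θ with hy
  have e1 : x = y + (h / 2) • θ := by rw [hy]; module
  have e2 : x + h • θ = y + (3 / 2 * h) • θ := by rw [hy]; module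
  rw [e2] at hx' ⊢
  rw [e1]
  have m1 : h / 2 ∈ Icc 0 (3 / 2 * h) := ⟨by linarith, by linarith⟩
  have m2 : 3 / 2 * h ∈ Icc 0 (3 / 2 * h) := ⟨by linarith, le_rfl⟩
  have t1 := hf.taylor hL hθ hx hx' m1
  have t2 := hf.taylor hL hθ hx hx' m2
  have t3 := ((hf.dirDeriv hL hθ).dirDeriv hL hθ).taylor hL hθ hx hx' m1
  have t4 := ((hf.dirDeriv hL hθ).dirDeriv hL hθ).taylor hL hθ hx hx' m2
  simp only [Finset.sum_range_succ, Finset.range_zero, Finset.sum_empty, Function.iterate_succ,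
    Function.iterate_zero, Function.comp_apply, id_eq, Nat.factorial] at t1 t2 t3 t4
  norm_num at t1 t2 t3 t4
  have hM := hf.nonneg hL
  rw [h0] at t1 t2
  set a0 := f y
  set a2 := LLG.dirDeriv L θ (LLG.dirDeriv L θ f) y
  set a3 := LLG.dirDeriv L θ (LLG.dirDeriv L θ (LLG.dirDeriv L θ f)) y
  set r1 := f (y + (h / 2) • θ)
  set r2 := f (y + (3 / 2 * h) • θ)
  set r3 := LLG.dirDeriv L θ (LLG.dirDeriv L θ f) (y + (h / 2) • θ)
  set r4 := LLG.dirDeriv L θ (LLG.dirDeriv L θ f) (y + (3 / 2 * h) • θ)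
  rw [smul_zero, add_zero] at t1 t2
  -- Expansion at the wall, where the first derivative vanishes. The quadratic terms cancel and the
  -- cubic ones leave h³/24 times the third derivative, which is exactly what the 1/24 difference of
  -- second derivatives supplies.
  have e : r2 - r1 - h ^ 2 • r3 - (h ^ 2 / 24) • (r4 - r3)
      = (r2 - (a0 + ((3 / 2 * h) ^ 2 / 2) • a2 + ((3 / 2 * h) ^ 3 / 6) • a3))
        - (r1 - (a0 + ((h / 2) ^ 2 / 2) • a2 + ((h / 2) ^ 3 / 6) • a3))
        - (23 / 24 * h ^ 2) • (r3 - (a2 + (h / 2) • a3))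
        - (h ^ 2 / 24) • (r4 - (a2 + (3 / 2 * h) • a3)) := by
    module
  rw [e]
  refine (norm_sub_le _ _).trans ((add_le_add_left ((norm_sub_le _ _).trans
    (add_le_add_left (norm_sub_le _ _) _)) _).trans ?_)
  rw [norm_smul, norm_smul, Real.norm_eq_abs, Real.norm_eq_abs, abs_of_nonneg (by positivity),
    abs_of_nonneg (by positivity)]
  have q3 : 23 / 24 * h ^ 2 * ‖r3 - (a2 + (h / 2) • a3)‖
      ≤ 23 / 24 * h ^ 2 * (M * (3 / 2 * h) ^ 2) := by gcongr
  have q4 : h ^ 2 / 24 * ‖r4 - (a2 + (3 / 2 * h) • a3)‖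
      ≤ h ^ 2 / 24 * (M * (3 / 2 * h) ^ 2) := by gcongr
  have : 0 ≤ M * h ^ 4 := by positivity
  linarith

theorem BoundedCn.norm_diff2_le (hL : ∀ i, 0 < L i) {x θ : Space d} {h : ℝ} (hθ : ‖θ‖ ≤ 1)
    (hh : 0 ≤ h) (hx : x + (-h) • θ ∈ closedBox L) (hx' : x + h • θ ∈ closedBox L)
    (hf : BoundedCn L 2 M f) :
    ‖f (x + h • θ) - f x + (f (x + (-h) • θ) - f x)‖ ≤ 12 * M * h ^ 2 := by
  set y := x + (-h) • θ with hy
  have e1 : x = y + h • θ := by rw [hy]; module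
  have e2 : x + h • θ = y + (2 * h) • θ := by rw [hy]; module
  rw [e2] at hx' ⊢
  rw [e1]
  have m1 : h ∈ Icc 0 (2 * h) := ⟨hh, by linarith⟩
  have m2 : 2 * h ∈ Icc 0 (2 * h) := ⟨by linarith, le_rfl⟩
  have t1 := hf.taylor hL hθ hx hx' m1
  have t2 := hf.taylor hL hθ hx hx' m2
  simp only [Finset.sum_range_succ, Finset.range_zero, Finset.sum_empty, Function.iterate_succ,
    Function.iterate_zero, Function.comp_apply, id_eq, Nat.factorial] at t1 t2
  norm_num at t1 t2
  set a0 := f y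
  set a1 := LLG.dirDeriv L θ f y
  set r1 := f (y + h • θ)
  set r2 := f (y + (2 * h) • θ)
  have e : r2 - r1 + (a0 - r1)
      = (r2 - (a0 + (2 * h) • a1)) - (2 : ℝ) • (r1 - (a0 + h • a1)) := by module
  rw [e]
  refine (norm_sub_le _ _).trans ?_
  rw [norm_smul, Real.norm_eq_abs, abs_two]
  linarith

theorem BoundedCn.norm_diff_wall_le (hL : ∀ i, 0 < L i) {x θ : Space d} {h : ℝ} (hθ : ‖θ‖ ≤ 1)
    (hh : 0 ≤ h) (hx : x + (-(h / 2)) • θ ∈ closedBox L) (hx' : x + h • θ ∈ closedBox L)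
    (hf : BoundedCn L 2 M f) (h0 : LLG.dirDeriv L θ f (x + (-(h / 2)) • θ) = 0) :
    ‖f (x + h • θ) - f x‖ ≤ 12 * M * h ^ 2 := by
  set y := x + (-(h / 2)) • θ with hy
  have e1 : x = y + (h / 2) • θ := by rw [hy]; module
  have e2 : x + h • θ = y + (3 / 2 * h) • θ := by rw [hy]; module
  rw [e2] at hx' ⊢
  rw [e1]
  have m1 : h / 2 ∈ Icc 0 (3 / 2 * h) := ⟨by linarith, by linarith⟩
  have m2 : 3 / 2 * h ∈ Icc 0 (3 / 2 * h) := ⟨by linarith, le_rfl⟩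
  have t1 := hf.taylor hL hθ hx hx' m1
  have t2 := hf.taylor hL hθ hx hx' m2
  simp only [Finset.sum_range_succ, Finset.range_zero, Finset.sum_empty, Function.iterate_succ,
    Function.iterate_zero, Function.comp_apply, id_eq, Nat.factorial] at t1 t2
  norm_num at t1 t2
  have hM := hf.nonneg hL
  rw [h0, smul_zero, add_zero] at t1 t2
  have := norm_sub_le (f (y + (3 / 2 * h) • θ) - f y) (f (y + (h / 2) • θ) - f y)
  rw [sub_sub_sub_cancel_right] at this
  have : 0 ≤ M * h ^ 2 := by positivity
  linarith

theorem BoundedCn.norm_diff_le (hL : ∀ i, 0 < L i) {x θ : Space d} {h : ℝ} (hθ : ‖θ‖ ≤ 1)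
    (hh : 0 ≤ h) (hx : x ∈ closedBox L) (hx' : x + h • θ ∈ closedBox L)
    (hf : BoundedCn L 1 M f) : ‖f (x + h • θ) - f x‖ ≤ M * h := by
  have := hf.taylor hL hθ hx hx' (s := h) ⟨hh, le_rfl⟩
  simpa using this

/-- Difference quotients at two different scales are close to each other. -/
theorem BoundedCn.norm_diff_scale_le (hL : ∀ i, 0 < L i) {x θ : Space d} {h l : ℝ} (hθ : ‖θ‖ ≤ 1)
    (hh : 0 < h) (hl : h ≤ l) (hx : x ∈ closedBox L) (hx' : x + l • θ ∈ closedBox L)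
    (hf : BoundedCn L 2 M f) :
    ‖f (x + l • θ) - f x - (l / h) • (f (x + h • θ) - f x)‖ ≤ 2 * M * l ^ 2 := by
  have hl0 : 0 < l := hh.trans_le hl
  have hM := hf.nonneg hL
  have t1 := hf.taylor hL hθ hx (line_mem_closedBox hx hx' ⟨hh.le, hl⟩) (s := h) ⟨hh.le, le_rfl⟩
  have t2 := hf.taylor hL hθ hx hx' (s := l) ⟨hl0.le, le_rfl⟩
  simp only [Finset.sum_range_succ, Finset.range_zero, Finset.sum_empty, Function.iterate_succ,
    Function.iterate_zero, Function.comp_apply, id_eq, Nat.factorial] at t1 t2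
  norm_num at t1 t2
  set a1 := LLG.dirDeriv L θ f x
  have e : f (x + l • θ) - f x - (l / h) • (f (x + h • θ) - f x)
      = (f (x + l • θ) - (f x + l • a1)) - (l / h) • (f (x + h • θ) - (f x + h • a1)) := by
    have : l • a1 = (l / h) • h • a1 := by rw [smul_smul, div_mul_cancel₀ _ hh.ne']
    rw [this]; module
  rw [e]
  refine (norm_sub_le _ _).trans ?_
  rw [norm_smul, Real.norm_eq_abs, abs_of_pos (by positivity)]
  have : l / h * ‖f (x + h • θ) - (f x + h • a1)‖ ≤ M * l ^ 2 := by
    calc _ ≤ l / h * (M * h ^ 2) := by gcongr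
      _ = M * (l * h) := by field_simp
      _ ≤ M * (l * l) := by gcongr
      _ = _ := by ring
  linarith

end Box

end LLG

/-! ### Boundary cells and consistency of the discrete Laplacian. -/

namespace LLG

open scoped RealInnerProductSpace

section Wall

variable {d : ℕ} {L : Fin d → ℝ} {F : Type*} [NormedAddCommGroup F] [NormedSpace ℝ F] {M : ℝ}
  {f : Space d → F}

/-- The unit vector in the coordinate direction `i`. -/
noncomputable abbrev axis (i : Fin d) : Space d := EuclideanSpace.single i (1 : ℝ)

/-- The normal derivative of `f` vanishes on the faces of the box. -/
def HasNeumann (L : Fin d → ℝ) (f : Space d → F) : Prop :=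
  ∀ x ∈ closedBox L, ∀ i, (x i = 0 ∨ x i = L i) →
    HasLineDerivWithinAt ℝ f 0 (closedBox L) x (axis i)

theorem norm_smul_axis_le {σ : ℝ} (hσ : σ = 1 ∨ σ = -1) (i : Fin d) : ‖σ • axis i‖ ≤ 1 := by
  rcases hσ with rfl | rfl <;> simp

/-- A one-sided derivative is unique only along a segment of positive length inside the box; at
every point one of the two orientations of an axis provides one. -/
theorem exists_inward (hL : ∀ i, 0 < L i) {y : Space d} (hy : y ∈ closedBox L) (j : Fin d) :
    ∃ σ ℓ : ℝ, (σ = 1 ∨ σ = -1) ∧ 0 < ℓ ∧ y + ℓ • σ • axis j ∈ closedBox L := by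
  have key : ∀ r : ℝ, y j + r ∈ Icc 0 (L j) → y + r • axis j ∈ closedBox L := by
    intro r hr i
    by_cases hij : i = j
    · subst hij; simpa using hr
    · simpa [hij] using hy i
  rcases (hy j).2.lt_or_eq with h | h
  · refine ⟨1, L j - y j, Or.inl rfl, sub_pos.2 h, ?_⟩
    rw [one_smul]
    exact key _ ⟨by linarith [(hy j).1, hL j], by linarith⟩
  · refine ⟨-1, L j, Or.inr rfl, hL j, ?_⟩
    rw [smul_smul]
    exact key _ ⟨by linarith, by linarith [hL j]⟩

theorem dirDeriv_axis_eq_zero {σ : ℝ} (hσ : σ = 1 ∨ σ = -1) {θ : Space d} {x : Space d}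
    (h : dirDeriv L (σ • θ) f x = 0) : dirDeriv L θ f x = 0 := by
  rw [dirDeriv_smul, Pi.smul_apply, smul_eq_zero] at h
  rcases h with h | h
  · rcases hσ with rfl | rfl <;> norm_num at h
  · exact h

theorem HasNeumann.dirDeriv_eq_zero (hL : ∀ i, 0 < L i) (hn : HasNeumann L f)
    (hf : DifferentiableOn ℝ f (closedBox L)) {y : Space d} (hy : y ∈ closedBox L) {i : Fin d}
    (hi : y i = 0 ∨ y i = L i) : dirDeriv L (axis i) f y = 0 := by
  obtain ⟨σ, ℓ, hσ, hℓ, hm⟩ := exists_inward hL hy i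
  refine dirDeriv_axis_eq_zero hσ (dirDeriv_eq_of_hasLineDerivWithinAt hf hℓ hy hm ?_)
  simpa using (hn y hy i hi).smul σ

/-- The tangential derivatives of a function that vanishes on a face vanish there. -/
theorem dirDeriv_eq_zero_of_wall (hL : ∀ i, 0 < L i) (hf : DifferentiableOn ℝ f (closedBox L))
    {i j : Fin d} (hij : j ≠ i) {c : ℝ} (h0 : ∀ y ∈ closedBox L, y i = c → f y = 0) {y : Space d}
    (hy : y ∈ closedBox L) (hc : y i = c) : dirDeriv L (axis j) f y = 0 := by
  obtain ⟨σ, ℓ, hσ, hℓ, hm⟩ := exists_inward hL hy j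
  refine dirDeriv_axis_eq_zero hσ ?_
  have hz : (0 : ℝ) ∈ Icc 0 ℓ := ⟨le_rfl, hℓ.le⟩
  have h1 := hasDerivWithinAt_line hf hy hm hz
  rw [zero_smul, add_zero] at h1
  have e : ∀ s ∈ Icc 0 ℓ, f (y + s • σ • axis j) = 0 := fun s hs =>
    h0 _ (line_mem_closedBox hy hm hs) (by simp [hij.symm, hc])
  have h2 : HasDerivWithinAt (fun s => f (y + s • σ • axis j)) 0 (Icc 0 ℓ) 0 :=
    (hasDerivWithinAt_const 0 (Icc 0 ℓ) (0 : F)).congr e (e 0 hz)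
  exact (uniqueDiffOn_Icc hℓ 0 hz).eq_deriv _ h1 h2

/-- Commuting derivatives puts the normal one innermost; it vanishes on the whole face, hence so do
its tangential derivatives. The tangential second derivatives thus satisfy the Neumann condition as
well. -/
theorem HasNeumann.dirDeriv_tangential_eq_zero (hL : ∀ i, 0 < L i) (hn : HasNeumann L f)
    (hf : BoundedCn L 3 M f) {i j : Fin d} (hij : j ≠ i) {y : Space d} (hy : y ∈ closedBox L)
    (hi : y i = 0 ∨ y i = L i) :
    dirDeriv L (axis i) (dirDeriv L (axis j) (dirDeriv L (axis j) f)) y = 0 := by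
  have hθ : ∀ i : Fin d, ‖axis i‖ ≤ 1 := fun i => by simp
  have f1 := hf.dirDeriv hL (hθ i)
  have f2 := f1.dirDeriv hL (hθ j)
  rw [dirDeriv_comm hL (hf.dirDeriv hL (hθ j)) _ _ hy]
  have e1 : EqOn (dirDeriv L (axis i) (dirDeriv L (axis j) f))
      (dirDeriv L (axis j) (dirDeriv L (axis i) f)) (closedBox L) :=
    fun z hz => dirDeriv_comm hL (hf.mono (by norm_num)) _ _ hz
  rw [dirDeriv_congr e1 _ hy]
  have key : ∀ z ∈ closedBox L, z i = y i → dirDeriv L (axis i) f z = 0 := fun z hz hzi =>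
    hn.dirDeriv_eq_zero hL hf.differentiableOn hz (by rw [hzi]; exact hi)
  exact dirDeriv_eq_zero_of_wall hL f2.differentiableOn hij
    (fun z hz hzi => dirDeriv_eq_zero_of_wall hL f1.differentiableOn hij key hz hzi) hy rfl

theorem dirDeriv_dirDeriv_sign (hL : ∀ i, 0 < L i) {σ : ℝ} (hσ : σ = 1 ∨ σ = -1) (θ : Space d)
    {x : Space d} (hx : x ∈ closedBox L) :
    dirDeriv L (σ • θ) (dirDeriv L (σ • θ) f) x = dirDeriv L θ (dirDeriv L θ f) x := by
  rw [dirDeriv_smul, dirDeriv_smul, Pi.smul_apply, dirDeriv_const_smul hL _ _ _ hx, Pi.smul_apply,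
    smul_smul]
  rcases hσ with rfl | rfl <;> simp

/-- Consistency of the difference quotients in direction `i` in a cell next to the face, with the
ghost value given by the discrete Neumann condition. -/
theorem norm_wall_consistency_le (hL : ∀ i, 0 < L i) (hn : HasNeumann L f)
    (hf : BoundedCn L 4 M f) {i : Fin d} {σ : ℝ} (hσ : σ = 1 ∨ σ = -1) {x : Space d} {h : ℝ}
    (hh : 0 ≤ h) (hx : x + (-(h / 2)) • σ • axis i ∈ closedBox L)
    (hx' : x + h • σ • axis i ∈ closedBox L)
    (hi : (x + (-(h / 2)) • σ • axis i) i = 0 ∨ (x + (-(h / 2)) • σ • axis i) i = L i) :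
    ‖f (x + h • σ • axis i) - f x - h ^ 2 • dirDeriv L (axis i) (dirDeriv L (axis i) f) x
      - (h ^ 2 / 24) • (boxLaplacian L f (x + h • σ • axis i) - boxLaplacian L f x)‖
      ≤ (52 + d) * M * h ^ 4 := by
  have hM := hf.nonneg hL
  have hθ : ∀ i : Fin d, ‖axis i‖ ≤ 1 := fun i => by simp
  have hxB : x ∈ closedBox L := by
    have e1 : x = (x + (-(h / 2)) • σ • axis i) + (h / 2) • σ • axis i := by module
    have e2 : x + h • σ • axis i
      = (x + (-(h / 2)) • σ • axis i) + (3 / 2 * h) • σ • axis i := by module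
    rw [e1]
    exact line_mem_closedBox hx (ℓ := 3 / 2 * h) (e2 ▸ hx') ⟨by linarith, by linarith⟩
  have t1 := hf.norm_diff_wall_sub_le hL (norm_smul_axis_le hσ i) hh hx hx' (by
    rw [dirDeriv_smul, Pi.smul_apply, hn.dirDeriv_eq_zero hL hf.differentiableOn hx hi, smul_zero])
  rw [dirDeriv_dirDeriv_sign hL hσ _ hxB, dirDeriv_dirDeriv_sign hL hσ _ hx'] at t1
  set w : Fin d → Space d → F := fun j => dirDeriv L (axis j) (dirDeriv L (axis j) f) with hw
  have t2 : ∀ j, j ≠ i → ‖w j (x + h • σ • axis i) - w j x‖ ≤ 12 * M * h ^ 2 := by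
    intro j hj
    refine ((hf.dirDeriv hL (hθ j)).dirDeriv hL (hθ j)).norm_diff_wall_le hL
      (norm_smul_axis_le hσ i) hh hx hx' ?_
    rw [dirDeriv_smul, Pi.smul_apply,
      hn.dirDeriv_tangential_eq_zero hL (hf.mono (by norm_num)) hj hx hi, smul_zero]
  -- The boundary defect involves only the second derivative normal to the wall. By their Neumann
  -- condition the others change by O(h²) across one cell, so the full Laplacian may replace it;
  -- this is what makes the correction a single field.
  set D := ∑ j ∈ Finset.univ.erase i, (w j (x + h • σ • axis i) - w j x) with hD
  have t3 : ‖D‖ ≤ d * (12 * M * h ^ 2) := by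
    refine (norm_sum_le_of_le _ fun j hj => t2 j (Finset.ne_of_mem_erase hj)).trans ?_
    rw [Finset.sum_const, nsmul_eq_mul]
    gcongr
    refine (Finset.card_le_univ _).trans_eq (Fintype.card_fin d)
  have e : boxLaplacian L f (x + h • σ • axis i) - boxLaplacian L f x
      = (w i (x + h • σ • axis i) - w i x) + D := by
    rw [boxLaplacian, boxLaplacian, ← Finset.sum_sub_distrib, hD,
      Finset.add_sum_erase _ (fun j => w j (x + h • σ • axis i) - w j x) (Finset.mem_univ i)]
  rw [e, smul_add, ← sub_sub]
  refine (norm_sub_le _ _).trans ((add_le_add_left t1 _).trans ?_)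
  rw [norm_smul, Real.norm_eq_abs, abs_of_nonneg (by positivity)]
  have : h ^ 2 / 24 * ‖D‖ ≤ h ^ 2 / 24 * (d * (12 * M * h ^ 2)) := by gcongr
  have : 0 ≤ d * (M * h ^ 4) := by positivity
  linarith

/-- Away from the wall the 1/24 term is a second difference, hence O(h²), and is included only so
that one formula covers all cells. -/
theorem norm_interior_consistency_le (hL : ∀ i, 0 < L i) (hf : BoundedCn L 4 M f) {i : Fin d}
    {x : Space d} {h : ℝ} (hh : 0 ≤ h) (hx : x + (-h) • axis i ∈ closedBox L)
    (hx' : x + h • axis i ∈ closedBox L) :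
    ‖f (x + h • axis i) - f x + (f (x + (-h) • axis i) - f x)
      - h ^ 2 • dirDeriv L (axis i) (dirDeriv L (axis i) f) x
      - (h ^ 2 / 24) • (boxLaplacian L f (x + h • axis i) - boxLaplacian L f x
        + (boxLaplacian L f (x + (-h) • axis i) - boxLaplacian L f x))‖
      ≤ (52 + d) * M * h ^ 4 := by
  have hM := hf.nonneg hL
  have hθ : ∀ i : Fin d, ‖axis i‖ ≤ 1 := fun i => by simp
  have t1 := hf.norm_diff2_sub_le hL (hθ i) hh hx hx'
  have t2 := fun j => ((hf.dirDeriv hL (hθ j)).dirDeriv hL (hθ j)).norm_diff2_le hL (hθ i) hh hx hx'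
  have t3 : ‖boxLaplacian L f (x + h • axis i) - boxLaplacian L f x
        + (boxLaplacian L f (x + (-h) • axis i) - boxLaplacian L f x)‖ ≤ d * (12 * M * h ^ 2) := by
    simp only [boxLaplacian]
    rw [← Finset.sum_sub_distrib, ← Finset.sum_sub_distrib, ← Finset.sum_add_distrib]
    refine (norm_sum_le_of_le _ fun j _ => t2 j).trans ?_
    simp
  refine (norm_sub_le _ _).trans ((add_le_add_left t1 _).trans ?_)
  rw [norm_smul, Real.norm_eq_abs, abs_of_nonneg (by positivity)]
  have : h ^ 2 / 24 * ‖boxLaplacian L f (x + h • axis i) - boxLaplacian L f x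
        + (boxLaplacian L f (x + (-h) • axis i) - boxLaplacian L f x)‖
      ≤ h ^ 2 / 24 * (d * (12 * M * h ^ 2)) := by gcongr
  have : 0 ≤ d * (M * h ^ 4) := by positivity
  linarith

end Wall

section Cells

variable {d : ℕ} {N : Fin d → ℕ} {L : Fin d → ℝ} {F : Type*} [NormedAddCommGroup F]
  [NormedSpace ℝ F] {M h : ℝ} {f : Space d → F}

theorem center_apply (h : ℝ) (I : Index N) (i : Fin d) :
    center h I i = ((I i : ℕ) + 1 / 2 : ℝ) * h := rfl

theorem center_mem_openBox (hh : 0 < h) (hN : ∀ i, (N i : ℝ) * h = L i) (I : Index N) :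
    center h I ∈ openBox L := by
  intro i
  rw [center_apply, ← hN i]
  have : ((I i : ℕ) : ℝ) + 1 ≤ N i := by exact_mod_cast (I i).2
  exact ⟨by positivity, by gcongr; linarith⟩

theorem center_mem_closedBox (hh : 0 < h) (hN : ∀ i, (N i : ℝ) * h = L i) (I : Index N) :
    center h I ∈ closedBox L :=
  openBox_subset_closedBox L (center_mem_openBox hh hN I)

theorem center_nbr_up {I : Index N} {i : Fin d} (hI : (I i : ℕ) + 1 < N i) :
    center h (nbr I (i, true)) = center h I + h • axis i := by
  ext j
  simp only [nbr, if_true, hI, dite_true, PiLp.add_apply, PiLp.smul_apply, center_apply]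
  by_cases hij : j = i
  · subst hij; simp; ring
  · simp [hij]

theorem center_nbr_down {I : Index N} {i : Fin d} (hI : 0 < (I i : ℕ)) :
    center h (nbr I (i, false)) = center h I + (-h) • axis i := by
  ext j
  simp only [nbr, Bool.false_eq_true, if_false, hI, if_true, PiLp.add_apply, PiLp.smul_apply,
    center_apply]
  by_cases hij : j = i
  · subst hij
    simp [Nat.cast_sub (Nat.one_le_iff_ne_zero.2 hI.ne')]; ring
  · simp [hij]

theorem nbr_up_self {I : Index N} {i : Fin d} (hI : ¬(I i : ℕ) + 1 < N i) :
    nbr I (i, true) = I := by simp [nbr, hI]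

theorem nbr_down_self {I : Index N} {i : Fin d} (hI : ¬0 < (I i : ℕ)) :
    nbr I (i, false) = I := by simp [nbr, hI]

theorem center_nbr (h : ℝ) (I : Index N) (p : Fin d × Bool) :
    nbr I p = I ∨ ∃ σ : ℝ, (σ = 1 ∨ σ = -1) ∧
      center h (nbr I p) = center h I + h • σ • axis p.1 := by
  obtain ⟨i, b⟩ := p
  cases b
  · by_cases hI : 0 < (I i : ℕ)
    · refine Or.inr ⟨-1, Or.inr rfl, ?_⟩
      rw [center_nbr_down hI]; module
    · exact Or.inl (nbr_down_self hI)
  · by_cases hI : (I i : ℕ) + 1 < N i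
    · refine Or.inr ⟨1, Or.inl rfl, ?_⟩
      rw [center_nbr_up hI]; module
    · exact Or.inl (nbr_up_self hI)

theorem norm_center_nbr_diff_le (hL : ∀ i, 0 < L i) (hf : BoundedCn L 1 M f) (hh : 0 < h)
    (hN : ∀ i, (N i : ℝ) * h = L i) (I : Index N) (p : Fin d × Bool) :
    ‖f (center h (nbr I p)) - f (center h I)‖ ≤ M * h := by
  have hM := hf.nonneg hL
  rcases center_nbr h I p with e | ⟨σ, hσ, e⟩
  · rw [e, sub_self, norm_zero]; positivity
  · rw [e]
    exact hf.norm_diff_le hL (norm_smul_axis_le hσ _) hh.le (center_mem_closedBox hh hN I)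
      (e ▸ center_mem_closedBox hh hN _)

/-- With at least two cells per direction, no cell touches both opposite faces, and each case is
either interior or one wall. -/
theorem norm_cell_consistency_le (hL : ∀ i, 0 < L i) (hn : HasNeumann L f)
    (hf : BoundedCn L 4 M f) (hh : 0 < h) (hN : ∀ i, (N i : ℝ) * h = L i) (hN2 : ∀ i, 2 ≤ N i)
    (I : Index N) (i : Fin d) :
    ‖∑ b, (f (center h (nbr I (i, b))) - f (center h I))
      - h ^ 2 • dirDeriv L (axis i) (dirDeriv L (axis i) f) (center h I)
      - (h ^ 2 / 24) • ∑ b, (boxLaplacian L f (center h (nbr I (i, b)))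
        - boxLaplacian L f (center h I))‖ ≤ (52 + d) * M * h ^ 4 := by
  have hB := center_mem_closedBox hh hN I
  rw [Fintype.sum_bool, Fintype.sum_bool]
  have hwall : ∀ (σ : ℝ), (σ = 1 ∨ σ = -1) →
      center h I i - h / 2 * σ = 0 ∨ center h I i - h / 2 * σ = L i →
      center h I + (-(h / 2)) • σ • axis i ∈ closedBox L ∧
      ((center h I + (-(h / 2)) • σ • axis i) i = 0 ∨
        (center h I + (-(h / 2)) • σ • axis i) i = L i) := by
    intro σ hσ H
    have e : (center h I + (-(h / 2)) • σ • axis i) i = center h I i - h / 2 * σ := by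
      simp [sub_eq_add_neg]
    refine ⟨fun j => ?_, by rw [e]; exact H⟩
    by_cases hij : j = i
    · subst hij
      rw [e]
      rcases H with H | H <;> rw [H] <;> constructor <;> linarith [hL j]
    · simpa [hij] using hB j
  by_cases h1 : (I i : ℕ) + 1 < N i
  · have m1 := center_mem_closedBox hh hN (nbr I (i, true))
    rw [center_nbr_up h1] at m1 ⊢
    by_cases h2 : 0 < (I i : ℕ)
    · have m2 := center_mem_closedBox hh hN (nbr I (i, false))
      rw [center_nbr_down h2] at m2 ⊢
      exact norm_interior_consistency_le hL hf hh.le m2 m1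
    · rw [nbr_down_self h2, sub_self, sub_self, add_zero, add_zero]
      have h3 := hwall 1 (Or.inl rfl) (Or.inl (by
        rw [center_apply, Nat.eq_zero_of_not_pos h2]; push_cast; ring))
      have := norm_wall_consistency_le hL hn hf (Or.inl rfl) hh.le h3.1
        (by rwa [one_smul]) h3.2
      rwa [one_smul] at this
  · have h2 : 0 < (I i : ℕ) := by have := hN2 i; omega
    have m2 := center_mem_closedBox hh hN (nbr I (i, false))
    rw [center_nbr_down h2] at m2 ⊢
    rw [nbr_up_self h1, sub_self, sub_self, zero_add, zero_add]
    have h4 : (I i : ℕ) + 1 = N i := by have := (I i).2; omega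
    have h3 := hwall (-1) (Or.inr rfl) (Or.inr (by
      have h5 : ((I i : ℕ) : ℝ) + 1 = N i := by exact_mod_cast h4
      rw [center_apply, ← hN i, ← h5]; ring))
    have e : h • (-1 : ℝ) • axis i = (-h) • axis i := by module
    have := norm_wall_consistency_le hL hn hf (Or.inr rfl) hh.le h3.1
      (by rwa [e]) h3.2
    rwa [e] at this

/-- Consistency of the discrete Laplacian of a function with vanishing normal derivative. -/
theorem norm_lap_sub_boxLaplacian_le (hL : ∀ i, 0 < L i) (hn : HasNeumann L f)
    (hf : BoundedCn L 4 M f) (hh : 0 < h) (hN : ∀ i, (N i : ℝ) * h = L i) (hN2 : ∀ i, 2 ≤ N i)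
    (I : Index N) :
    ‖(h ^ 2)⁻¹ • ∑ p, (f (center h (nbr I p)) - f (center h I)) - boxLaplacian L f (center h I)
      - (1 / 24 : ℝ) • ∑ p, (boxLaplacian L f (center h (nbr I p))
        - boxLaplacian L f (center h I))‖ ≤ d * ((52 + d) * M) * h ^ 2 := by
  have e : (h ^ 2)⁻¹ • ∑ p, (f (center h (nbr I p)) - f (center h I))
        - boxLaplacian L f (center h I)
        - (1 / 24 : ℝ) • ∑ p, (boxLaplacian L f (center h (nbr I p))
        - boxLaplacian L f (center h I))
      = (h ^ 2)⁻¹ • ∑ i, (∑ b, (f (center h (nbr I (i, b))) - f (center h I))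
      - h ^ 2 • dirDeriv L (axis i) (dirDeriv L (axis i) f) (center h I)
      - (h ^ 2 / 24) • ∑ b, (boxLaplacian L f (center h (nbr I (i, b)))
        - boxLaplacian L f (center h I))) := by
    rw [Fintype.sum_prod_type, Fintype.sum_prod_type, Finset.sum_sub_distrib,
      Finset.sum_sub_distrib, ← Finset.smul_sum, ← Finset.smul_sum, smul_sub, smul_sub, smul_smul,
      smul_smul, inv_mul_cancel₀ (by positivity), one_smul]
    congr 2
    field_simp
  rw [e, norm_smul, norm_inv, Real.norm_eq_abs, abs_of_pos (by positivity : 0 < h ^ 2),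
    inv_mul_le_iff₀ (by positivity)]
  refine (norm_sum_le_of_le _ fun i _ => norm_cell_consistency_le hL hn hf hh hN hN2 I i).trans ?_
  rw [Finset.sum_const, Finset.card_univ, Fintype.card_fin, nsmul_eq_mul]
  refine le_of_eq ?_
  ring

end Cells

end LLG

/-! ### Tangential exchange field; spatial bounds at all times. -/

namespace LLG

open scoped RealInnerProductSpace

section Tangential

variable {d : ℕ} {N : Fin d → ℕ} {h ε C : ℝ}

theorem perp_smul_self_add {v : Vec3} (hv : ‖v‖ = 1) (r : ℝ) (b : Vec3) :
    perp v (r • v + b) = perp v b := by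
  have : perp v v = 0 := by simp [perp, hv]
  rw [perp_add, perp_smul, this, smul_zero, zero_add]

/-- The tangential part of the discrete Laplacian of a unit vector field is determined, up to second
order, by the tangential part `S` of the exchange field. -/
theorem norm_perp_lap_sub_le {v W S : GridFun N} (hh : 0 < h) (hh1 : h ≤ 1) (hε : 0 < ε)
    (hC : 1 ≤ C) (hv : ∀ I, ‖v I‖ = 1) (hW : ∀ I, ‖W I‖ ≤ C)
    (hS : ∀ I, S I = ε • perp (v I) (W I))
    (hdv : ∀ I p, ‖v (nbr I p) - v I‖ ≤ C * h) (hdW : ∀ I p, ‖W (nbr I p) - W I‖ ≤ C * h)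
    (hcons : ∀ I, ‖lap h v I - W I - (1 / 24 : ℝ) • ∑ p, (W (nbr I p) - W I)‖ ≤ C * h ^ 2)
    (I : Index N) :
    ‖lap h v I‖ ≤ (2 + d) * C ∧ (∀ p, ‖S (nbr I p) - S I‖ ≤ 4 * ε * C ^ 3 * h) ∧
    ‖perp (v I) (ε • lap h v I) - S I - (1 / 24 : ℝ) • perp (v I) (∑ p, (S (nbr I p) - S I))‖
      ≤ (3 + 5 * d) * ε * C ^ 3 * h ^ 2 := by
  have hC0 : 0 < C := by linarith
  have hsum : ‖∑ p, (W (nbr I p) - W I)‖ ≤ 2 * d * (C * h) := by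
    refine (norm_sum_le_of_le _ fun p _ => hdW I p).trans_eq ?_
    rw [Finset.sum_const, Finset.card_univ, Fintype.card_prod, Fintype.card_fin,
      Fintype.card_bool, nsmul_eq_mul]; push_cast; ring
  have hlap : ‖lap h v I‖ ≤ (2 + d) * C := by
    have e : lap h v I = (lap h v I - W I - (1 / 24 : ℝ) • ∑ p, (W (nbr I p) - W I)) + W I
        + (1 / 24 : ℝ) • ∑ p, (W (nbr I p) - W I) := by abel
    rw [e]
    refine (norm_add_le _ _).trans ((add_le_add ((norm_add_le _ _).trans
      (add_le_add (hcons I) (hW I))) le_rfl).trans ?_)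
    rw [norm_smul, Real.norm_eq_abs, abs_of_pos (by norm_num : (0 : ℝ) < 1 / 24)]
    have h2 : h ^ 2 ≤ 1 := pow_le_one₀ hh.le hh1
    have : C * h ^ 2 ≤ C * 1 := by gcongr
    have : (2 * d * (C * h) : ℝ) ≤ 2 * d * (C * 1) := by gcongr
    have : 0 ≤ (d : ℝ) * C := by positivity
    linarith
  refine ⟨hlap, ?_⟩
  have c1 : C ≤ C ^ 3 := by simpa using pow_le_pow_right₀ hC (by norm_num : 1 ≤ 3)
  have c2 : C ^ 2 ≤ C ^ 3 := pow_le_pow_right₀ hC (by norm_num)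
  set c : Index N → ℝ := fun J => ⟪v J, W J⟫ with hc
  have hS' : ∀ J, S J = ε • W J - (ε * c J) • v J := by
    intro J; rw [hS, perp]; module
  have hc0 : |c I| ≤ C := by
    refine (abs_real_inner_le_norm _ _).trans ?_
    rw [hv, one_mul]; exact hW I
  have hdc : ∀ p, |c (nbr I p) - c I| ≤ 2 * C ^ 2 * h := by
    intro p
    have e : c (nbr I p) - c I = ⟪v (nbr I p) - v I, W (nbr I p)⟫ + ⟪v I, W (nbr I p) - W I⟫ := by
      rw [hc, inner_sub_left, inner_sub_right]; ring
    rw [e]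
    refine (abs_add_le _ _).trans ((add_le_add (abs_real_inner_le_norm _ _)
      (abs_real_inner_le_norm _ _)).trans ?_)
    rw [hv, one_mul]
    have t1 : ‖v (nbr I p) - v I‖ * ‖W (nbr I p)‖ ≤ C * h * C := by
      gcongr
      exacts [hdv I p, hW _]
    have t2 := hdW I p
    have t3 : C * h * 1 ≤ C * h * C := by gcongr
    linarith
  refine ⟨fun p => ?_, ?_⟩
  · have e : S (nbr I p) - S I = ε • ((W (nbr I p) - W I) - (c (nbr I p) - c I) • v (nbr I p)
        - c I • (v (nbr I p) - v I)) := by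
      rw [hS', hS']; module
    rw [e, norm_smul, Real.norm_eq_abs, abs_of_pos hε]
    have b : ‖(W (nbr I p) - W I) - (c (nbr I p) - c I) • v (nbr I p)
        - c I • (v (nbr I p) - v I)‖ ≤ C * h + 2 * C ^ 2 * h * 1 + C * (C * h) := by
      refine (norm_sub_le _ _).trans (add_le_add ((norm_sub_le _ _).trans
        (add_le_add (hdW I p) ?_)) ?_)
      · rw [norm_smul, Real.norm_eq_abs, hv]
        gcongr
        exact hdc p
      · rw [norm_smul, Real.norm_eq_abs]
        gcongr
        exact hdv I p
    have d1 : C * h ≤ C ^ 3 * h := by gcongr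
    have d2 : C ^ 2 * h ≤ C ^ 3 * h := by gcongr
    calc _ ≤ ε * (C * h + 2 * C ^ 2 * h * 1 + C * (C * h)) := by gcongr
      _ ≤ ε * (4 * (C ^ 3 * h)) := by gcongr; linarith
      _ = _ := by ring
  -- Differences of ε W and of its tangential part S differ, modulo v, by multiples of differences
  -- of v. With the coefficient frozen these add up to h² times the Laplacian of v; the variation of
  -- the coefficient gives products of two O(h) differences.
  have hperp : ∀ p, perp (v I) (ε • (W (nbr I p) - W I) - (S (nbr I p) - S I))
      = ε • (c I • perp (v I) (v (nbr I p) - v I)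
        + (c (nbr I p) - c I) • perp (v I) (v (nbr I p) - v I)) := by
    intro p
    have e : ε • (W (nbr I p) - W I) - (S (nbr I p) - S I)
        = (ε * (c (nbr I p) - c I)) • v I + (ε * c (nbr I p)) • (v (nbr I p) - v I) := by
      rw [hS', hS']; module
    rw [e, perp_smul_self_add (hv I), perp_smul]
    module
  have hlap' : ∑ p, (v (nbr I p) - v I) = h ^ 2 • lap h v I := by
    rw [lap, smul_smul, mul_inv_cancel₀ (by positivity), one_smul]
  have hps : ∀ b : Index N → Vec3, perp (v I) (∑ p, (b (nbr I p) - b I))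
      = ∑ p, perp (v I) (b (nbr I p) - b I) := by
    intro b
    rw [perp, inner_sum, Finset.sum_smul, ← Finset.sum_sub_distrib]
    rfl
  have e : perp (v I) (ε • lap h v I) - S I - (1 / 24 : ℝ) • perp (v I) (∑ p, (S (nbr I p) - S I))
      = ε • perp (v I) (lap h v I - W I - (1 / 24 : ℝ) • ∑ p, (W (nbr I p) - W I))
        + (1 / 24 * ε) • (c I • (h ^ 2 • perp (v I) (lap h v I))
          + ∑ p, (c (nbr I p) - c I) • perp (v I) (v (nbr I p) - v I)) := by
    have e1 : ε • perp (v I) (∑ p, (W (nbr I p) - W I)) - perp (v I) (∑ p, (S (nbr I p) - S I))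
        = ε • (c I • (h ^ 2 • perp (v I) (lap h v I))
          + ∑ p, (c (nbr I p) - c I) • perp (v I) (v (nbr I p) - v I)) := by
      rw [← perp_smul (h ^ 2), ← hlap', hps, hps, hps, Finset.smul_sum, Finset.smul_sum,
        ← Finset.sum_add_distrib, Finset.smul_sum, ← Finset.sum_sub_distrib]
      refine Finset.sum_congr rfl fun p _ => ?_
      rw [← hperp, perp_sub _ (ε • _), perp_smul]
    rw [mul_smul, ← e1, perp_sub, perp_sub, perp_smul, perp_smul, hS I]
    module
  rw [e]
  have hsum2 : ‖∑ p, (c (nbr I p) - c I) • perp (v I) (v (nbr I p) - v I)‖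
      ≤ 2 * d * (2 * C ^ 2 * h * (C * h)) := by
    refine (norm_sum_le _ _).trans ((Finset.sum_le_sum fun p _ =>
      (?_ : _ ≤ 2 * C ^ 2 * h * (C * h))).trans_eq ?_)
    · rw [norm_smul, Real.norm_eq_abs]
      gcongr
      exacts [hdc p, (norm_perp_le (hv I) _).trans (hdv I p)]
    · rw [Finset.sum_const, Finset.card_univ, Fintype.card_prod, Fintype.card_fin,
        Fintype.card_bool, nsmul_eq_mul]; push_cast; ring
  have b1 : ‖ε • perp (v I) (lap h v I - W I - (1 / 24 : ℝ) • ∑ p, (W (nbr I p) - W I))‖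
      ≤ ε * (C * h ^ 2) := by
    rw [norm_smul, Real.norm_eq_abs, abs_of_pos hε]
    gcongr
    exact (norm_perp_le (hv I) _).trans (hcons I)
  have b2 : ‖c I • (h ^ 2 • perp (v I) (lap h v I))‖ ≤ C * (h ^ 2 * ((2 + d) * C)) := by
    rw [norm_smul, norm_smul, Real.norm_eq_abs, Real.norm_eq_abs,
      abs_of_pos (by positivity : 0 < h ^ 2)]
    gcongr
    exact (norm_perp_le (hv I) _).trans hlap
  refine (norm_add_le _ _).trans ((add_le_add b1 le_rfl).trans ?_)
  rw [norm_smul, Real.norm_eq_abs, abs_of_pos (by positivity)]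
  have b3 : 1 / 24 * ε * ‖c I • (h ^ 2 • perp (v I) (lap h v I))
          + ∑ p, (c (nbr I p) - c I) • perp (v I) (v (nbr I p) - v I)‖
      ≤ 1 / 24 * ε * (C * (h ^ 2 * ((2 + d) * C)) + 2 * d * (2 * C ^ 2 * h * (C * h))) := by
    gcongr
    exact (norm_add_le _ _).trans (add_le_add b2 hsum2)
  refine (add_le_add le_rfl b3).trans ?_
  have d1 : ε * h ^ 2 * C ≤ ε * h ^ 2 * C ^ 3 := by gcongr
  have d2 : ε * h ^ 2 * C ^ 2 ≤ ε * h ^ 2 * C ^ 3 := by gcongr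
  have d3 : ε * h ^ 2 * d * C ^ 2 ≤ ε * h ^ 2 * d * C ^ 3 := by gcongr
  have d4 : 0 ≤ ε * h ^ 2 * C ^ 3 := by positivity
  have d5 : 0 ≤ ε * h ^ 2 * d * C ^ 3 := by positivity
  linarith

end Tangential

section AllTimes

/-- Spatial smoothness is given only for almost every time; closed inequalities between continuous
functions extend from there to all times. -/
theorem le_of_ae_le {T c : ℝ} (hT : 0 < T) {φ : ℝ → ℝ} (hφ : ContinuousOn φ (Icc 0 T))
    (h : ∀ᵐ t ∂(volume.restrict (Icc 0 T)), φ t ≤ c) {t : ℝ} (ht : t ∈ Icc 0 T) : φ t ≤ c := by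
  have h1 : (fun t => max (φ t) c) =ᵐ[volume.restrict (Icc 0 T)] fun _ => c := by
    filter_upwards [h] with s hs using max_eq_right hs
  have := Measure.eqOn_Icc_of_ae_eq volume hT.ne h1 (hφ.sup continuousOn_const) continuousOn_const ht
  exact max_eq_right_iff.1 this

end AllTimes

section Spatial

variable {d : ℕ} {L : Fin d → ℝ} {ε K : ℝ}

/-- Spatial regularity at one time, in terms of difference quotients only: `v` has bounded
differences, and `S` is the tangential part of its exchange field up to second order. -/
structure SpatialBound (L : Fin d → ℝ) (ε K : ℝ) (v S : Space d → Vec3) : Prop where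
  diff : ∀ {x θ : Space d} {l : ℝ}, ‖θ‖ ≤ 1 → 0 ≤ l → x ∈ closedBox L → x + l • θ ∈ closedBox L →
    ‖v (x + l • θ) - v x‖ ≤ K * l
  scale : ∀ {x θ : Space d} {h l : ℝ}, ‖θ‖ ≤ 1 → 0 < h → h ≤ l → x ∈ closedBox L →
    x + l • θ ∈ closedBox L → ‖v (x + l • θ) - v x - (l / h) • (v (x + h • θ) - v x)‖ ≤ K * l ^ 2
  lap : ∀ {h : ℝ} {N : Fin d → ℕ}, 0 < h → h ≤ 1 → (∀ i, (N i : ℝ) * h = L i) → (∀ i, 2 ≤ N i) →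
    ∀ I : Index N, ‖lap h (fun J => v (center h J)) I‖ ≤ K
  field_diff : ∀ {h : ℝ} {N : Fin d → ℕ}, 0 < h → h ≤ 1 → (∀ i, (N i : ℝ) * h = L i) →
    (∀ i, 2 ≤ N i) → ∀ (I : Index N) (p : Fin d × Bool),
    ‖S (center h (nbr I p)) - S (center h I)‖ ≤ K * h
  perp_lap : ∀ {h : ℝ} {N : Fin d → ℕ}, 0 < h → h ≤ 1 → (∀ i, (N i : ℝ) * h = L i) →
    (∀ i, 2 ≤ N i) → ∀ I : Index N,
    ‖perp (v (center h I)) (ε • LLG.lap h (fun J => v (center h J)) I) - S (center h I)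
      - (1 / 24 : ℝ) • perp (v (center h I)) (∑ p, (S (center h (nbr I p)) - S (center h I)))‖
      ≤ K * h ^ 2

theorem norm_boxLaplacian_le (hL : ∀ i, 0 < L i) {M : ℝ} {f : Space d → Vec3}
    (hf : BoundedCn L 2 M f) {x : Space d} (hx : x ∈ closedBox L) :
    ‖boxLaplacian L f x‖ ≤ d * M := by
  have hθ : ∀ i : Fin d, ‖axis i‖ ≤ 1 := fun i => by simp
  refine (norm_sum_le_of_le _ fun i _ =>
    ((hf.dirDeriv hL (hθ i)).dirDeriv hL (hθ i)).norm_le hx).trans_eq ?_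
  simp

theorem spatialBound_of_boundedCn (hL : ∀ i, 0 < L i) (hε : 0 < ε) {M : ℝ} {v S : Space d → Vec3}
    (hn : HasNeumann L v) (hv1 : ∀ x ∈ closedBox L, ‖v x‖ = 1) (hv : BoundedCn L 4 M v)
    (hS : ∀ x ∈ openBox L, S x = ε • perp (v x) (boxLaplacian L v x))
    (hK : (5 + 5 * d) * (1 + ε) * (1 + d * (52 + d) * M + (d + 2) * M) ^ 3 ≤ K) :
    SpatialBound L ε K v S := by
  have hM := hv.nonneg hL
  have hθ : ∀ i : Fin d, ‖axis i‖ ≤ 1 := fun i => by simp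
  set C := 1 + d * (52 + d) * M + (d + 2) * M with hC
  have hdM : 0 ≤ (d : ℝ) * M := by positivity
  have hddM : 0 ≤ d * (52 + d) * M := by positivity
  have hC1 : 1 ≤ C := by rw [hC]; nlinarith
  have hMC : 2 * M ≤ C := by rw [hC]; nlinarith
  have hdC : d * M ≤ C := by rw [hC]; nlinarith
  have hddC : d * ((52 + d) * M) ≤ C := by rw [hC]; nlinarith
  have hC3 : C ≤ C ^ 3 := by simpa using pow_le_pow_right₀ hC1 (by norm_num : 1 ≤ 3)
  have hCK : (5 + 5 * d) * C ≤ K := by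
    refine le_trans ?_ hK
    have : (5 + 5 * d) * C * 1 ≤ (5 + 5 * d) * C ^ 3 * (1 + ε) := by gcongr; linarith
    linarith
  have hdC0 : 0 ≤ (d : ℝ) * C := by positivity
  have key : ∀ {h : ℝ} {N : Fin d → ℕ}, 0 < h → h ≤ 1 → (∀ i, (N i : ℝ) * h = L i) →
      (∀ i, 2 ≤ N i) → ∀ I : Index N, _ := fun {h N} hh hh1 hN hN2 I =>
    norm_perp_lap_sub_le (v := fun J : Index N => v (center h J))
      (W := fun J => boxLaplacian L v (center h J)) (S := fun J => S (center h J)) hh hh1 hε hC1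
      (fun I => hv1 _ (center_mem_closedBox hh hN I))
      (fun I => (norm_boxLaplacian_le hL (hv.mono (by norm_num))
        (center_mem_closedBox hh hN I)).trans hdC)
      (fun I => hS _ (center_mem_openBox hh hN I))
      (fun I p => (norm_center_nbr_diff_le hL (hv.mono (by norm_num)) hh hN I p).trans
        (by gcongr; linarith))
      (fun I p => by
        simp only [boxLaplacian]
        rw [← Finset.sum_sub_distrib]
        refine (norm_sum_le_of_le _ fun i _ => norm_center_nbr_diff_le hL
          (((hv.dirDeriv hL (hθ i)).dirDeriv hL (hθ i)).mono (by norm_num)) hh hN I p).trans ?_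
        rw [Finset.sum_const, Finset.card_univ, Fintype.card_fin, nsmul_eq_mul, ← mul_assoc]
        gcongr)
      (fun I => (norm_lap_sub_boxLaplacian_le hL hn hv hh hN hN2 I).trans (by gcongr)) I
  refine ⟨fun h1 h2 h3 h4 => ?_, fun h1 h2 h3 h4 h5 => ?_, fun hh hh1 hN hN2 I => ?_,
    fun hh hh1 hN hN2 I p => ?_, fun hh hh1 hN hN2 I => ?_⟩
  · refine ((hv.mono (by norm_num)).norm_diff_le hL h1 h2 h3 h4).trans ?_
    gcongr
    linarith
  · refine ((hv.mono (by norm_num)).norm_diff_scale_le hL h1 h2 h3 h4 h5).trans ?_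
    gcongr
    linarith
  · refine (key hh hh1 hN hN2 I).1.trans ?_
    linarith
  · refine ((key hh hh1 hN hN2 I).2.1 p).trans ?_
    gcongr
    refine le_trans ?_ hK
    gcongr
    · linarith
    · linarith
  · refine (key hh hh1 hN hN2 I).2.2.trans ?_
    gcongr
    refine le_trans ?_ hK
    gcongr <;> linarith

/-- For fixed points and mesh, each clause involves finitely many values of v and S, which are
continuous in t. This is why `SpatialBound` is phrased without derivatives. -/
theorem SpatialBound.of_ae {T : ℝ} (hT : 0 < T) {v S : ℝ → Space d → Vec3}
    (hv : ∀ x ∈ closedBox L, ContinuousOn (fun t => v t x) (Icc 0 T))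
    (hS : ∀ x ∈ closedBox L, ContinuousOn (fun t => S t x) (Icc 0 T))
    (h : ∀ᵐ t ∂(volume.restrict (Icc 0 T)), SpatialBound L ε K (v t) (S t)) {t : ℝ}
    (ht : t ∈ Icc 0 T) : SpatialBound L ε K (v t) (S t) := by
  have hlap : ∀ {h : ℝ} {N : Fin d → ℕ}, 0 < h → (∀ i, (N i : ℝ) * h = L i) → ∀ I : Index N,
      ContinuousOn (fun t => LLG.lap h (fun J => v t (center h J)) I) (Icc 0 T) := by
    intro h N hh hN I
    have hc := fun J : Index N => hv _ (center_mem_closedBox hh hN J)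
    exact (continuousOn_finsetSum _ fun p _ => (hc (nbr I p)).sub (hc I)).const_smul ((h ^ 2)⁻¹)
  have hperp : ∀ {a b : ℝ → Vec3}, ContinuousOn a (Icc 0 T) → ContinuousOn b (Icc 0 T) →
      ContinuousOn (fun t => perp (a t) (b t)) (Icc 0 T) := by
    intro a b ha hb
    unfold perp
    fun_prop
  refine ⟨fun {x θ l} h1 h2 h3 h4 => ?_, fun {x θ k l} h1 h2 h3 h4 h5 => ?_,
    fun {k N} hh hh1 hN hN2 I => ?_, fun {k N} hh hh1 hN hN2 I p => ?_,
    fun {k N} hh hh1 hN hN2 I => ?_⟩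
  · exact le_of_ae_le hT (φ := fun t => ‖v t (x + l • θ) - v t x‖) ((hv _ h4).sub (hv _ h3)).norm
      (h.mono fun s hs => hs.diff h1 h2 h3 h4) ht
  · have h6 : x + k • θ ∈ closedBox L := line_mem_closedBox h4 h5 ⟨h2.le, h3⟩
    have h7 : ContinuousOn
        (fun t => v t (x + l • θ) - v t x - (l / k) • (v t (x + k • θ) - v t x)) (Icc 0 T) :=
      ((hv _ h5).sub (hv _ h4)).sub (((hv _ h6).sub (hv _ h4)).fun_const_smul _)
    exact le_of_ae_le hT h7.norm (h.mono fun s hs => hs.scale h1 h2 h3 h4 h5) ht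
  · exact le_of_ae_le hT (φ := fun t => ‖LLG.lap k (fun J => v t (center k J)) I‖)
      (hlap hh hN I).norm (h.mono fun s hs => hs.lap hh hh1 hN hN2 I) ht
  · have hcS := fun J : Index N => hS _ (center_mem_closedBox hh hN J)
    exact le_of_ae_le hT ((hcS (nbr I p)).sub (hcS I)).norm
      (h.mono fun s hs => hs.field_diff hh hh1 hN hN2 I p) ht
  · have hc := fun J : Index N => hv _ (center_mem_closedBox hh hN J)
    have hcS := fun J : Index N => hS _ (center_mem_closedBox hh hN J)
    have h7 : ContinuousOn (fun t =>
        perp (v t (center k I)) (ε • LLG.lap k (fun J => v t (center k J)) I) - S t (center k I)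
        - (1 / 24 : ℝ) • perp (v t (center k I))
          (∑ p, (S t (center k (nbr I p)) - S t (center k I)))) (Icc 0 T) :=
      ((hperp (hc I) ((hlap hh hN I).const_smul ε)).sub (hcS I)).sub
        ((hperp (hc I) (continuousOn_finsetSum _ fun p _ => (hcS (nbr I p)).sub
          (hcS I))).fun_const_smul _)
    exact le_of_ae_le hT h7.norm (h.mono fun s hs => hs.perp_lap hh hh1 hN hN2 I) ht

end Spatial

end LLG

/-! ### The corrected reference solution at one time level; interpolation. -/

namespace LLG

open scoped RealInnerProductSpace

section Reference

variable {d : ℕ} {L : Fin d → ℝ} {T α ε Q K : ℝ} {he v v' S : ℝ → Space d → Vec3}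
  {z ρ : ℝ → ℝ → Space d → Vec3}

/-- A unit vector field `v`, its time derivative `v'`, the tangential exchange field `S`, and a
correction `z` such that `v + h² z` has unit values, with bounds uniform in time, in space and in
the mesh size `h`. -/
structure RefData (L : Fin d → ℝ) (T α ε Q K : ℝ) (he v v' S : ℝ → Space d → Vec3)
    (z ρ : ℝ → ℝ → Space d → Vec3) : Prop where
  one_le : 1 ≤ K
  α_pos : 0 < α
  ε_pos : 0 < ε
  α_le : 1 + 5 * α ≤ K
  ε_le : ε ≤ K
  inv_ε_le : ε⁻¹ ≤ K
  Q_le : |Q| ≤ K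
  d_le : (d : ℝ) ≤ 3
  field : ∀ x ∈ closedBox L, DiffBound T K fun t => he t x
  base : ∀ x ∈ closedBox L, DiffBound T K fun t => v t x
  deriv : ∀ x ∈ closedBox L, DiffBound T K fun t => v' t x
  exch : ∀ x ∈ closedBox L, DiffBound T K fun t => S t x
  corr : ∀ h ∈ Ioc (0 : ℝ) 1, ∀ x ∈ closedBox L, DiffBound T K fun t => z t h x
  ref : ∀ h ∈ Ioc (0 : ℝ) 1, ∀ x ∈ closedBox L, DiffBound T K fun t => v t x + h ^ 2 • z t h x
  corr_eq : ∀ t ∈ Icc 0 T, ∀ h ∈ Ioc (0 : ℝ) 1, ∀ x ∈ closedBox L,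
    z t h x = -((24 * ε)⁻¹ • S t x) + h ^ 2 • ρ t h x ∧ ‖ρ t h x‖ ≤ K
  base_unit : ∀ t ∈ Icc 0 T, ∀ x ∈ closedBox L, ‖v t x‖ = 1
  ref_unit : ∀ t ∈ Icc 0 T, ∀ h ∈ Ioc (0 : ℝ) 1, ∀ x ∈ closedBox L, ‖v t x + h ^ 2 • z t h x‖ = 1
  hasDeriv : ∀ x ∈ closedBox L, ∀ t ∈ Icc 0 T,
    HasDerivWithinAt (fun s => v s x) (v' t x) (Icc 0 T) t
  eqn : ∀ t ∈ Icc 0 T, ∀ x ∈ closedBox L,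
    llgRhs α (v t x) (S t x + lowerField Q (v t x) (he t x)) = v' t x
  spatial : ∀ t ∈ Icc 0 T, SpatialBound L ε K (v t) (S t)

/-- The corrected reference solution on the grid. -/
noncomputable def gridRef {N : Fin d → ℕ} (v : ℝ → Space d → Vec3) (z : ℝ → ℝ → Space d → Vec3)
    (h t : ℝ) : GridFun N :=
  fun I => v t (center h I) + h ^ 2 • z t h (center h I)

theorem norm_sum_nbr_sub_le {N : Fin d → ℕ} (hd : (d : ℝ) ≤ 3) {f : GridFun N} {c : ℝ}
    (hc : 0 ≤ c) (I : Index N) (hf : ∀ p, ‖f (nbr I p) - f I‖ ≤ c) :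
    ‖∑ p, (f (nbr I p) - f I)‖ ≤ 6 * c := by
  refine (norm_sum_le_of_le _ fun p _ => hf p).trans ?_
  rw [Finset.sum_const, Finset.card_univ, Fintype.card_prod, Fintype.card_fin,
    Fintype.card_bool, nsmul_eq_mul]
  push_cast
  nlinarith

theorem norm_sub_le_two_mul {a b : Vec3} {c : ℝ} (ha : ‖a‖ ≤ c) (hb : ‖b‖ ≤ c) :
    ‖a - b‖ ≤ 2 * c := by
  linarith [norm_sub_le a b]

theorem norm_grad_le_six {N : Fin d → ℕ} (hd : (d : ℝ) ≤ 3) {f : GridFun N} {c h : ℝ}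
    (hc : 0 ≤ c) (I : Index N) (hf : ∀ p, ‖h⁻¹ • (f (nbr I p) - f I)‖ ≤ c) :
    ‖grad h f I‖ ≤ 6 * c := by
  refine (norm_grad_le_of_forall hc f I hf).trans ?_
  nlinarith

theorem norm_inv_smul_le {h c : ℝ} (hh : 0 < h) {a : Vec3} (ha : ‖a‖ ≤ h * c) : ‖h⁻¹ • a‖ ≤ c := by
  rwa [norm_smul, norm_inv, Real.norm_eq_abs, abs_of_pos hh, inv_mul_le_iff₀ hh]

section Level

variable {N : Fin d → ℕ} {h k t : ℝ}

theorem RefData.corr_le (hD : RefData L T α ε Q K he v v' S z ρ) (ht : t ∈ Icc 0 T)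
    (hh : h ∈ Ioc (0 : ℝ) 1) {x : Space d} (hx : x ∈ closedBox L) : ‖z t h x‖ ≤ K :=
  (hD.corr h hh x hx).bound t ht

theorem SpatialBound.nbr_diff {w w' : Space d → Vec3} (hs : SpatialBound L ε K w w') (hK : 0 ≤ K)
    (hh : 0 < h) (hN : ∀ i, (N i : ℝ) * h = L i) (I : Index N) (p : Fin d × Bool) :
    ‖w (center h (nbr I p)) - w (center h I)‖ ≤ K * h := by
  rcases center_nbr h I p with e | ⟨σ, hσ, e⟩
  · rw [e, sub_self, norm_zero]; positivity
  · rw [e]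
    exact hs.diff (norm_smul_axis_le hσ _) hh.le (center_mem_closedBox hh hN I)
      (e ▸ center_mem_closedBox hh hN _)

/-- The main part of z is a multiple of S, whose neighbouring values differ by O(h); the rest
already carries h² and needs no regularity. -/
theorem RefData.corr_diff (hD : RefData L T α ε Q K he v v' S z ρ) (ht : t ∈ Icc 0 T)
    (hh : h ∈ Ioc (0 : ℝ) 1) (hN : ∀ i, (N i : ℝ) * h = L i) (hN2 : ∀ i, 2 ≤ N i) (I : Index N)
    (p : Fin d × Bool) : ‖z t h (center h (nbr I p)) - z t h (center h I)‖ ≤ 3 * K ^ 2 * h := by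
  have hK := hD.one_le
  have hε := hD.ε_pos
  have m := fun J : Index N => center_mem_closedBox hh.1 hN J
  rw [(hD.corr_eq t ht h hh _ (m _)).1, (hD.corr_eq t ht h hh _ (m I)).1]
  have e : -((24 * ε)⁻¹ • S t (center h (nbr I p))) + h ^ 2 • ρ t h (center h (nbr I p))
      - (-((24 * ε)⁻¹ • S t (center h I)) + h ^ 2 • ρ t h (center h I))
      = -((24 * ε)⁻¹ • (S t (center h (nbr I p)) - S t (center h I)))
        + h ^ 2 • (ρ t h (center h (nbr I p)) - ρ t h (center h I)) := by module
  rw [e]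
  refine (norm_add_le _ _).trans ?_
  rw [norm_neg, norm_smul, norm_smul, Real.norm_eq_abs, Real.norm_eq_abs,
    abs_of_pos (by positivity), abs_of_pos (by have := hh.1; positivity)]
  have b1 := (hD.spatial t ht).field_diff hh.1 hh.2 hN hN2 I p
  have b2 := norm_sub_le_two_mul (hD.corr_eq t ht h hh _ (m (nbr I p))).2
    (hD.corr_eq t ht h hh _ (m I)).2
  have b3 : (24 * ε)⁻¹ ≤ K := by
    rw [mul_inv]; nlinarith [hD.inv_ε_le, inv_pos.2 hε]
  have hh0 := hh.1
  calc _ ≤ K * (K * h) + h ^ 2 * (2 * K) := by gcongr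
    _ = K ^ 2 * h + 2 * (K * h) * h := by ring
    _ ≤ K ^ 2 * h + 2 * (K * h) * K := by gcongr; exact hh.2.trans hK
    _ = _ := by ring

/-- The discrete Laplacian of h² z is the sum of the differences of z over neighbours, which to
second order is -1/(24ε) times that of S. After multiplication by ε this cancels the boundary defect
in `SpatialBound.perp_lap`. Passing from the tangent space at v to the one at the corrected value
costs O(h²). -/
theorem RefData.refLevel (hD : RefData L T α ε Q K he v v' S z ρ) (ht : t ∈ Icc 0 T)
    (hh : h ∈ Ioc (0 : ℝ) 1) (hN : ∀ i, (N i : ℝ) * h = L i) (hN2 : ∀ i, 2 ≤ N i)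
    {P : ℝ} (hP : 2000 * K ^ 4 ≤ P) :
    RefLevel P h ε (gridRef v z h t : GridFun N) (fun I => S t (center h I)) := by
  have hK := hD.one_le
  have hε := hD.ε_pos
  have hh0 := hh.1
  have hh1 := hh.2
  have hKP : ∀ n ≤ 4, ∀ c : ℝ, 0 ≤ c → c ≤ 2000 → c * K ^ n ≤ P := by
    intro n hn c hc0 hc
    refine le_trans ?_ hP
    gcongr
  have m := fun J : Index N => center_mem_closedBox hh.1 hN J
  have hz : ∀ J : Index N, ‖z t h (center h J)‖ ≤ K := fun J => hD.corr_le ht hh (m J)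
  have hsp := hD.spatial t ht
  have hlap : ∀ I : Index N, lap h (gridRef v z h t) I
      = lap h (fun J => v t (center h J)) I
        + ∑ p, (z t h (center h (nbr I p)) - z t h (center h I)) := by
    intro I
    have e : (gridRef v z h t : GridFun N) = (fun J => v t (center h J))
        + h ^ 2 • fun J => z t h (center h J) := rfl
    rw [e, lap_add, lap_smul, lap, lap, smul_smul, mul_inv_cancel₀ (by positivity), one_smul]
  have hlap_le : ∀ I : Index N, ‖lap h (gridRef v z h t) I‖ ≤ 13 * K := by
    intro I
    rw [hlap]
    refine (norm_add_le _ _).trans ((add_le_add (hsp.lap hh0 hh1 hN hN2 I)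
      (norm_sum_nbr_sub_le (f := fun J => z t h (center h J)) hD.d_le
        (by positivity : 0 ≤ 2 * K) I fun p => norm_sub_le_two_mul (hz _) (hz _))).trans ?_)
    linarith
  refine ⟨fun I => hD.ref_unit t ht h hh _ (m I), fun I => ?_, fun I => ?_, fun I => ?_⟩
  · refine le_trans (norm_grad_le_six hD.d_le (by positivity : 0 ≤ 3 * K) I fun p => ?_)
      (by simpa [← mul_assoc] using hKP 1 (by norm_num) (6 * 3) (by norm_num) (by norm_num))
    refine norm_inv_smul_le hh0 ?_
    have e : gridRef v z h t (nbr I p) - gridRef v z h t I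
        = (v t (center h (nbr I p)) - v t (center h I))
          + h ^ 2 • (z t h (center h (nbr I p)) - z t h (center h I)) := by
      simp only [gridRef]; module
    rw [e]
    refine (norm_add_le _ _).trans ?_
    rw [norm_smul, Real.norm_eq_abs, abs_of_pos (by positivity)]
    have b1 := hsp.nbr_diff (by linarith) hh0 hN I p
    have b2 := norm_sub_le_two_mul (hz (nbr I p)) (hz I)
    calc _ ≤ K * h + h ^ 2 * (2 * K) := by gcongr
      _ = K * h + h * (2 * (h * K)) := by ring
      _ ≤ K * h + h * (2 * (1 * K)) := by gcongr
      _ = _ := by ring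
  · exact (hlap_le I).trans (by
      simpa using hKP 1 (by norm_num) 13 (by norm_num) (by norm_num))
  · have hu := hD.ref_unit t ht h hh _ (m I)
    have hv := hD.base_unit t ht _ (m I)
    set u := gridRef v z h t I with hu'
    have hcorr : ∑ p, (z t h (center h (nbr I p)) - z t h (center h I))
        = -((24 * ε)⁻¹ • ∑ p, (S t (center h (nbr I p)) - S t (center h I)))
          + h ^ 2 • ∑ p, (ρ t h (center h (nbr I p)) - ρ t h (center h I)) := by
      rw [Finset.smul_sum, Finset.smul_sum, ← Finset.sum_neg_distrib, ← Finset.sum_add_distrib]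
      refine Finset.sum_congr rfl fun p _ => ?_
      rw [(hD.corr_eq t ht h hh _ (m _)).1, (hD.corr_eq t ht h hh _ (m I)).1]
      module
    set Rs := ∑ p, (ρ t h (center h (nbr I p)) - ρ t h (center h I)) with hRs
    set v0 := v t (center h I) with hv0
    set Sg := ∑ p, (S t (center h (nbr I p)) - S t (center h I)) with hSg
    have hR : ‖Rs‖ ≤ 6 * (2 * K) :=
      norm_sum_nbr_sub_le (f := fun J => ρ t h (center h J)) hD.d_le (by positivity) I fun p =>
        norm_sub_le_two_mul (hD.corr_eq t ht h hh _ (m _)).2 (hD.corr_eq t ht h hh _ (m I)).2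
    have e : perp u (ε • lap h (gridRef v z h t) I) - S t (center h I)
        = (perp u (ε • lap h (gridRef v z h t) I) - perp v0 (ε • lap h (gridRef v z h t) I))
          + (perp v0 (ε • lap h (fun J => v t (center h J)) I) - S t (center h I)
            - (1 / 24 : ℝ) • perp v0 Sg) + (ε * h ^ 2) • perp v0 Rs := by
      have e1 : ε • lap h (gridRef v z h t) I = ε • lap h (fun J => v t (center h J)) I
          - (1 / 24 : ℝ) • Sg + (ε * h ^ 2) • Rs := by
        rw [hlap, hcorr, smul_add, smul_add, smul_neg, smul_smul, smul_smul]
        have : ε * (24 * ε)⁻¹ = 1 / 24 := by field_simp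
        rw [this]; abel
      have e2 : perp v0 (ε • lap h (gridRef v z h t) I)
          = perp v0 (ε • lap h (fun J => v t (center h J)) I) - (1 / 24 : ℝ) • perp v0 Sg
            + (ε * h ^ 2) • perp v0 Rs := by
        rw [e1, perp_add, perp_sub, perp_smul (1 / 24), perp_smul (ε * h ^ 2)]
      rw [e2]; abel
    rw [e]
    have b1 : ‖perp u (ε • lap h (gridRef v z h t) I) - perp v0 (ε • lap h (gridRef v z h t) I)‖
        ≤ 2 * (h ^ 2 * K) * (K * (13 * K)) := by
      refine (norm_perp_sub_perp_le hu hv _).trans ?_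
      have : v t (center h I) + h ^ 2 • z t h (center h I) - v t (center h I)
          = h ^ 2 • z t h (center h I) := by abel
      rw [this, norm_smul, norm_smul, Real.norm_eq_abs, Real.norm_eq_abs, abs_of_pos hε,
        abs_of_pos (by positivity)]
      gcongr
      exacts [hz I, hD.ε_le, hlap_le I]
    have b2 := hsp.perp_lap hh0 hh1 hN hN2 I
    have b3 : ‖(ε * h ^ 2) • perp v0 Rs‖ ≤ K * h ^ 2 * (6 * (2 * K)) := by
      rw [norm_smul, Real.norm_eq_abs, abs_of_pos (by positivity)]
      gcongr
      · exact hD.ε_le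
      · exact (norm_perp_le hv _).trans hR
    refine (norm_add_le _ _).trans ((add_le_add ((norm_add_le _ _).trans
      (add_le_add b1 b2)) b3).trans ?_)
    have k1 : K ≤ K ^ 3 := by simpa using pow_le_pow_right₀ hK (by norm_num : 1 ≤ 3)
    have k2 : K ^ 2 ≤ K ^ 3 := pow_le_pow_right₀ hK (by norm_num)
    calc _ = (26 * K ^ 3 + K + 12 * K ^ 2) * h ^ 2 := by ring
      _ ≤ (26 * K ^ 3 + K ^ 3 + 12 * K ^ 3) * h ^ 2 := by gcongr
      _ = 39 * K ^ 3 * h ^ 2 := by ring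
      _ ≤ _ := by
        gcongr
        exact hKP 3 (by norm_num) 39 (by norm_num) (by norm_num)

/-- Interpolation between the smallness of `w₂ - w₁` and the regularity of both functions. -/
theorem sq_norm_nbr_diff_le {w₁ w₂ S₁ S₂ : Space d → Vec3} (hK : 0 ≤ K)
    (h₁ : SpatialBound L ε K w₁ S₁) (h₂ : SpatialBound L ε K w₂ S₂) (hh : 0 < h) (hk : 0 < k)
    (hw : ∀ x ∈ closedBox L, ‖w₂ x - w₁ x‖ ≤ K * k) {i : Fin d} (hhL : 2 * h ≤ L i)
    (hkL : 4 * k ≤ L i ^ 2) (hL : 0 < L i) {σ : ℝ} (hσ : σ = 1 ∨ σ = -1) {x : Space d}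
    (hx : x ∈ closedBox L) (hx' : x + h • σ • axis i ∈ closedBox L) :
    ‖h⁻¹ • ((w₂ (x + h • σ • axis i) - w₁ (x + h • σ • axis i)) - (w₂ x - w₁ x))‖ ^ 2
      ≤ 16 * K ^ 2 * (k + h ^ 2) := by
  -- A step of length √k balances the time smallness k/l against the spatial error l; shorter than
  -- one cell is not possible.
  set l := max h (Real.sqrt k) with hl
  have hl0 : 0 < l := hh.trans_le (le_max_left _ _)
  have hsq : Real.sqrt k ^ 2 = k := Real.sq_sqrt hk.le
  have hlL : 2 * l ≤ L i := by
    rcases max_choice h (Real.sqrt k) with e | e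
    · rw [hl, e]; exact hhL
    · rw [hl, e]
      refine abs_le_of_sq_le_sq' ?_ hL.le |>.2
      rw [mul_pow, hsq]; linarith
  have hkl : k ≤ l ^ 2 := by
    rw [← hsq]; gcongr; exact le_max_right _ _
  have hl2 : l ^ 2 ≤ k + h ^ 2 := by
    rcases max_choice h (Real.sqrt k) with e | e
    · rw [hl, e]; linarith
    · rw [hl, e, hsq]; linarith [sq_nonneg h]
  -- the estimate starting from a point from which the longer step stays in the box
  have key : ∀ {σ : ℝ}, (σ = 1 ∨ σ = -1) → ∀ {x : Space d}, x ∈ closedBox L →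
      x + l • σ • axis i ∈ closedBox L →
      ‖h⁻¹ • ((w₂ (x + h • σ • axis i) - w₁ (x + h • σ • axis i)) - (w₂ x - w₁ x))‖ ^ 2
        ≤ 16 * K ^ 2 * (k + h ^ 2) := by
    intro σ hσ x hx hxl
    have hθ := norm_smul_axis_le hσ i
    have s1 := h₁.scale hθ hh (le_max_left _ _) hx hxl
    have s2 := h₂.scale hθ hh (le_max_left _ _) hx hxl
    have g1 := hw _ hx
    have g2 := hw _ hxl
    set D := (w₂ (x + h • σ • axis i) - w₁ (x + h • σ • axis i)) - (w₂ x - w₁ x) with hDdef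
    have e : (l / h) • D
        = (w₂ (x + l • σ • axis i) - w₁ (x + l • σ • axis i)) - (w₂ x - w₁ x)
          + (w₁ (x + l • σ • axis i) - w₁ x - (l / h) • (w₁ (x + h • σ • axis i) - w₁ x))
          - (w₂ (x + l • σ • axis i) - w₂ x - (l / h) • (w₂ (x + h • σ • axis i) - w₂ x)) := by
      rw [hDdef]; module
    have b : ‖(l / h) • D‖ ≤ (K * k + K * k) + K * l ^ 2 + K * l ^ 2 := by
      rw [e]
      exact (norm_sub_le _ _).trans (add_le_add ((norm_add_le _ _).trans
        (add_le_add ((norm_sub_le _ _).trans (add_le_add g2 g1)) s1)) s2)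
    have b2 : l * ‖h⁻¹ • D‖ ≤ l * (4 * K * l) := by
      have e2 : l * ‖h⁻¹ • D‖ = ‖(l / h) • D‖ := by
        rw [div_eq_mul_inv, mul_smul, norm_smul l, Real.norm_eq_abs, abs_of_pos hl0]
      rw [e2]
      refine b.trans ?_
      nlinarith
    have b3 := le_of_mul_le_mul_left b2 hl0
    calc _ ≤ (4 * K * l) ^ 2 := by gcongr
      _ = 16 * K ^ 2 * l ^ 2 := by ring
      _ ≤ _ := by gcongr
  set y := x + h • σ • axis i with hy
  have hyi : y i = x i + h * σ := by simp [hy]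
  have mem : ∀ {σ : ℝ} {x : Space d}, x ∈ closedBox L → x i + l * σ ∈ Icc 0 (L i) →
      x + l • σ • axis i ∈ closedBox L := by
    intro σ x hx hr j
    by_cases hij : j = i
    · subst hij; simpa using hr
    · simpa [hij] using hx j
  have back : y + h • (-σ) • axis i = x := by rw [hy]; module
  have swap : ‖h⁻¹ • ((w₂ y - w₁ y) - (w₂ x - w₁ x))‖
      = ‖h⁻¹ • ((w₂ (y + h • (-σ) • axis i) - w₁ (y + h • (-σ) • axis i)) - (w₂ y - w₁ y))‖ := by
    rw [back, ← norm_neg, ← smul_neg, neg_sub]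
  have hσ' : -σ = 1 ∨ -σ = -1 := by rcases hσ with rfl | rfl <;> norm_num
  have hxi := hx i
  have hyi' := hx' i
  -- Since l ≤ L i / 2, the long step fits if it points from the half containing its base point
  -- towards the other one. If the given step points outwards, it is reversed and based at its end
  -- point.
  rcases le_total (x i) (L i / 2) with hx2 | hx2
  · rcases hσ with rfl | rfl
    · exact key (Or.inl rfl) hx (mem hx ⟨by linarith [hxi.1], by linarith⟩)
    · rw [swap]
      refine key hσ' hx' (mem hx' ?_)
      constructor <;> linarith [hyi'.1]
  · rcases hσ with rfl | rfl
    · rw [swap]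
      refine key hσ' hx' (mem hx' ?_)
      constructor <;> linarith [hyi'.2]
    · exact key (Or.inr rfl) hx (mem hx ⟨by linarith, by linarith [hxi.2]⟩)

end Level

end Reference

end LLG

/-! ### The corrected reference solution: increments and residuals in time. -/

namespace LLG

open scoped RealInnerProductSpace

section Reference

variable {d : ℕ} {L : Fin d → ℝ} {T α ε Q K : ℝ} {he v v' S : ℝ → Space d → Vec3}
  {z ρ : ℝ → ℝ → Space d → Vec3} {N : Fin d → ℕ} {h k t : ℝ}

/-- The uncorrected part is handled by interpolation. For the correction, h² divided by h still
leaves a factor h, so its Lipschitz bound in time suffices, together with k ≤ √(k + h²). -/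
theorem RefData.refIncr (hD : RefData L T α ε Q K he v v' S z ρ) (ht : t ∈ Icc 0 T)
    (htk : t + k ∈ Icc 0 T) (hh : h ∈ Ioc (0 : ℝ) 1) (hk : 0 < k) (hk1 : k ≤ 1)
    (hN : ∀ i, (N i : ℝ) * h = L i) (hL : ∀ i, 0 < L i) (hhL : ∀ i, 2 * h ≤ L i)
    (hkL : ∀ i, 4 * k ≤ L i ^ 2) {P : ℝ} (hP : 2000 * K ^ 4 ≤ P) :
    RefIncr P h k (gridRef v z h t : GridFun N) (fun I => S t (center h I)) (gridRef v z h (t + k))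
      (fun I => S (t + k) (center h I)) := by
  have hK := hD.one_le
  have hh0 := hh.1
  have hh1 := hh.2
  have m := fun J : Index N => center_mem_closedBox hh.1 hN J
  have hKP : K ≤ P := by
    refine le_trans ?_ hP
    have : K ≤ K ^ 4 := by simpa using pow_le_pow_right₀ hK (by norm_num : 1 ≤ 4)
    linarith
  have lip : ∀ {f : ℝ → Vec3}, DiffBound T K f → ‖f (t + k) - f t‖ ≤ K * k := by
    intro f hf
    have := hf.lip _ htk _ ht
    rwa [add_sub_cancel_left, abs_of_pos hk] at this
  refine ⟨fun I => (lip (hD.ref h hh _ (m I))).trans (by gcongr),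
    fun I => (lip (hD.exch _ (m I))).trans (by gcongr), fun I => ?_⟩
  set r := Real.sqrt (k + h ^ 2) with hr
  have hr2 : r ^ 2 = k + h ^ 2 := Real.sq_sqrt (by positivity)
  have hr0 : 0 ≤ r := Real.sqrt_nonneg _
  have hkr : k ≤ r := by
    refine abs_le_of_sq_le_sq' ?_ hr0 |>.2
    rw [hr2]
    nlinarith [sq_nonneg h]
  have hcomp : ∀ p, ‖h⁻¹ • ((gridRef v z h (t + k) - gridRef v z h t : GridFun N) (nbr I p)
      - (gridRef v z h (t + k) - gridRef v z h t : GridFun N) I)‖ ≤ 6 * K * r := by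
    intro p
    rcases center_nbr h I p with e | ⟨σ, hσ, e⟩
    · rw [e, sub_self, smul_zero, norm_zero]; positivity
    · have e1 : (gridRef v z h (t + k) - gridRef v z h t : GridFun N) (nbr I p)
          - (gridRef v z h (t + k) - gridRef v z h t : GridFun N) I
          = ((v (t + k) (center h (nbr I p)) - v t (center h (nbr I p)))
              - (v (t + k) (center h I) - v t (center h I)))
            + h ^ 2 • ((z (t + k) h (center h (nbr I p)) - z t h (center h (nbr I p)))
              - (z (t + k) h (center h I) - z t h (center h I))) := by
        simp only [Pi.sub_apply, gridRef]; module
      rw [e1, smul_add]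
      have b1 := sq_norm_nbr_diff_le (by linarith) (hD.spatial t ht) (hD.spatial _ htk) hh0 hk
        (fun x hx => lip (f := fun t => v t x) (hD.base x hx)) (hhL p.1) (hkL p.1) (hL p.1) hσ (m I)
        (by rw [← e]; exact m _)
      rw [← e, ← hr2] at b1
      set D := h⁻¹ • ((v (t + k) (center h (nbr I p)) - v t (center h (nbr I p)))
        - (v (t + k) (center h I) - v t (center h I)))
      have b2 : ‖D‖ ≤ 4 * K * r := by
        refine abs_le_of_sq_le_sq' (b1.trans_eq ?_) (by positivity) |>.2
        ring
      have b3 := norm_sub_le_two_mul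
        (lip (f := fun t => z t h (center h (nbr I p))) (hD.corr h hh _ (m (nbr I p))))
        (lip (f := fun t => z t h (center h I)) (hD.corr h hh _ (m I)))
      refine (norm_add_le _ _).trans ((add_le_add b2 (norm_inv_smul_le (c := 2 * K * r) hh0
        ?_)).trans (by linarith))
      rw [norm_smul, Real.norm_eq_abs, abs_of_pos (by positivity)]
      calc _ ≤ h ^ 2 * (2 * (K * k)) := by gcongr
        _ = h * (2 * K * (h * k)) := by ring
        _ ≤ h * (2 * K * (1 * r)) := by gcongr
        _ = _ := by ring
  have hg := norm_grad_le_six hD.d_le (by positivity) I hcomp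
  calc _ ≤ (6 * (6 * K * r)) ^ 2 := by gcongr
    _ = 1296 * K ^ 2 * r ^ 2 := by ring
    _ ≤ _ := by
      rw [hr2]
      gcongr
      refine le_trans ?_ hP
      have : K ^ 2 ≤ K ^ 4 := pow_le_pow_right₀ hK (by norm_num)
      linarith [sq_nonneg K]

/-- Extrapolation and averaging approximate the value at the midpoint to second order. -/
theorem DiffBound.norm_extrap_sub_le {f : ℝ → Vec3} (hK : 0 ≤ K) (hf : DiffBound T K f)
    (hk : 0 < k) (h0 : t - k ∈ Icc 0 T) (h1 : t + k ∈ Icc 0 T) :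
    ‖(1 / 2 : ℝ) • ((3 : ℝ) • f t - f (t - k)) - f (t + k / 2)‖ ≤ K * k ^ 2 ∧
      ‖(1 / 2 : ℝ) • (f (t + k) + f t) - f (t + k / 2)‖ ≤ K * k ^ 2 := by
  have m2 : t + k / 2 - k / 2 ∈ Icc 0 T := ⟨by linarith [h0.1], by linarith [h1.2]⟩
  have m3 : t + k / 2 + k / 2 ∈ Icc 0 T := by rwa [add_assoc, add_halves]
  have d1 := hf.diff2 t k hk.le h0 h1
  have d2 := hf.diff2 (t + k / 2) (k / 2) (by positivity) m2 m3
  rw [add_assoc, add_halves, add_sub_cancel_right] at d2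
  have hKk : 0 ≤ K * k ^ 2 := by positivity
  have e2 : (1 / 2 : ℝ) • (f (t + k) + f t) - f (t + k / 2)
      = (1 / 2 : ℝ) • (f (t + k) - (2 : ℝ) • f (t + k / 2) + f t) := by module
  have b2 : ‖(1 / 2 : ℝ) • (f (t + k) + f t) - f (t + k / 2)‖ ≤ K * k ^ 2 / 8 := by
    rw [e2, norm_smul]
    norm_num
    linarith
  refine ⟨?_, b2.trans (by linarith)⟩
  have e1 : (1 / 2 : ℝ) • ((3 : ℝ) • f t - f (t - k)) - f (t + k / 2)
      = ((1 / 2 : ℝ) • (f (t + k) + f t) - f (t + k / 2))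
        - (1 / 2 : ℝ) • (f (t + k) - (2 : ℝ) • f t + f (t - k)) := by module
  rw [e1]
  refine (norm_sub_le _ _).trans ((add_le_add_left b2 _).trans ?_)
  rw [norm_smul]
  norm_num
  linarith

/-- Extrapolated, averaged and differenced quantities are all compared with their values at t + k/2,
where the exact equation holds. The correction contributes O(h²), even after division by k, because
z is Lipschitz in time. -/
theorem RefData.norm_midpoint_le (hD : RefData L T α ε Q K he v v' S z ρ) (h0 : t - k ∈ Icc 0 T)
    (h1 : t + k ∈ Icc 0 T) (hh : h ∈ Ioc (0 : ℝ) 1) (hk : 0 < k) {x : Space d}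
    (hx : x ∈ closedBox L) {u : ℝ → Vec3} (hu : ∀ s, u s = v s x + h ^ 2 • z s h x) {F : Vec3}
    (hF : F = (1 / 2 : ℝ) • ((3 : ℝ) • lowerField Q (u t) (he t x)
      - lowerField Q (u (t - k)) (he (t - k) x))) :
    ‖F‖ ≤ 4 * K ∧
    ‖k⁻¹ • (u (t + k) - u t) - llgRhs α ((1 / 2 : ℝ) • ((3 : ℝ) • u t - u (t - k)))
      ((1 / 2 : ℝ) • (S (t + k) x + S t x) + F)‖ ≤ 11 * K ^ 3 * (k ^ 2 + h ^ 2) := by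
  have hK := hD.one_le
  have hα := hD.α_pos
  have hh0 := hh.1
  have ht : t ∈ Icc 0 T := mem_Icc_of_sub_add hk.le h0 h1
  have hm : t + k / 2 ∈ Icc 0 T := ⟨by linarith [ht.1], by linarith [h1.2]⟩
  set τ := k ^ 2 + h ^ 2 with hτ
  have hkτ : k ^ 2 ≤ τ := by rw [hτ]; linarith [sq_nonneg h]
  have hτ0 : 0 ≤ τ := by positivity
  have hub : DiffBound T K u := by
    have := hD.ref h hh x hx
    rwa [show (fun t => v t x + h ^ 2 • z t h x) = u from funext fun s => (hu s).symm] at this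
  have hun : ∀ s ∈ Icc 0 T, ‖u s‖ = 1 := fun s hs => by
    rw [hu]; exact hD.ref_unit s hs h hh x hx
  set um := (1 / 2 : ℝ) • ((3 : ℝ) • u t - u (t - k)) with hum
  set hm' := (1 / 2 : ℝ) • ((3 : ℝ) • he t x - he (t - k) x) with hhm
  set Sm := (1 / 2 : ℝ) • (S (t + k) x + S t x) with hSm
  set c := t + k / 2 with hc
  have hFe : F = lowerField Q um hm' := by
    rw [hF, lowerField_smul, lowerField_sub, lowerField_smul]
  have hum2 : ‖um‖ ≤ 2 := by
    rw [hum, norm_smul]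
    have := norm_sub_le ((3 : ℝ) • u t) (u (t - k))
    rw [norm_smul, hun t ht, hun _ h0] at this
    norm_num at this ⊢
    linarith
  have hhm2 : ‖hm'‖ ≤ 2 * K := by
    rw [hhm, norm_smul]
    have := norm_sub_le ((3 : ℝ) • he t x) (he (t - k) x)
    rw [norm_smul] at this
    have b1 := (hD.field x hx).bound t ht
    have b2 := (hD.field x hx).bound _ h0
    norm_num at this ⊢
    linarith
  have hFn : ‖F‖ ≤ 4 * K := by
    rw [hFe]
    refine (norm_lowerField_le _ _ _).trans ?_
    have : |Q| * ‖um‖ ≤ K * 2 := by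
      gcongr; exact hD.Q_le
    linarith
  refine ⟨hFn, ?_⟩
  have hv1 := hD.base_unit c hm x hx
  have huc : ‖u c - v c x‖ ≤ K * h ^ 2 := by
    rw [hu, add_sub_cancel_left, norm_smul, Real.norm_eq_abs, abs_of_pos (by positivity), mul_comm]
    gcongr
    exact (hD.corr h hh x hx).bound c hm
  have humv : ‖um - v c x‖ ≤ K * τ := by
    have b := (hub.norm_extrap_sub_le (by linarith) hk h0 h1).1
    have := norm_add_le (um - u c) (u c - v c x)
    rw [sub_add_sub_cancel] at this
    have : K * τ = K * k ^ 2 + K * h ^ 2 := by rw [hτ]; ring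
    linarith
  have hSc : ‖Sm - S c x‖ ≤ K * τ :=
    ((hD.exch x hx).norm_extrap_sub_le (by linarith) hk h0 h1).2.trans (by gcongr)
  have hhc : ‖hm' - he c x‖ ≤ K * τ :=
    ((hD.field x hx).norm_extrap_sub_le (by linarith) hk h0 h1).1.trans (by gcongr)
  have hFc : ‖F - lowerField Q (v c x) (he c x)‖ ≤ K * (K * τ) + K * τ := by
    rw [hFe, lowerField_sub]
    refine (norm_lowerField_le _ _ _).trans ?_
    gcongr
    exact hD.Q_le
  have hSmn : ‖Sm‖ ≤ K := by
    rw [hSm, norm_smul]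
    have := norm_add_le (S (t + k) x) (S t x)
    have b1 := (hD.exch x hx).bound t ht
    have b2 := (hD.exch x hx).bound _ h1
    norm_num
    linarith
  -- difference quotient in time
  have hquot : ‖k⁻¹ • (u (t + k) - u t) - v' c x‖ ≤ K * τ := by
    have m2 : c - k / 2 ∈ Icc 0 T := by rwa [hc, add_sub_cancel_right]
    have m3 : c + k / 2 ∈ Icc 0 T := by rwa [hc, add_assoc, add_halves]
    have b1 := norm_central_diff_le (hD.hasDeriv x hx) (hD.deriv x hx) (by linarith)
      (by positivity : 0 ≤ k / 2) m2 m3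
    rw [hc, add_assoc, add_halves, add_sub_cancel_right, ← hc, mul_div_cancel₀ _ two_ne_zero] at b1
    have b2 := (hD.corr h hh x hx).lip _ h1 t ht
    rw [add_sub_cancel_left, abs_of_pos hk] at b2
    have e : k⁻¹ • (u (t + k) - u t) - v' c x
        = k⁻¹ • ((v (t + k) x - v t x - k • v' c x) + h ^ 2 • (z (t + k) h x - z t h x)) := by
      have : v' c x = k⁻¹ • k • v' c x := by rw [smul_smul, inv_mul_cancel₀ hk.ne', one_smul]
      rw [hu, hu]
      nth_rewrite 1 [this]
      module
    rw [e]
    refine norm_inv_smul_le hk ((norm_add_le _ _).trans ?_)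
    rw [norm_smul, Real.norm_eq_abs, abs_of_pos (by positivity)]
    have b3 : h ^ 2 * ‖z (t + k) h x - z t h x‖ ≤ h ^ 2 * (K * k) := by gcongr
    have : 0 ≤ K * k ^ 3 := by positivity
    have : k * (K * τ) = K * k ^ 3 + h ^ 2 * (K * k) := by rw [hτ]; ring
    have : K * (k / 2) ^ 3 = K * k ^ 3 / 8 := by ring
    linarith
  have e : k⁻¹ • (u (t + k) - u t) - llgRhs α um (Sm + F)
      = (k⁻¹ • (u (t + k) - u t) - v' c x)
        - (llgRhs α um (Sm + F) - llgRhs α (v c x) (Sm + F))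
        - llgRhs α (v c x) ((Sm - S c x) + (F - lowerField Q (v c x) (he c x))) := by
    rw [← hD.eqn c hm x hx]
    have : Sm - S c x + (F - lowerField Q (v c x) (he c x))
      = (Sm + F) - (S c x + lowerField Q (v c x) (he c x)) := by abel
    rw [this, llgRhs_sub]; abel
  rw [e]
  have q1 : ‖llgRhs α um (Sm + F) - llgRhs α (v c x) (Sm + F)‖ ≤ K * (K * τ) * (5 * K) := by
    refine (norm_llgRhs_sub_le _ _ _ _).trans ?_
    rw [abs_of_pos hα, hv1]
    gcongr
    · nlinarith [hD.α_le]
    · exact (norm_add_le _ _).trans (by linarith)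
  have q2 : ‖llgRhs α (v c x) ((Sm - S c x) + (F - lowerField Q (v c x) (he c x)))‖
      ≤ K * (K * τ + (K * (K * τ) + K * τ)) := by
    refine (norm_llgRhs_le _ _ _).trans ?_
    rw [abs_of_pos hα, hv1, one_mul, mul_one]
    gcongr
    · linarith [hD.α_le]
    · exact (norm_add_le _ _).trans (add_le_add hSc hFc)
  refine (norm_sub_le _ _).trans ((add_le_add ((norm_sub_le _ _).trans
    (add_le_add hquot q1)) q2).trans ?_)
  have k1 : K ≤ K ^ 3 := by simpa using pow_le_pow_right₀ hK (by norm_num : 1 ≤ 3)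
  have k2 : K ^ 2 ≤ K ^ 3 := pow_le_pow_right₀ hK (by norm_num)
  calc _ = (K + 2 * K ^ 2 + 6 * K ^ 3) * τ := by ring
    _ ≤ (K ^ 3 + 2 * K ^ 3 + 6 * K ^ 3) * τ := by gcongr
    _ = 9 * K ^ 3 * τ := by ring
    _ ≤ _ := by gcongr; norm_num

/-- The corrected reference solution satisfies the scheme up to a residual of second order. -/
theorem RefData.refAt (hD : RefData L T α ε Q K he v v' S z ρ) (hh : h ∈ Ioc (0 : ℝ) 1)
    (hk : 0 < k) (hk1 : k ≤ 1) (hN : ∀ i, (N i : ℝ) * h = L i) (hN2 : ∀ i, 2 ≤ N i)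
    (hL : ∀ i, 0 < L i) (hhL : ∀ i, 2 * h ≤ L i) (hkL : ∀ i, 4 * k ≤ L i ^ 2)
    (hvol : ∏ i, L i ≤ K) {K' : ℝ} (hK' : 100000 * (2000 * K ^ 4) ^ 25 ≤ K') {n : ℕ} (hn : 1 ≤ n)
    (hnT : ((n + 1 : ℕ) : ℝ) * k ≤ T) :
    RefAt K' h k α ε Q he (fun n => (gridRef v z h (n * k) : GridFun N)) n := by
  have hK := hD.one_le
  set P := 2000 * K ^ 4 with hP
  have hK4 : ∀ j ≤ 4, K ^ j ≤ K ^ 4 := fun j hj => pow_le_pow_right₀ hK hj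
  have k0 := hK4 0 (by norm_num)
  have k1 := hK4 1 (by norm_num)
  have k3 := hK4 3 (by norm_num)
  rw [pow_zero] at k0
  rw [pow_one] at k1
  have e0 : ((n - 1 : ℕ) : ℝ) * k = n * k - k := by
    rw [Nat.cast_sub hn]; push_cast; ring
  have e1 : ((n + 1 : ℕ) : ℝ) * k = n * k + k := by push_cast; ring
  have hn1 : (1 : ℝ) ≤ n := by exact_mod_cast hn
  have m0 : (n : ℝ) * k - k ∈ Icc 0 T := ⟨by nlinarith, by rw [e1] at hnT; linarith⟩
  have m1 : (n : ℝ) * k + k ∈ Icc 0 T := ⟨by positivity, by rwa [← e1]⟩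
  have m : (n : ℝ) * k ∈ Icc 0 T := mem_Icc_of_sub_add hk.le m0 m1
  have hcp : ConsParam P h k α ε := by
    refine ⟨by linarith, hh.1, hk, hh.2, hk1, hD.α_pos, hD.ε_pos, ?_, ?_, ?_⟩
    · linarith [hD.α_le]
    · linarith [hD.ε_le]
    · linarith [hD.inv_ε_le]
  have i1 := hD.refIncr (N := N) m0 (by rwa [sub_add_cancel]) hh hk hk1 hN hL hhL hkL le_rfl
  rw [sub_add_cancel] at i1
  have i2 := hD.refIncr (N := N) m m1 hh hk hk1 hN hL hhL hkL le_rfl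
  have mid := fun I : Index N => hD.norm_midpoint_le m0 m1 hh hk (center_mem_closedBox hh.1 hN I)
    (u := fun s => gridRef v z h s I) (fun s => rfl) rfl
  have := refStep_and_refResidual hcp (hD.refLevel m0 hh hN hN2 le_rfl)
    (hD.refLevel m hh hN hN2 le_rfl) (hD.refLevel m1 hh hN hN2 le_rfl) i1 i2
    (F := extrapolate (gridField Q h k he fun n => (gridRef v z h (n * k) : GridFun N)) n)
    (fun I => ((hD.ref h hh _ (center_mem_closedBox hh.1 hN I)).diff2 (n * k) k hk.le m0 m1).trans
      (by gcongr; linarith))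
    (fun I => by
      have := (mid I).1
      simp only [extrapolate, gridField, e0]
      exact this.trans (by linarith))
    (fun I => by
      have := (mid I).2
      simp only [extrapolate, gridField, e0]
      refine this.trans ?_
      gcongr
      linarith)
    (by rw [gridSum_const hN, mul_one]; linarith) hK'
  obtain ⟨R, hR1, hR2⟩ := this
  refine ⟨R, ?_, ?_⟩
  · have eX : halfField ε Q h k he (fun n => (gridRef v z h (n * k) : GridFun N)) n = fun I =>
        ε • lap h ((1 / 2 : ℝ) • (gridRef v z h (n * k + k) + gridRef v z h (n * k))) I
          + extrapolate (gridField Q h k he fun n => (gridRef v z h (n * k) : GridFun N)) n I := by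
      ext1 I; simp only [halfField, e1]
    simp only [eX, e0, e1]
    exact hR1
  · simp only [e0, e1]
    exact hR2

/-- Both z and its difference quotients are bounded, so replacing the exact solution by the
corrected one changes errors by O(h²) in discrete H¹. -/
theorem RefData.h1Sq_corr_le (hD : RefData L T α ε Q K he v v' S z ρ) (ht : t ∈ Icc 0 T)
    (hh : h ∈ Ioc (0 : ℝ) 1) (hN : ∀ i, (N i : ℝ) * h = L i) (hN2 : ∀ i, 2 ≤ N i)
    (hvol : ∏ i, L i ≤ K) :
    h1Sq h (gridRef v z h t - fun I => v t (center h I) : GridFun N) ≤ 163 * K ^ 5 * h ^ 4 := by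
  have hK := hD.one_le
  have hh0 := hh.1
  have m := fun J : Index N => center_mem_closedBox hh.1 hN J
  have e : ∀ I : Index N, (gridRef v z h t - fun I => v t (center h I) : GridFun N) I
      = h ^ 2 • z t h (center h I) := fun I => by simp [gridRef]
  have b1 : ∀ I : Index N, ‖(gridRef v z h t - fun I => v t (center h I) : GridFun N) I‖ ^ 2
      ≤ (h ^ 2 * K) ^ 2 := by
    intro I
    rw [e, norm_smul, Real.norm_eq_abs, abs_of_pos (by positivity)]
    gcongr
    exact hD.corr_le ht hh (m I)
  have b2 : ∀ I : Index N,
      ‖grad h (gridRef v z h t - fun I => v t (center h I) : GridFun N) I‖ ^ 2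
      ≤ (6 * (h ^ 2 * (3 * K ^ 2))) ^ 2 := by
    intro I
    gcongr
    refine norm_grad_le_six hD.d_le (by positivity) I fun p => norm_inv_smul_le hh0 ?_
    rw [e, e, ← smul_sub, norm_smul, Real.norm_eq_abs, abs_of_pos (by positivity)]
    calc _ ≤ h ^ 2 * (3 * K ^ 2 * h) := by gcongr; exact hD.corr_diff ht hh hN hN2 I p
      _ = _ := by ring
  have s1 := gridSum_mono hh0 b1
  have s2 := gridSum_mono hh0 b2
  rw [gridSum_const hN] at s1 s2
  rw [h1Sq]
  have k3 : K ^ 3 ≤ K ^ 5 := pow_le_pow_right₀ hK (by norm_num)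
  have t1 : (∏ i, L i) * (h ^ 2 * K) ^ 2 ≤ K * (h ^ 2 * K) ^ 2 := by gcongr
  have t2 : (∏ i, L i) * (6 * (h ^ 2 * (3 * K ^ 2))) ^ 2 ≤ K * (6 * (h ^ 2 * (3 * K ^ 2))) ^ 2 := by
    gcongr
  have t3 : K ^ 3 * h ^ 4 ≤ K ^ 5 * h ^ 4 := by gcongr
  linarith

end Reference

end LLG

/-! ### Construction of the corrected solution from the exact one. -/

namespace LLG

open scoped RealInnerProductSpace

section Construction

variable {d : ℕ} {L : Fin d → ℝ} {T α ε Q : ℝ}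

/-- The sum equals ((1 - q) v - h² s)/(1 + q) with 4q = h⁴|s|², a rational parametrization of a
circle in the sphere. It avoids the square root of a normalization, so products and one inverse
suffice for the bounds in time. -/
theorem norm_add_correction_eq_one {v s : Vec3} (hv : ‖v‖ = 1) (hs : ⟪v, s⟫ = 0) (h : ℝ) :
    ‖v + h ^ 2 • (1 + h ^ 4 / 4 * ⟪s, s⟫)⁻¹ • (-s - (h ^ 2 / 2 * ⟪s, s⟫) • v)‖ = 1 := by
  have hss : 0 ≤ ⟪s, s⟫ := real_inner_self_nonneg
  set q := h ^ 4 / 4 * ⟪s, s⟫ with hq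
  have hq0 : 0 ≤ q := by positivity
  have e : v + h ^ 2 • (1 + q)⁻¹ • (-s - (h ^ 2 / 2 * ⟪s, s⟫) • v)
      = (1 + q)⁻¹ • ((1 - q) • v - h ^ 2 • s) := by
    have e1 : v = (1 + q)⁻¹ • (1 + q) • v := by
      rw [smul_smul, inv_mul_cancel₀ (by positivity), one_smul]
    nth_rewrite 1 [e1]
    rw [hq]
    module
  have e2 : ‖(1 - q) • v - h ^ 2 • s‖ ^ 2 = (1 + q) ^ 2 := by
    rw [norm_sub_sq_real, norm_smul, norm_smul, inner_smul_left, inner_smul_right, hs, hv, mul_pow,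
      mul_pow, Real.norm_eq_abs, Real.norm_eq_abs, sq_abs, sq_abs]
    have : h ^ 4 * ⟪s, s⟫ = 4 * q := by rw [hq]; ring
    rw [real_inner_self_eq_norm_sq] at this
    simp
    linarith
  have e3 : ‖(1 - q) • v - h ^ 2 • s‖ = 1 + q := by
    rw [← abs_norm, ← abs_of_nonneg (by positivity : 0 ≤ 1 + q), ← sq_eq_sq_iff_abs_eq_abs, e2]
  rw [e, norm_smul, e3, norm_inv, Real.norm_eq_abs, abs_of_nonneg (by positivity),
    inv_mul_cancel₀ (by positivity)]

theorem inner_deriv_eq_zero (hT : 0 < T) {v v' : ℝ → Vec3} (hv : ∀ t ∈ Icc 0 T, ‖v t‖ = 1)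
    {t : ℝ} (ht : t ∈ Icc 0 T) (hd : HasDerivWithinAt v (v' t) (Icc 0 T) t) : ⟪v t, v' t⟫ = 0 := by
  have h1 := hd.inner ℝ hd
  have h2 : HasDerivWithinAt (fun t => ⟪v t, v t⟫) 0 (Icc 0 T) t :=
    (hasDerivWithinAt_const t (Icc 0 T) (1 : ℝ)).congr
      (fun s hs => by rw [real_inner_self_eq_norm_sq, hv s hs, one_pow])
      (by rw [real_inner_self_eq_norm_sq, hv t ht, one_pow])
  have := (uniqueDiffOn_Icc hT t ht).eq_deriv _ h1 h2
  rw [real_inner_comm (v t)] at this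
  linarith

/-- The tangential part of the exchange field, expressed by the time derivative `w` of a solution
`v` and the lower order field `f`. -/
noncomputable def exchField (α : ℝ) (v w f : Vec3) : Vec3 :=
  (1 + α ^ 2)⁻¹ • (α • w + cross v w) - perp v f

theorem inner_exchField {v w f : Vec3} (hv : ‖v‖ = 1) (hw : ⟪v, w⟫ = 0) :
    ⟪v, exchField α v w f⟫ = 0 := by
  rw [exchField, inner_sub_right, inner_perp hv, inner_smul_right, inner_add_right,
    inner_smul_right, hw, inner_cross_left]
  ring

theorem llgRhs_exchField {v w f : Vec3} (hv : ‖v‖ = 1) (hw : ⟪v, w⟫ = 0) :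
    llgRhs α v (exchField α v w f + f) = w := by
  have e : exchField α v w f + f
      = (1 + α ^ 2)⁻¹ • (α • w + cross v w) + ⟪v, f⟫ • v := by
    rw [exchField, perp]; abel
  rw [e, llgRhs_add, llgRhs_smul α ⟪v, f⟫, llgRhs_self, smul_zero, add_zero, llgRhs_of_perp hv hw]

/-- This identifies a field defined without spatial derivatives, and hence regular in time, with the
tangential part of the exchange field. -/
theorem exchField_of_llgRhs {v w f D : Vec3} (hv : ‖v‖ = 1)
    (hw : w = llgRhs α v (ε • D + f)) : exchField α v w f = ε • perp v D := by
  rw [exchField, hw, ← perp_eq_of_llgRhs hv, perp_add, perp_smul, add_sub_cancel_right]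

theorem TimeC11.exchField {ι : Type*} {A : Set ι} {v w f : ℝ → ι → Vec3} (hv : TimeC11 T A v)
    (hw : TimeC11 T A w) (hf : TimeC11 T A f) :
    TimeC11 T A (fun t x => exchField α (v t x) (w t x) (f t x)) :=
  (((hw.const_smul α).add (hv.cross hw)).const_smul _).sub (hv.perp hf)

theorem ae_spatialBound (hL : ∀ i, 0 < L i) (hε : 0 < ε)
    {he me v' : ℝ → Space d → Vec3} (h_space : SpaceRegular L T 4 me)
    (h_sol : IsLLGSolution L T α ε Q he me)
    (hv' : ∀ x ∈ closedBox L, ∀ t ∈ Icc 0 T,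
      HasDerivWithinAt (fun s => me s x) (v' t x) (Icc 0 T) t) :
    ∃ K₀, ∀ K, K₀ ≤ K → ∀ᵐ t ∂(volume.restrict (Icc 0 T)), SpatialBound L ε K (me t)
      (fun x => exchField α (me t x) (v' t x) (lowerField Q (me t x) (he t x))) := by
  obtain ⟨M, hM⟩ := h_space
  refine ⟨(5 + 5 * d) * (1 + ε) * (1 + d * (52 + d) * M + (d + 2) * M) ^ 3, fun K hK => ?_⟩
  have hint : ∀ᵐ t ∂(volume.restrict (Icc 0 T)), t ∈ Ioo 0 T := by
    rw [← Measure.restrict_congr_set (Ioo_ae_eq_Icc (μ := volume) (a := (0:ℝ)) (b := T))]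
    exact ae_restrict_mem measurableSet_Ioo
  filter_upwards [hM, hint] with t h1 ht
  have htI := Ioo_subset_Icc_self ht
  have hb : BoundedCn L 4 M (me t) := ⟨h1.1, h1.2⟩
  refine spatialBound_of_boundedCn hL hε (h_sol.neumann t htI) (h_sol.norm_eq_one t htI) hb
    (fun x hx => ?_) hK
  have hxB := openBox_subset_closedBox L hx
  refine exchField_of_llgRhs (h_sol.norm_eq_one t htI x hxB) ?_
  rw [← laplacian_eq_boxLaplacian hL (hb.mono (by norm_num)) hx]
  exact ((hv' x hxB t htI).hasDerivAt (Icc_mem_nhds ht.1 ht.2)).unique (h_sol.equation t ht x hx)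

/-- The bounds in time follow from the algebra of `TimeC11`, with the mesh size as an additional
parameter in (0, 1]. The equation holds on the closed box and at all times, because S is defined by
inverting the right-hand side on tangent vectors. -/
theorem exists_refData (hd : d ≤ 3) (hL : ∀ i, 0 < L i) (hT : 0 < T) (hα : 0 < α) (hε : 0 < ε)
    {he me : ℝ → Space d → Vec3} (h_he : TimeRegular L T 2 he) (h_time : TimeRegular L T 3 me)
    (h_space : SpaceRegular L T 4 me) (h_sol : IsLLGSolution L T α ε Q he me) (c : ℝ) :
    ∃ K, c ≤ K ∧ ∃ v' S z ρ, RefData L T α ε Q K he me v' S z ρ := by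
  obtain ⟨v', hv'T, hv'⟩ := TimeRegular.exists_deriv hT (r := 2) h_time
  have rh : TimeC11 T (closedBox L) he := h_he.timeC11 hT
  have rv : TimeC11 T (closedBox L) me := (h_time.mono (by norm_num)).timeC11 hT
  have rv' : TimeC11 T (closedBox L) v' := hv'T.timeC11 hT
  set S : ℝ → Space d → Vec3 := fun t x =>
    exchField α (me t x) (v' t x) (lowerField Q (me t x) (he t x)) with hS
  have rS : TimeC11 T (closedBox L) S := rv.exchField rv' (rv.lowerField Q rh)
  set s : ℝ → Space d → Vec3 := fun t x => (24 * ε)⁻¹ • S t x with hs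
  have rs : TimeC11 T (closedBox L) s := rS.const_smul _
  set A : Set (ℝ × Space d) := Ioc (0 : ℝ) 1 ×ˢ closedBox L with hA
  have mA : MapsTo Prod.snd A (closedBox L) := fun p hp => hp.2
  have pv := rv.comp mA
  have ps := rs.comp mA
  have ph : ∀ (n : ℕ) (r : ℝ), 0 ≤ r → r ≤ 1 →
      TimeC11 T A (fun _ (p : ℝ × Space d) => p.1 ^ n * r) := by
    intro n r hr0 hr1
    refine TimeC11.of_const (C := 1) fun p hp => ?_
    have h0 : 0 ≤ p.1 := hp.1.1.le
    rw [Real.norm_eq_abs, abs_of_nonneg (by positivity)]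
    exact mul_le_one₀ (pow_le_one₀ h0 hp.1.2) hr0 hr1
  have pss := ps.inner ps
  have p1 : TimeC11 T A (fun _ (_ : ℝ × Space d) => (1 : ℝ)) :=
    TimeC11.of_const (C := 1) fun _ _ => by simp
  have pD : TimeC11 T A (fun t (p : ℝ × Space d) =>
      (1 + p.1 ^ 4 / 4 * ⟪s t p.2, s t p.2⟫)⁻¹) := by
    refine TimeC11.inv (p1.add ?_) fun t _ p _ => ?_
    · simpa [div_eq_mul_inv] using (ph 4 4⁻¹ (by norm_num) (by norm_num)).smul pss
    · have : 0 ≤ ⟪s t p.2, s t p.2⟫ := real_inner_self_nonneg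
      have : 0 ≤ p.1 ^ 4 / 4 * ⟪s t p.2, s t p.2⟫ := by positivity
      linarith
  set z : ℝ → ℝ → Space d → Vec3 := fun t h x => (1 + h ^ 4 / 4 * ⟪s t x, s t x⟫)⁻¹ •
    (-s t x - (h ^ 2 / 2 * ⟪s t x, s t x⟫) • me t x) with hz
  -- Obtained by solving z = -s + h² ρ: the corrections for unit length are of higher order.
  set ρ : ℝ → ℝ → Space d → Vec3 := fun t h x => (1 + h ^ 4 / 4 * ⟪s t x, s t x⟫)⁻¹ •
    ((h ^ 2 / 4 * ⟪s t x, s t x⟫) • s t x - (1 / 2 * ⟪s t x, s t x⟫) • me t x) with hρ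
  have pz : TimeC11 T A (fun t (p : ℝ × Space d) => z t p.1 p.2) := by
    have := pD.smul ((ps.const_smul (-1)).sub
      (((ph 2 2⁻¹ (by norm_num) (by norm_num)).smul pss).smul pv))
    simpa [hz, div_eq_mul_inv] using this
  have pρ : TimeC11 T A (fun t (p : ℝ × Space d) => ρ t p.1 p.2) := by
    have := pD.smul ((((ph 2 4⁻¹ (by norm_num) (by norm_num)).smul pss).smul ps).sub
      ((pss.const_smul (1 / 2)).smul pv))
    simpa [hρ, div_eq_mul_inv] using this
  have pu : TimeC11 T A (fun t (p : ℝ × Space d) => me t p.2 + p.1 ^ 2 • z t p.1 p.2) := by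
    simpa using pv.add ((ph 2 1 zero_le_one le_rfl).smul pz)
  obtain ⟨K₀, hsp⟩ := ae_spatialBound hL hε h_space h_sol hv'
  obtain ⟨K1, k1, b1⟩ := rh
  obtain ⟨K2, k2, b2⟩ := rv
  obtain ⟨K3, k3, b3⟩ := rv'
  obtain ⟨K4, k4, b4⟩ := rS
  obtain ⟨K5, k5, b5⟩ := pz
  obtain ⟨K6, k6, b6⟩ := pρ
  obtain ⟨K7, k7, b7⟩ := pu
  have hεi := inv_pos.2 hε
  set K := |c| + |K₀| + K1 + K2 + K3 + K4 + K5 + K6 + K7 + 1 + 5 * α + ε + ε⁻¹ + |Q| with hK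
  have n1 := abs_nonneg c
  have n2 := abs_nonneg K₀
  have n3 := abs_nonneg Q
  have hvu := h_sol.norm_eq_one
  have horth : ∀ t ∈ Icc 0 T, ∀ x ∈ closedBox L, ⟪me t x, v' t x⟫ = 0 := fun t ht x hx =>
    inner_deriv_eq_zero hT (v := fun t => me t x) (v' := fun t => v' t x)
      (fun s hs => hvu s hs x hx) ht (hv' x hx t ht)
  have hScont : ∀ x ∈ closedBox L, ContinuousOn (fun t => S t x) (Icc 0 T) := by
    intro x hx
    refine LipschitzOnWith.continuousOn (K := K4.toNNReal)
      (LipschitzOnWith.of_dist_le_mul fun t ht r hr => ?_)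
    rw [dist_eq_norm, Real.dist_eq, Real.coe_toNNReal _ k4]
    exact (b4 x hx).lip t ht r hr
  refine ⟨K, by linarith [le_abs_self c], v', S, z, ρ, ?_⟩
  exact
    { one_le := by linarith
      α_pos := hα
      ε_pos := hε
      α_le := by linarith
      ε_le := by linarith
      inv_ε_le := by linarith
      Q_le := by linarith
      d_le := by exact_mod_cast hd
      field := fun x hx => (b1 x hx).mono (by linarith)
      base := fun x hx => (b2 x hx).mono (by linarith)
      deriv := fun x hx => (b3 x hx).mono (by linarith)
      exch := fun x hx => (b4 x hx).mono (by linarith)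
      corr := fun h hh x hx => (b5 (h, x) ⟨hh, hx⟩).mono (by linarith)
      ref := fun h hh x hx => (b7 (h, x) ⟨hh, hx⟩).mono (by linarith)
      corr_eq := fun t ht h hh x hx => by
        refine ⟨?_, ((b6 (h, x) ⟨hh, hx⟩).bound t ht).trans (by linarith)⟩
        have h0 : 0 ≤ ⟪s t x, s t x⟫ := real_inner_self_nonneg
        have hD : 0 < 1 + h ^ 4 / 4 * ⟪s t x, s t x⟫ := by positivity
        have e : -s t x = (1 + h ^ 4 / 4 * ⟪s t x, s t x⟫)⁻¹ •
            (1 + h ^ 4 / 4 * ⟪s t x, s t x⟫) • (-s t x) := by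
          rw [smul_smul, inv_mul_cancel₀ hD.ne', one_smul]
        show z t h x = -s t x + h ^ 2 • ρ t h x
        rw [e]
        simp only [hz, hρ]
        module
      base_unit := hvu
      ref_unit := fun t ht h _ x hx => by
        refine norm_add_correction_eq_one (hvu t ht x hx) ?_ h
        rw [hs, inner_smul_right, inner_exchField (hvu t ht x hx) (horth t ht x hx), mul_zero]
      hasDeriv := hv'
      eqn := fun t ht x hx => llgRhs_exchField (hvu t ht x hx) (horth t ht x hx)
      spatial := fun t ht => SpatialBound.of_ae hT (fun x hx => h_time.continuousOn hx) hScont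
        (hsp K (by linarith [le_abs_self K₀])) ht }

theorem exists_pos_le (hL : ∀ i, 0 < L i) : ∃ c > 0, ∀ i, c ≤ L i := by
  have h0 : ∀ i, 0 ≤ (L i)⁻¹ := fun i => (inv_pos.2 (hL i)).le
  have h1 : 0 ≤ ∑ i, (L i)⁻¹ := Finset.sum_nonneg fun i _ => h0 i
  refine ⟨(∑ i, (L i)⁻¹ + 1)⁻¹, by positivity, fun i => ?_⟩
  refine inv_le_of_inv_le₀ (hL i) ?_
  have := Finset.single_le_sum (fun j _ => h0 j) (Finset.mem_univ i)
  linarith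

theorem h1Sq_sub_comm {N : Fin d → ℕ} (h : ℝ) (f g : GridFun N) :
    h1Sq h (f - g) = h1Sq h (g - f) := by
  simp only [h1Sq, grad_sub, Pi.sub_apply, norm_sub_rev]

end Construction

end LLG

/-! ### Conclusion: from the corrected reference to the exact solution. -/

theorem mainTheorem2 (d : ℕ) (hd : d = 1 ∨ d = 2 ∨ d = 3)
    (L : Fin d → ℝ) (hL : ∀ i, 0 < L i) (T : ℝ) (hT : 0 < T)
    (α ε Q : ℝ) (hα : 0 < α) (hε : 0 < ε)
    (he me : ℝ → LLG.Space d → LLG.Vec3)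
    (h_he : LLG.TimeRegular L T 2 he)
    (h_time : LLG.TimeRegular L T 3 me) (h_space : LLG.SpaceRegular L T 4 me)
    (h_sol : LLG.IsLLGSolution L T α ε Q he me)
    (C₀ C₁ : ℝ) :
    ∃ C > 0, ∃ δ > 0, ∀ (h k : ℝ) (N : Fin d → ℕ),
      0 < h → h < δ → 0 < k → k < δ → k ≤ C₁ * h → (∀ i, (N i : ℝ) * h = L i) →
      ∀ mh ms : ℕ → LLG.GridFun N,
        (∀ I, mh 0 I = me 0 (LLG.center h I)) →
        LLG.h1Norm h (LLG.error h k me mh 0) + LLG.h1Norm h (LLG.error h k me mh 1)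
          ≤ C₀ * (k ^ 2 + h ^ 2) →
        LLG.IsSICNSolution T α ε Q h k he mh ms →
        ∀ n : ℕ, 2 ≤ n → (n : ℝ) * k ≤ T →
          LLG.h1Norm h (LLG.error h k me mh n) ≤ C * (k ^ 2 + h ^ 2) := by
  have hd3 : d ≤ 3 := by omega
  obtain ⟨K, hKL, v', S, z, ρ, hD⟩ :=
    LLG.exists_refData hd3 hL hT hα hε h_he h_time h_space h_sol (∏ i, L i)
  have hK := hD.one_le
  -- One constant must bound the reference data and residuals and also serve in k ≤ K' h; hence the
  -- summand |C₁|.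
  set K' := 100000 * (2000 * K ^ 4) ^ 25 + |C₁| with hK'
  have hKK' : K ≤ K' := by
    have h1 : K ≤ K ^ 100 := by simpa using pow_le_pow_right₀ hK (by norm_num : 1 ≤ 100)
    have h2 : 100000 * (2000 * K ^ 4) ^ 25 = 100000 * 2000 ^ 25 * K ^ 100 := by ring
    have h3 : (1 : ℝ) * K ^ 100 ≤ 100000 * 2000 ^ 25 * K ^ 100 := by gcongr; norm_num
    rw [hK', h2]
    linarith [abs_nonneg C₁]
  have hRK' : 100000 * (2000 * K ^ 4) ^ 25 ≤ K' := by linarith [abs_nonneg C₁]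
  have hC₁K' : C₁ ≤ K' := by
    have : 0 ≤ 100000 * (2000 * K ^ 4) ^ 25 := by positivity
    linarith [le_abs_self C₁]
  clear_value K'
  -- The given starting error contributes 2 C₀² and the correction 2 · 163 K⁵; the summand 1 ensures
  -- B₀ ≥ 1.
  set B₀ := 1 + 2 * C₀ ^ 2 + 326 * K ^ 5 with hB₀
  obtain ⟨C, hC, δ, hδ, hstab⟩ := LLG.exists_stability hd3 L hL K' α ε Q T B₀ (hK.trans hKK') hα hε
    (hD.α_le.trans hKK') (hD.ε_le.trans hKK') (hD.Q_le.trans hKK') hT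
    (by have : 0 ≤ K ^ 5 := by positivity
        linarith [sq_nonneg C₀]) he
  obtain ⟨c, hc, hcL⟩ := LLG.exists_pos_le hL
  refine ⟨Real.sqrt (2 * C + 326 * K ^ 5), by positivity,
    min δ (min 1 (min (c / 2) (c ^ 2 / 4))), by positivity, ?_⟩
  intro h k N hh hhδ hk hkδ hkh hN mh ms hm0 hinit hsol n hn hnT
  simp only [lt_min_iff] at hhδ hkδ
  obtain ⟨hh1, hh2, hh3, -⟩ := hhδ
  obtain ⟨hk1, hk2, -, hk4⟩ := hkδ
  have hhI : h ∈ Ioc (0 : ℝ) 1 := ⟨hh, hh2.le⟩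
  have hhL : ∀ i, 2 * h ≤ L i := fun i => by linarith [hcL i]
  have hkL : ∀ i, 4 * k ≤ L i ^ 2 := fun i => by
    have : c ^ 2 ≤ L i ^ 2 := by
      have := hcL i
      gcongr
    linarith
  have hN2 : ∀ i, 2 ≤ N i := fun i => by
    have h1 : 2 * h ≤ N i * h := (hhL i).trans_eq (hN i).symm
    exact_mod_cast le_of_mul_le_mul_right h1 hh
  set u : ℕ → LLG.GridFun N := fun n => LLG.gridRef me z h (n * k) with hu
  set τ := k ^ 2 + h ^ 2 with hτ
  have hτ0 : 0 ≤ τ := by positivity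
  have hh4 : h ^ 4 ≤ τ ^ 2 := by
    have : h ^ 2 ≤ τ := by rw [hτ]; linarith [sq_nonneg k]
    calc h ^ 4 = (h ^ 2) ^ 2 := by ring
      _ ≤ _ := by gcongr
  have hcorr : ∀ j : ℕ, (j : ℝ) * k ≤ T →
      LLG.h1Sq h (u j - fun I => me (j * k) (LLG.center h I)) ≤ 163 * K ^ 5 * τ ^ 2 := by
    intro j hj
    refine (hD.h1Sq_corr_le ⟨by positivity, hj⟩ hhI hN hN2 hKL).trans ?_
    gcongr
  have herr : ∀ j : ℕ, LLG.error h k me mh j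
      = mh j - fun I => me (j * k) (LLG.center h I) := fun j => rfl
  have hstart : ∀ j : ℕ, (j : ℝ) * k ≤ T → LLG.h1Norm h (LLG.error h k me mh j) ≤ C₀ * τ →
      LLG.h1Sq h (mh j - u j) ≤ B₀ * τ ^ 2 := by
    intro j hj hle
    have h1 : LLG.h1Sq h (LLG.error h k me mh j) ≤ (C₀ * τ) ^ 2 := by
      rw [LLG.h1Norm_eq_sqrt] at hle
      rw [← Real.sq_sqrt (LLG.h1Sq_nonneg hh (LLG.error h k me mh j))]
      gcongr
    have h2 := LLG.h1Sq_add_le hh (LLG.error h k me mh j)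
      ((fun I => me (j * k) (LLG.center h I)) - u j)
    rw [LLG.h1Sq_sub_comm _ (fun I => me (j * k) (LLG.center h I)), herr, sub_add_sub_cancel,
      ← herr] at h2
    have h3 := hcorr j hj
    have h4 : (C₀ * τ) ^ 2 = C₀ ^ 2 * τ ^ 2 := by ring
    have h5 : B₀ * τ ^ 2 = τ ^ 2 + 2 * (C₀ ^ 2 * τ ^ 2) + 2 * (163 * K ^ 5 * τ ^ 2) := by
      rw [hB₀]; ring
    linarith [sq_nonneg τ]
  have hn2 : (2 : ℝ) ≤ n := by exact_mod_cast hn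
  have hT1 : ((1 : ℕ) : ℝ) * k ≤ T := by
    push_cast; nlinarith
  have hT0 : ((0 : ℕ) : ℝ) * k ≤ T := by
    push_cast; linarith
  have hn0 := Real.sqrt_nonneg (LLG.h1Sq h (LLG.error h k me mh 0))
  have hn1 := Real.sqrt_nonneg (LLG.h1Sq h (LLG.error h k me mh 1))
  rw [← LLG.h1Norm_eq_sqrt] at hn0 hn1
  have hfin := hstab h k N hh hh1 hk hk1 (hkh.trans (by gcongr)) hN u mh ms
    (fun j hj hjT => hD.refAt hhI hk hk2.le hN hN2 hL hhL hkL hKL hRK' hj hjT) hsol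
    (hstart 0 hT0 (by linarith)) (hstart 1 hT1 (by linarith)) n hn hnT
  have hadd := LLG.h1Sq_add_le hh (mh n - u n) (u n - fun I => me (n * k) (LLG.center h I))
  rw [sub_add_sub_cancel, ← herr] at hadd
  have h3 := hcorr n hnT
  rw [LLG.h1Norm_eq_sqrt]
  refine Real.sqrt_le_iff.2 ⟨by positivity, ?_⟩
  rw [mul_pow, Real.sq_sqrt (by positivity)]
  linarith
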